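/- Let $\alpha>0$, $\alpha\neq 1$, and let $U^\alpha=\{(z_1,z_2)\in\mathbb C^2: |z_1|^{2/\alpha}+|z_2|^2<1\}$, equipped with Lebesgue measure $\sigma$. For $z,w\in U^\alpha$ and $a$ in the unit disc put $$f_\alpha(z)=\frac{z_1}{(1-|z_2|^2)^{\alpha/2}},\qquad \varphi_{z_2}(w)=\left(w_1\left(\frac{\sqrt{1-|z_2|^2}}{1-\bar z_2w_2}\right)^{\alpha},\ \frac{z_2-w_2}{1-\bar z_2w_2}\right),$$ with the principal branch of the power, and $$\phi_a(w)=\left(m,\ w_2\,\frac{\sqrt{1-|a|^2}}{1-\bar a w_1}\sqrt{\frac{(1-|w_1|^2)(1-|m|^{2/\alpha})}{(1-|w_1|^{2/\alpha})(1-|m|^2)}}\right),\qquad m=\frac{a-w_1}{1-\bar a w_1}.$$ Let $A^2(U^\alpha)$ be the closed subspace of holomorphic functions in $L^2(U^\alpha)$, and let $P:L^2(U^\alpha)\to A^2(U^\alpha)$ be the orthogonal projection. Let $4<p\le\infty$ and let $u:U^\alpha\to\mathbb C$ be a measurable function with $$\sup_{z\in U^\alpha}\bigl\|\,u(z)-u(\varphi_{z_2}(\phi_{f_\alpha(z)}(\cdot)))\bigr\|_{L^p(U^\alpha)}<\infty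 .$$ Then the Hankel operator $H_uf=(I-P)(uf)$, with natural domain $\{f\in A^2(U^\alpha): uf\in L^2(U^\alpha)\}$, is densely defined in $A^2(U^\alpha)$ and extends to a bounded linear operator from $A^2(U^\alpha)$ to $L^2(U^\alpha)$. -/

import Mathlib

open MeasureTheory Set Filter Topology Metric
open scoped ENNReal ComplexConjugate

namespace Thullen

noncomputable section

/-- Multiplication by a unimodular scalar preserves Lebesgue measure on `ℂ²`. -/
theorem rot_mp (θ : ℝ) : MeasurePreserving (fun w : ℂ × ℂ => circleMap 0 1 θ • w) := by
  have h : MeasurePreserving (fun w : ℂ => circleMap 0 1 θ * w) := by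
    convert (rotation (Circle.exp θ)).measurePreserving using 2
    simp [circleMap]
  exact h.prod h

/-- Sub-mean value inequality for the squared modulus of a holomorphic function. -/
theorem sq_mean_value {g : ℂ × ℂ → ℂ} {c : ℂ × ℂ} {ρ : ℝ}
    (hg : DifferentiableOn ℂ g (ball c ρ)) :
    ‖g c‖ₑ ^ 2 * volume (ball (0 : ℂ × ℂ) ρ) ≤ ∫⁻ w in ball c ρ, ‖g w‖ₑ ^ 2 := by
  classical
  have : (volume : Measure (ℂ × ℂ)).IsAddLeftInvariant := by
    rw [Measure.volume_eq_prod]; infer_instance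
  set B := ball (0 : ℂ × ℂ) ρ with hB
  have hmem : ∀ w ∈ B, ∀ l : ℂ, ‖l‖ ≤ 1 → c + l • w ∈ ball c ρ := by
    intro w hw l hl
    rw [hB, mem_ball_zero_iff] at hw
    rw [mem_ball_iff_norm, add_sub_cancel_left, norm_smul]
    nlinarith [norm_nonneg w, norm_nonneg l]
  let F : ℂ × ℂ → ℝ≥0∞ := B.indicator fun w => ‖g (c + w)‖ₑ ^ 2
  have hFm : Measurable F := by
    have hc : ContinuousOn (fun w => ‖g (c + w)‖ₑ ^ 2) B := by
      have : ContinuousOn (fun w => g (c + w)) B :=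
        hg.continuousOn.comp (by fun_prop) fun w hw => by simpa using hmem w hw 1 (by simp)
      exact (ENNReal.continuous_pow 2).comp_continuousOn this.enorm
    exact hc.measurable_piecewise continuousOn_const isOpen_ball.measurableSet
  have h1 : ∫⁻ w in ball c ρ, ‖g w‖ₑ ^ 2 = ∫⁻ w, F w := by
    rw [lintegral_indicator isOpen_ball.measurableSet, ← lintegral_indicator isOpen_ball.measurableSet,
      ← lintegral_indicator isOpen_ball.measurableSet,
      ← lintegral_add_left_eq_self (μ := volume) _ c]
    refine lintegral_congr fun w => ?_
    by_cases hw : w ∈ B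
    · have : c + w ∈ ball c ρ := by simpa using hmem w hw 1 (by simp)
      rw [indicator_of_mem hw, indicator_of_mem this]
    · have : c + w ∉ ball c ρ := by simpa [mem_ball_iff_norm, hB] using hw
      rw [indicator_of_notMem hw, indicator_of_notMem this]
  have h2 : ∀ θ : ℝ, ∫⁻ w, F (circleMap 0 1 θ • w) = ∫⁻ w, F w := fun θ =>
    (rot_mp θ).lintegral_comp hFm
  have h3 : ∀ w ∈ B, ENNReal.ofReal (2 * Real.pi) * ‖g c‖ₑ ^ 2 ≤
      ∫⁻ θ in Ioc 0 (2 * Real.pi), F (circleMap 0 1 θ • w) := by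
    intro w hw
    have hd : DiffContOnCl ℂ (fun l : ℂ => g (c + l • w) ^ 2) (ball 0 |1|) := by
      refine DifferentiableOn.diffContOnCl ?_
      rw [abs_one, closure_ball _ one_ne_zero]
      refine DifferentiableOn.pow (hg.comp (by fun_prop) fun l hl => ?_) 2
      exact hmem w hw l (by simpa using hl)
    have hav := hd.circleAverage
    rw [Real.circleAverage_def, intervalIntegral.integral_of_le (by positivity)] at hav
    have hF : ∀ θ : ℝ, F (circleMap 0 1 θ • w) = ‖g (c + circleMap 0 1 θ • w) ^ 2‖ₑ := by
      intro θ
      have : circleMap 0 1 θ • w ∈ B := by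
        rw [hB, mem_ball_zero_iff, norm_smul]; simpa [hB] using hw
      simp [F, indicator_of_mem this]
    simp_rw [hF]
    refine le_trans (le_of_eq ?_) (enorm_integral_le_lintegral_enorm _)
    have hpi : (2 * Real.pi) ≠ 0 := by positivity
    have : ∫ θ in Ioc 0 (2 * Real.pi), g (c + circleMap 0 1 θ • w) ^ 2
        = (2 * Real.pi) • (g c ^ 2) := by
      rw [inv_smul_eq_iff₀ hpi] at hav
      simpa using hav
    rw [this, enorm_smul, enorm_pow, Real.enorm_eq_ofReal (by positivity)]
  have h4 : ∫⁻ θ in Ioc 0 (2 * Real.pi), ∫⁻ w, F (circleMap 0 1 θ • w)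
      = ∫⁻ w, ∫⁻ θ in Ioc 0 (2 * Real.pi), F (circleMap 0 1 θ • w) := by
    refine lintegral_lintegral_swap (Measurable.aemeasurable ?_)
    refine hFm.comp ?_
    have : Continuous fun p : ℝ × (ℂ × ℂ) => circleMap 0 1 p.1 • p.2 := by
      have := continuous_circleMap 0 1
      fun_prop
    exact this.measurable
  simp_rw [h2] at h4
  rw [lintegral_const, Measure.restrict_apply_univ, Real.volume_Ioc, sub_zero] at h4
  have h5 : (ENNReal.ofReal (2 * Real.pi) * ‖g c‖ₑ ^ 2) * volume B ≤
      ∫⁻ w, ∫⁻ θ in Ioc 0 (2 * Real.pi), F (circleMap 0 1 θ • w) := by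
    rw [← setLIntegral_const]
    refine (setLIntegral_mono' isOpen_ball.measurableSet h3).trans (setLIntegral_le_lintegral _ _)
  rw [← h4, mul_comm (∫⁻ w, F w), mul_assoc] at h5
  rw [h1]
  exact (ENNReal.mul_le_mul_iff_right (by simp [Real.pi_pos]) ENNReal.ofReal_ne_top).1 h5


/-- The Bergman space `A²(U)`: the square-integrable holomorphic functions on `U`, as a subspace of
`L²(U)` with respect to Lebesgue measure. -/
def bergmanSpace (U : Set (ℂ × ℂ)) : Submodule ℂ (Lp ℂ 2 (volume.restrict U)) where
  carrier := {f | ∃ g : ℂ × ℂ → ℂ, DifferentiableOn ℂ g U ∧ f =ᵐ[volume.restrict U] g}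
  zero_mem' := ⟨0, differentiableOn_const 0, Lp.coeFn_zero _ _ _⟩
  add_mem' := by
    rintro f₁ f₂ ⟨g₁, h₁, e₁⟩ ⟨g₂, h₂, e₂⟩
    exact ⟨g₁ + g₂, h₁.add h₂, (Lp.coeFn_add f₁ f₂).trans (e₁.add e₂)⟩
  smul_mem' := by
    rintro c f ⟨g, h, e⟩
    exact ⟨c • g, h.const_smul c, (Lp.coeFn_smul c f).trans (e.const_smul c)⟩

/-- Point evaluations are locally uniformly bounded on the Bergman space. -/
theorem eval_bound {U : Set (ℂ × ℂ)} {z₀ : ℂ × ℂ} {r : ℝ} (hr : 0 < r)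
    (hU : ball z₀ (2 * r) ⊆ U) :
    ∃ C : ℝ, 0 < C ∧ ∀ (f : Lp ℂ 2 (volume.restrict U)) (g : ℂ × ℂ → ℂ),
      DifferentiableOn ℂ g U → f =ᵐ[volume.restrict U] g → ∀ z ∈ ball z₀ r, ‖g z‖ ≤ C * ‖f‖ := by
  set V := volume (ball (0 : ℂ × ℂ) r) with hV
  have hV0 : V ≠ 0 := (measure_ball_pos _ _ hr).ne'
  have hVt : V ≠ ∞ := measure_ball_lt_top.ne
  have hVp : 0 < V.toReal := ENNReal.toReal_pos hV0 hVt
  refine ⟨(Real.sqrt V.toReal)⁻¹, by positivity, fun f g hg hfg z hz => ?_⟩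
  have hzU : ball z r ⊆ U := by
    refine Subset.trans (fun w hw => ?_) hU
    rw [mem_ball] at *
    linarith [dist_triangle w z z₀]
  have h1 := sq_mean_value (hg.mono hzU)
  have h2 : ∫⁻ w in ball z r, ‖g w‖ₑ ^ 2 ≤ ‖f‖ₑ ^ 2 := by
    refine (lintegral_mono_set hzU).trans (le_of_eq ?_)
    rw [Lp.enorm_def, eLpNorm_congr_ae hfg]
    have := eLpNorm_nnreal_pow_eq_lintegral (f := g) (μ := volume.restrict U) (p := 2) (by norm_num)
    simpa using this.symm
  have h3 := ENNReal.toReal_mono (by simp) (h1.trans h2)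
  rw [ENNReal.toReal_mul, ENNReal.toReal_pow, ENNReal.toReal_pow, toReal_enorm, toReal_enorm] at h3
  rw [inv_mul_eq_div, le_div_iff₀ (by positivity)]
  refine abs_le_of_sq_le_sq' ?_ (norm_nonneg _) |>.2
  rw [mul_pow, Real.sq_sqrt hVp.le]
  exact h3

/-- The Bergman space of an open set is closed in `L²`. -/
theorem isClosed_bergmanSpace {U : Set (ℂ × ℂ)} (hU : IsOpen U) :
    IsClosed (bergmanSpace U : Set (Lp ℂ 2 (volume.restrict U))) := by
  refine IsSeqClosed.isClosed fun x f hx hxf => ?_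
  choose g hg hge using hx
  have hxc : CauchySeq x := hxf.cauchySeq
  have hloc : ∀ z₀ ∈ U, ∃ r > 0, ball z₀ r ⊆ U ∧ UniformCauchySeqOn g atTop (ball z₀ r) ∧
      UniformCauchySeqOn (fun n => fderiv ℂ (g n)) atTop (ball z₀ r) := by
    intro z₀ hz₀
    obtain ⟨R, hR, hRU⟩ := Metric.isOpen_iff.1 hU z₀ hz₀
    have hr : 0 < R / 2 := by positivity
    obtain ⟨C, hC, hb⟩ := eval_bound hr (U := U) (z₀ := z₀) (by convert hRU using 2; ring)
    have hd : ∀ n m, ∀ z ∈ ball z₀ (R / 2), ‖g n z - g m z‖ ≤ C * ‖x n - x m‖ := fun n m z hz =>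
      hb (x n - x m) (g n - g m) ((hg n).sub (hg m))
        ((Lp.coeFn_sub _ _).trans ((hge n).sub (hge m))) z hz
    have hsub : ball z₀ (R / 4) ⊆ ball z₀ (R / 2) := ball_subset_ball (by linarith)
    have hsubU : ball z₀ (R / 2) ⊆ U := (ball_subset_ball (by linarith)).trans hRU
    have hd' : ∀ n m, ∀ z ∈ ball z₀ (R / 4),
        ‖fderiv ℂ (g n) z - fderiv ℂ (g m) z‖ ≤ (2 * (C * ‖x n - x m‖)) / (R / 4) := by
      intro n m z hz
      have hzb : ball z (R / 4) ⊆ ball z₀ (R / 2) := by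
        intro w hw
        rw [mem_ball] at *
        linarith [dist_triangle w z z₀]
      have hzU : U ∈ 𝓝 z := hU.mem_nhds (hsubU (hsub hz))
      rw [← fderiv_sub ((hg n).differentiableAt hzU) ((hg m).differentiableAt hzU)]
      refine Complex.norm_fderiv_le_div_of_mapsTo_ball
        (((hg n).sub (hg m)).mono (hzb.trans hsubU)) (fun w hw => ?_) (by positivity)
      rw [mem_closedBall, dist_eq_norm]
      refine (norm_sub_le _ _).trans ?_
      have h1 := hd n m w (hzb hw)
      have h2 := hd n m z (hsub hz)
      simp only [Pi.sub_apply]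
      linarith
    refine ⟨R / 4, by positivity, hsub.trans hsubU, ?_, ?_⟩
    · rw [Metric.uniformCauchySeqOn_iff]
      intro ε hε
      obtain ⟨N, hN⟩ := Metric.cauchySeq_iff.1 hxc (ε / C) (by positivity)
      refine ⟨N, fun m hm n hn z hz => ?_⟩
      have := hN m hm n hn
      rw [dist_eq_norm] at *
      calc _ ≤ C * ‖x m - x n‖ := hd m n z (hsub hz)
        _ < C * (ε / C) := by gcongr
        _ = ε := by field_simp
    · rw [Metric.uniformCauchySeqOn_iff]
      intro ε hε
      obtain ⟨N, hN⟩ := Metric.cauchySeq_iff.1 hxc (ε * (R / 4) / (2 * C)) (by positivity)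
      refine ⟨N, fun m hm n hn z hz => ?_⟩
      have := hN m hm n hn
      rw [dist_eq_norm] at *
      calc _ ≤ (2 * (C * ‖x m - x n‖)) / (R / 4) := hd' m n z hz
        _ < (2 * (C * (ε * (R / 4) / (2 * C)))) / (R / 4) := by gcongr
        _ = ε := by field_simp
  have hG : ∀ z, ∃ y, z ∈ U → Tendsto (fun n => g n z) atTop (𝓝 y) := by
    intro z
    by_cases hz : z ∈ U
    · obtain ⟨r, hr, -, h1, -⟩ := hloc z hz
      obtain ⟨y, hy⟩ := cauchySeq_tendsto_of_complete (h1.cauchySeq (mem_ball_self hr))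
      exact ⟨y, fun _ => hy⟩
    · exact ⟨0, fun h => absurd h hz⟩
  choose G hG using hG
  have hL : ∀ z, ∃ y, z ∈ U → Tendsto (fun n => fderiv ℂ (g n) z) atTop (𝓝 y) := by
    intro z
    by_cases hz : z ∈ U
    · obtain ⟨r, hr, -, -, h1⟩ := hloc z hz
      obtain ⟨y, hy⟩ := cauchySeq_tendsto_of_complete (h1.cauchySeq (mem_ball_self hr))
      exact ⟨y, fun _ => hy⟩
    · exact ⟨0, fun h => absurd h hz⟩
  choose L hL using hL
  refine ⟨G, fun z hz => ?_, ?_⟩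
  · obtain ⟨r, hr, hrU, -, h2⟩ := hloc z hz
    refine (hasFDerivAt_of_tendstoUniformlyOn isOpen_ball
      (h2.tendstoUniformlyOn_of_tendsto fun w hw => hL w (hrU hw))
      (fun n w hw => ((hg n).differentiableAt (hU.mem_nhds (hrU hw))).hasFDerivAt)
      (fun w hw => hG w (hrU hw)) (mem_ball_self hr)).differentiableAt.differentiableWithinAt
  · obtain ⟨φ, hφ, hae⟩ := (tendstoInMeasure_of_tendsto_Lp hxf).exists_seq_tendsto_ae
    filter_upwards [hae, ae_all_iff.2 hge, ae_restrict_mem hU.measurableSet] with z h1 h2 h3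
    refine tendsto_nhds_unique h1 ?_
    simp_rw [h2]
    exact (hG z h3).comp hφ.tendsto_atTop

theorem hasOrthogonalProjection_bergmanSpace {U : Set (ℂ × ℂ)} (hU : IsOpen U) :
    (bergmanSpace U).HasOrthogonalProjection :=
  have : CompleteSpace (bergmanSpace U) := (isClosed_bergmanSpace hU).completeSpace_coe
  inferInstance

/-- The Bergman projection `P`: the orthogonal projection of `L²(U)` onto `A²(U)`. -/
def bergmanProjection {U : Set (ℂ × ℂ)} (hU : IsOpen U) :
    Lp ℂ 2 (volume.restrict U) →L[ℂ] Lp ℂ 2 (volume.restrict U) :=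
  have := hasOrthogonalProjection_bergmanSpace hU
  (bergmanSpace U).starProjection

theorem mul_add_ae {U : Set (ℂ × ℂ)} (u : ℂ × ℂ → ℂ) (f g : Lp ℂ 2 (volume.restrict U)) :
    (fun w => u w * (f + g) w) =ᵐ[volume.restrict U]
      (fun w => u w * f w) + fun w => u w * g w := by
  filter_upwards [Lp.coeFn_add f g] with w hw
  rw [hw]
  exact mul_add _ _ _

theorem mul_smul_ae {U : Set (ℂ × ℂ)} (u : ℂ × ℂ → ℂ) (c : ℂ)
    (f : Lp ℂ 2 (volume.restrict U)) :
    (fun w => u w * (c • f) w) =ᵐ[volume.restrict U] c • fun w => u w * f w := by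
  filter_upwards [Lp.coeFn_smul c f] with w hw
  rw [hw]
  exact mul_left_comm _ _ _

/-- The natural domain `{f ∈ A²(U) : u f ∈ L²(U)}` of multiplication by `u`. -/
def mulDomain (U : Set (ℂ × ℂ)) (u : ℂ × ℂ → ℂ) : Submodule ℂ (bergmanSpace U) where
  carrier := {f | MemLp (fun w => u w * (f : Lp ℂ 2 (volume.restrict U)) w) 2 (volume.restrict U)}
  zero_mem' := by
    refine (memLp_congr_ae ?_).2 (MemLp.zero (ε := ℂ))
    filter_upwards [Lp.coeFn_zero ℂ 2 (volume.restrict U)] with w hw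
    rw [ZeroMemClass.coe_zero, hw]
    exact mul_zero _
  add_mem' := fun {f g} hf hg => (memLp_congr_ae (mul_add_ae u f.1 g.1)).2 (MemLp.add hf hg)
  smul_mem' := fun c f hf => (memLp_congr_ae (mul_smul_ae u c f.1)).2 (MemLp.const_smul hf c)

theorem memLp_of_mulDomain {U : Set (ℂ × ℂ)} {u : ℂ × ℂ → ℂ} (f : mulDomain U u) :
    MemLp (fun w => u w * (f.1.1 : Lp ℂ 2 (volume.restrict U)) w) 2 (volume.restrict U) := f.2

/-- Multiplication `M_u f = u f`, with values in `L²(U)`, on its natural domain in `A²(U)`. -/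
def mulMap (U : Set (ℂ × ℂ)) (u : ℂ × ℂ → ℂ) :
    mulDomain U u →ₗ[ℂ] Lp ℂ 2 (volume.restrict U) where
  toFun f := MemLp.toLp (fun w => u w * (f.1.1 : Lp ℂ 2 (volume.restrict U)) w)
    (memLp_of_mulDomain f)
  map_add' f g := by
    rw [← MemLp.toLp_add]
    exact MemLp.toLp_congr _ _ (mul_add_ae u f.1.1 g.1.1)
  map_smul' c f := by
    rw [RingHom.id_apply, ← MemLp.toLp_const_smul]
    exact MemLp.toLp_congr _ _ (mul_smul_ae u c f.1.1)

/-- The Hankel operator `H_u = (I - P) M_u` from `A²(U)` to `L²(U)`, on its natural domain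
`{f ∈ A²(U) : u f ∈ L²(U)}`. -/
def hankel {U : Set (ℂ × ℂ)} (hU : IsOpen U) (u : ℂ × ℂ → ℂ) :
    bergmanSpace U →ₗ.[ℂ] Lp ℂ 2 (volume.restrict U) where
  domain := mulDomain U u
  toFun := (ContinuousLinearMap.id ℂ _ - bergmanProjection hU).toLinearMap ∘ₗ mulMap U u

/-- The Thullen domain `U^α = {(z₁, z₂) ∈ ℂ² : |z₁|^(2/α) + |z₂|² < 1}`. -/
def thullenDomain (α : ℝ) : Set (ℂ × ℂ) :=
  {z | ‖z.1‖ ^ (2 / α) + ‖z.2‖ ^ 2 < 1}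

theorem isOpen_thullenDomain {α : ℝ} (hα : 0 < α) : IsOpen (thullenDomain α) := by
  have h : Continuous fun z : ℂ × ℂ => ‖z.1‖ ^ (2 / α) :=
    (Real.continuous_rpow_const (by positivity)).comp (by fun_prop)
  exact isOpen_lt (h.add (by fun_prop)) continuous_const

/-- The Möbius involution `t ↦ (a - t) / (1 - conj a * t)` of the unit disc. -/
def moebius (a t : ℂ) : ℂ := (a - t) / (1 - conj a * t)

/-- The map `φ_a` (used with `a = z₂`), a holomorphic automorphism of `U^α`. The power is the
principal branch; its base has positive real part on `U^α`. -/
def varphiMap (α : ℝ) (a : ℂ) (w : ℂ × ℂ) : ℂ × ℂ :=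
  (w.1 * ((Real.sqrt (1 - ‖a‖ ^ 2) : ℂ) / (1 - conj a * w.2)) ^ (α : ℂ), moebius a w.2)

/-- The map `ϕ_a` (used with `a = f_α(z)`), in general a non-holomorphic bijection of `U^α`. -/
def phiMap (α : ℝ) (a : ℂ) (w : ℂ × ℂ) : ℂ × ℂ :=
  (moebius a w.1,
    w.2 * ((Real.sqrt (1 - ‖a‖ ^ 2) : ℂ) / (1 - conj a * w.1)) *
      (Real.sqrt (((1 - ‖w.1‖ ^ 2) * (1 - ‖moebius a w.1‖ ^ (2 / α))) /
        ((1 - ‖w.1‖ ^ (2 / α)) * (1 - ‖moebius a w.1‖ ^ 2))) : ℂ))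

/-- `f_α(z) = z₁ / (1 - |z₂|²)^(α/2)`. -/
def fAlpha (α : ℝ) (z : ℂ × ℂ) : ℂ :=
  z.1 / (((1 - ‖z.2‖ ^ 2) ^ (α / 2) : ℝ) : ℂ)

end

end Thullen

/-! Write K for `kernel`, the Bergman kernel normalised to be holomorphic in its second argument, so
that Pf(z) = ∫ conj K(z,w) f(w) dw. For f in A² the same integral returns f(z), hence H_u f(z) = ∫
(u(z) - u(w)) conj K(z,w) f(w) dw (`hankel_ae_eq`). Boundedness therefore follows from Schur's test
for the symmetric kernel |u(z) - u(w)| |K(z,w)|, once some h > 0 satisfies ∫ |u(z) - u(w)| |K(z,w)|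
h(w) dw ≤ A h(z).

The hypothesis on u enters by a change of variables. Put a = f_α(z). The map ϕ_a preserves the
domain and sends 0 to (a, 0), and the automorphism φ_{z₂} sends (a, 0) to z; their composite T_z
sends 0 to z. Substituting T_z in the Schur integral with h = `schurFun`, the two Jacobians, the
kernel and h combine into at most a constant times h(z) times `schurWeight` (`kernel_weight_bound`).
Hölder then separates the norm of u(z) - u ∘ T_z in L^p, bounded by assumption, from the norm of the
weight in L^q, with q conjugate to p.

The weight is bounded in L^q uniformly in z when q < 4/3, that is p > 4
(`exists_lintegral_schurWeight_le`). Integrating over the fibres of the first coordinate leaves |a -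
x|^(-λ) on the disc, integrable for λ < 2. The estimates need λ slightly above both 3q - 2 and
(2/α)(3(α + 2)q/4 - 2), and each of these is below 2 exactly when q < 4/3.

The kernel is computed on the first axis, where only the monomials z₁ⁿ matter and the reproducing
property is a Taylor expansion; the automorphisms φ carry it to every point
(`integral_conj_kernel_mul`).

For density, T_0 is w ↦ -w, so the hypothesis at z = 0 puts u in L². The functions K(z, ·) are
bounded, hence lie in the domain, and a Bergman function orthogonal to all of them vanishes. -/

namespace Thullen

/-! ### Möbius involutions of the disc -/

theorem norm_sq_one_sub_sub (a t : ℂ) :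
    ‖1 - conj a * t‖ ^ 2 - ‖a - t‖ ^ 2 = (1 - ‖a‖ ^ 2) * (1 - ‖t‖ ^ 2) := by
  simp only [← Complex.normSq_eq_norm_sq, Complex.normSq_apply]
  simp
  ring

theorem one_sub_norm_le (a t : ℂ) : 1 - ‖a‖ * ‖t‖ ≤ ‖1 - conj a * t‖ := by
  have := norm_sub_norm_le (1 : ℂ) (conj a * t)
  simpa using this

theorem one_sub_conj_mul_norm_pos {a t : ℂ} (ha : ‖a‖ < 1) (ht : ‖t‖ < 1) :
    0 < ‖1 - conj a * t‖ := by
  have := one_sub_norm_le a t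
  nlinarith [norm_nonneg a, norm_nonneg t]

theorem one_sub_conj_mul_ne_zero {a t : ℂ} (ha : ‖a‖ < 1) (ht : ‖t‖ < 1) :
    1 - conj a * t ≠ 0 := norm_pos_iff.1 (one_sub_conj_mul_norm_pos ha ht)

theorem one_sub_sq_pos {a : ℂ} (ha : ‖a‖ < 1) : 0 < 1 - ‖a‖ ^ 2 := by
  nlinarith [norm_nonneg a]

theorem one_sub_norm_moebius_sq {a t : ℂ} (ha : ‖a‖ < 1) (ht : ‖t‖ < 1) :
    1 - ‖moebius a t‖ ^ 2 = (1 - ‖a‖ ^ 2) * (1 - ‖t‖ ^ 2) / ‖1 - conj a * t‖ ^ 2 := by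
  have h := one_sub_conj_mul_norm_pos ha ht
  rw [moebius, norm_div, div_pow, ← norm_sq_one_sub_sub, sub_div, div_self (by positivity)]

theorem norm_moebius_lt_one {a t : ℂ} (ha : ‖a‖ < 1) (ht : ‖t‖ < 1) : ‖moebius a t‖ < 1 := by
  have h := one_sub_norm_moebius_sq ha ht
  have : 0 < 1 - ‖moebius a t‖ ^ 2 := by
    rw [h]
    exact div_pos (mul_pos (one_sub_sq_pos ha) (one_sub_sq_pos ht))
      (pow_pos (one_sub_conj_mul_norm_pos ha ht) 2)
  nlinarith [norm_nonneg (moebius a t)]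

theorem conj_mul_self_eq (a : ℂ) : conj a * a = ((‖a‖ ^ 2 : ℝ) : ℂ) := by
  rw [mul_comm, Complex.mul_conj, Complex.normSq_eq_norm_sq]

theorem one_sub_conj_mul_moebius {a t : ℂ} (ha : ‖a‖ < 1) (ht : ‖t‖ < 1) :
    1 - conj a * moebius a t = ((1 - ‖a‖ ^ 2 : ℝ) : ℂ) / (1 - conj a * t) := by
  have h := one_sub_conj_mul_ne_zero ha ht
  rw [moebius, eq_div_iff h]
  field_simp
  push_cast
  have := conj_mul_self_eq a
  push_cast at this
  linear_combination -this

theorem moebius_moebius {a t : ℂ} (ha : ‖a‖ < 1) (ht : ‖t‖ < 1) :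
    moebius a (moebius a t) = t := by
  have h := one_sub_conj_mul_ne_zero ha ht
  have h2 : ((1 - ‖a‖ ^ 2 : ℝ) : ℂ) ≠ 0 := by exact_mod_cast (one_sub_sq_pos ha).ne'
  have h3 := conj_mul_self_eq a
  rw [moebius, one_sub_conj_mul_moebius ha ht, moebius, div_div_eq_mul_div, div_eq_iff h2,
    sub_mul, div_mul_cancel₀ _ h]
  push_cast at *
  linear_combination -t * h3

theorem hasDerivAt_moebius {a t : ℂ} (ha : ‖a‖ < 1) (ht : ‖t‖ < 1) :
    HasDerivAt (moebius a) (-((1 - ‖a‖ ^ 2 : ℝ) : ℂ) / (1 - conj a * t) ^ 2) t := by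
  have h := one_sub_conj_mul_ne_zero ha ht
  have h1 : HasDerivAt (fun x : ℂ => a - x) (-1) t := by
    simpa using (hasDerivAt_id t).const_sub a
  have h2 : HasDerivAt (fun x : ℂ => 1 - conj a * x) (-conj a) t := by
    simpa using ((hasDerivAt_id t).const_mul (conj a)).const_sub 1
  have h3 := conj_mul_self_eq a
  have h4 : -((1 - ‖a‖ ^ 2 : ℝ) : ℂ) = -1 * (1 - conj a * t) - (a - t) * -conj a := by
    push_cast at *
    linear_combination -h3
  rw [h4]
  exact h1.div h2 h

theorem measurable_moebius (a : ℂ) : Measurable (moebius a) := by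
  unfold moebius; fun_prop

theorem image_moebius_ball {a : ℂ} (ha : ‖a‖ < 1) :
    moebius a '' ball 0 1 = ball 0 1 := by
  ext y
  simp only [mem_image, mem_ball_zero_iff]
  exact ⟨fun ⟨x, hx, e⟩ => e ▸ norm_moebius_lt_one ha hx, fun hy =>
    ⟨_, norm_moebius_lt_one ha hy, moebius_moebius ha hy⟩⟩

theorem injOn_moebius {a : ℂ} (ha : ‖a‖ < 1) : InjOn (moebius a) (ball 0 1) := by
  intro x hx y hy h
  rw [mem_ball_zero_iff] at hx hy
  rw [← moebius_moebius ha hx, h, moebius_moebius ha hy]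

/-! ### Holomorphic changes of variables -/

/-- The real determinant of multiplication by f'(x) is the norm of f'(x) from ℂ to ℝ, that is
|f'(x)|². -/
theorem lintegral_image_holomorphic {s : Set ℂ} (hs : MeasurableSet s) {f f' : ℂ → ℂ}
    (hf : ∀ x ∈ s, HasDerivAt f (f' x) x) (hi : InjOn f s) (g : ℂ → ℝ≥0∞) :
    ∫⁻ x in f '' s, g x = ∫⁻ x in s, ENNReal.ofReal (‖f' x‖ ^ 2) * g (f x) := by
  rw [lintegral_image_eq_lintegral_abs_det_fderiv_mul volume hs
    (fun x hx => ((hf x hx).hasFDerivAt.restrictScalars ℝ).hasFDerivWithinAt) hi]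
  refine lintegral_congr fun x => ?_
  congr 2
  simp only [ContinuousLinearMap.det]
  erw [LinearMap.det_restrictScalars]
  have := ContinuousLinearMap.det_toSpanSingleton (f' x)
  rw [ContinuousLinearMap.det] at this
  erw [this]
  rw [Algebra.norm_complex_apply, Complex.normSq_eq_norm_sq, abs_of_nonneg (by positivity)]

theorem lintegral_moebius {a : ℂ} (ha : ‖a‖ < 1) (g : ℂ → ℝ≥0∞) :
    ∫⁻ x in ball 0 1, g x =
      ∫⁻ x in ball 0 1, ENNReal.ofReal (((1 - ‖a‖ ^ 2) / ‖1 - conj a * x‖ ^ 2) ^ 2) *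
        g (moebius a x) := by
  conv_lhs => rw [← image_moebius_ball ha]
  rw [lintegral_image_holomorphic isOpen_ball.measurableSet
    (fun x hx => hasDerivAt_moebius ha (mem_ball_zero_iff.1 hx)) (injOn_moebius ha)]
  refine lintegral_congr fun x => ?_
  rw [norm_div, norm_neg, norm_pow, Complex.norm_real, Real.norm_of_nonneg (one_sub_sq_pos ha).le]

theorem lintegral_ball_mul {c : ℂ} (hc : c ≠ 0) (ρ : ℝ) (g : ℂ → ℝ≥0∞) :
    ∫⁻ y in ball 0 (‖c‖ * ρ), g y =
      ENNReal.ofReal (‖c‖ ^ 2) * ∫⁻ y in ball 0 ρ, g (y * c) := by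
  have : ball (0 : ℂ) (‖c‖ * ρ) = (fun y => y * c) '' ball 0 ρ := by
    ext y
    simp only [mem_image, mem_ball_zero_iff]
    constructor
    · intro h
      refine ⟨y / c, ?_, by field_simp⟩
      rw [norm_div, div_lt_iff₀ (norm_pos_iff.2 hc), mul_comm]
      exact h
    · rintro ⟨x, hx, rfl⟩
      rw [norm_mul, mul_comm]
      have := norm_pos_iff.2 hc
      gcongr
  rw [this, lintegral_image_holomorphic isOpen_ball.measurableSet (f' := fun _ => c)
    (fun x _ => by simpa using (hasDerivAt_id x).mul_const c)
    (fun x _ y _ h => mul_right_cancel₀ hc h),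
    lintegral_const_mul' _ _ ENNReal.ofReal_ne_top]

/-- Integration over a domain fibred over the unit disc by discs centred at the origin. -/
theorem lintegral_fibred {T : ℂ → ℝ}
    (hV : MeasurableSet {p : ℂ × ℂ | ‖p.1‖ < 1 ∧ ‖p.2‖ < T p.1})
    {G : ℂ × ℂ → ℝ≥0∞} (hG : Measurable G) :
    ∫⁻ p in {p : ℂ × ℂ | ‖p.1‖ < 1 ∧ ‖p.2‖ < T p.1}, G p =
      ∫⁻ x in ball 0 1, ∫⁻ y in ball 0 (T x), G (x, y) := by
  rw [← lintegral_indicator hV, Measure.volume_eq_prod,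
    lintegral_prod _ (hG.indicator hV).aemeasurable, ← lintegral_indicator isOpen_ball.measurableSet]
  refine lintegral_congr fun x => ?_
  by_cases hx : ‖x‖ < 1
  · rw [indicator_of_mem (mem_ball_zero_iff.2 hx), ← lintegral_indicator isOpen_ball.measurableSet]
    refine lintegral_congr fun y => ?_
    by_cases hy : ‖y‖ < T x
    · rw [indicator_of_mem (mem_ball_zero_iff.2 hy), indicator_of_mem]
      exact ⟨hx, hy⟩
    · rw [indicator_of_notMem (s := ball _ _) (by simpa using hy), indicator_of_notMem]
      exact fun h : _ ∧ _ => hy h.2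
  · rw [indicator_of_notMem (s := ball _ _) (by simpa using hx), lintegral_congr (g := 0), lintegral_zero_fun]
    intro y
    rw [indicator_of_notMem]
    · rfl
    · exact fun h : _ ∧ _ => hx h.1

/-- Change of variables under a fibred map covering a Möbius involution of the base disc. -/
theorem lintegral_fibred_moebius {T : ℂ → ℝ}
    (hV : MeasurableSet {p : ℂ × ℂ | ‖p.1‖ < 1 ∧ ‖p.2‖ < T p.1})
    (hT : ∀ x, ‖x‖ < 1 → 0 < T x) {a : ℂ} (ha : ‖a‖ < 1) {c : ℂ → ℂ} (hc : Measurable c)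
    (hcT : ∀ x, ‖x‖ < 1 → ‖c x‖ * T x = T (moebius a x))
    {G : ℂ × ℂ → ℝ≥0∞} (hG : Measurable G) :
    ∫⁻ p in {p : ℂ × ℂ | ‖p.1‖ < 1 ∧ ‖p.2‖ < T p.1}, G p =
      ∫⁻ p in {p : ℂ × ℂ | ‖p.1‖ < 1 ∧ ‖p.2‖ < T p.1},
        ENNReal.ofReal (((1 - ‖a‖ ^ 2) / ‖1 - conj a * p.1‖ ^ 2) ^ 2 * ‖c p.1‖ ^ 2) *
          G (moebius a p.1, p.2 * c p.1) := by
  have hm := measurable_moebius a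
  rw [lintegral_fibred hV hG, lintegral_fibred hV (by fun_prop), lintegral_moebius ha]
  refine setLIntegral_congr_fun isOpen_ball.measurableSet fun x hx => ?_
  rw [mem_ball_zero_iff] at hx
  have hc0 : c x ≠ 0 := by
    intro h
    have := hT _ (norm_moebius_lt_one ha hx)
    rw [← hcT x hx, h] at this
    simp at this
  simp only
  rw [← hcT x hx, lintegral_ball_mul hc0, lintegral_const_mul' _ _ ENNReal.ofReal_ne_top,
    ENNReal.ofReal_mul (by positivity), mul_assoc]

end Thullen

namespace Thullen

/-! ### Slices of the Thullen domain -/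

theorem rpow_lt_one_iff_norm {α : ℝ} (hα : 0 < α) (x : ℂ) : ‖x‖ ^ (2 / α) < 1 ↔ ‖x‖ < 1 := by
  have := Real.rpow_lt_rpow_iff (norm_nonneg x) zero_le_one (show 0 < 2 / α by positivity)
  rwa [Real.one_rpow] at this

theorem one_sub_rpow_pos {α : ℝ} (hα : 0 < α) {x : ℂ} (hx : ‖x‖ < 1) :
    0 < 1 - ‖x‖ ^ (2 / α) := by
  have := (rpow_lt_one_iff_norm hα x).2 hx
  linarith

theorem mem_thullenDomain_iff_snd {α : ℝ} (hα : 0 < α) (z : ℂ × ℂ) :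
    z ∈ thullenDomain α ↔ ‖z.1‖ < 1 ∧ ‖z.2‖ < √(1 - ‖z.1‖ ^ (2 / α)) := by
  rw [thullenDomain, mem_ofPred_eq, Real.lt_sqrt (norm_nonneg _), ← rpow_lt_one_iff_norm hα]
  constructor
  · intro h
    constructor <;> nlinarith [sq_nonneg ‖z.2‖]
  · rintro ⟨-, h⟩
    linarith

/-- The domain fibres over either coordinate disc. `varphiMap` covers a Möbius map of the second
coordinate and needs this slicing; `phiMap` covers one of the first and needs the other. -/
theorem mem_thullenDomain_iff_fst {α : ℝ} (hα : 0 < α) (z : ℂ × ℂ) :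
    z ∈ thullenDomain α ↔ ‖z.2‖ < 1 ∧ ‖z.1‖ < (1 - ‖z.2‖ ^ 2) ^ (α / 2) := by
  have key : 0 ≤ 1 - ‖z.2‖ ^ 2 →
      (‖z.1‖ < (1 - ‖z.2‖ ^ 2) ^ (α / 2) ↔ ‖z.1‖ ^ (2 / α) < 1 - ‖z.2‖ ^ 2) := by
    intro h
    have := Real.lt_rpow_inv_iff_of_pos (norm_nonneg z.1) h (show 0 < 2 / α by positivity)
    rwa [inv_div] at this
  rw [thullenDomain, mem_ofPred_eq]
  have h0 : 0 ≤ ‖z.1‖ ^ (2 / α) := Real.rpow_nonneg (norm_nonneg _) _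
  constructor
  · intro h
    have h2 : ‖z.2‖ ^ 2 < 1 := by linarith
    exact ⟨by nlinarith [norm_nonneg z.2], (key (by linarith)).2 (by linarith)⟩
  · rintro ⟨h1, h⟩
    have := (key (by nlinarith [norm_nonneg z.2])).1 h
    linarith

theorem thullenDomain_eq_fibred {α : ℝ} (hα : 0 < α) :
    thullenDomain α = {p : ℂ × ℂ | ‖p.1‖ < 1 ∧ ‖p.2‖ < √(1 - ‖p.1‖ ^ (2 / α))} :=
  Set.ext (mem_thullenDomain_iff_snd hα)

theorem measurableSet_thullenDomain {α : ℝ} (hα : 0 < α) : MeasurableSet (thullenDomain α) :=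
  (isOpen_thullenDomain hα).measurableSet

theorem norm_fst_lt_one {α : ℝ} (hα : 0 < α) {z : ℂ × ℂ} (hz : z ∈ thullenDomain α) :
    ‖z.1‖ < 1 := ((mem_thullenDomain_iff_snd hα z).1 hz).1

theorem norm_snd_lt_one {α : ℝ} (hα : 0 < α) {z : ℂ × ℂ} (hz : z ∈ thullenDomain α) :
    ‖z.2‖ < 1 := ((mem_thullenDomain_iff_fst hα z).1 hz).1

theorem volume_thullenDomain_lt_top {α : ℝ} (hα : 0 < α) : volume (thullenDomain α) < ∞ := by
  refine (measure_mono (t := ball 0 1) fun z hz => ?_).trans_lt measure_ball_lt_top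
  rw [mem_ball_zero_iff, Prod.norm_def]
  exact max_lt (norm_fst_lt_one hα hz) (norm_snd_lt_one hα hz)

theorem lintegral_thullenDomain {α : ℝ} (hα : 0 < α) {G : ℂ × ℂ → ℝ≥0∞} (hG : Measurable G) :
    ∫⁻ w in thullenDomain α, G w =
      ∫⁻ x in ball 0 1, ENNReal.ofReal (1 - ‖x‖ ^ (2 / α)) *
        ∫⁻ ζ in ball 0 1, G (x, ζ * (√(1 - ‖x‖ ^ (2 / α)) : ℂ)) := by
  have hm := measurableSet_thullenDomain hα
  rw [thullenDomain_eq_fibred hα] at hm ⊢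
  refine (lintegral_fibred (T := fun x => √(1 - ‖x‖ ^ (2 / α))) hm hG).trans ?_
  refine setLIntegral_congr_fun isOpen_ball.measurableSet fun x hx => ?_
  have h := one_sub_rpow_pos hα (mem_ball_zero_iff.1 hx)
  have h0 : (√(1 - ‖x‖ ^ (2 / α)) : ℂ) ≠ 0 := by exact_mod_cast (Real.sqrt_pos.2 h).ne'
  have := lintegral_ball_mul h0 1 (fun y => G (x, y))
  rw [mul_one, Complex.norm_real, Real.norm_of_nonneg (Real.sqrt_nonneg _), Real.sq_sqrt h.le]
    at this
  exact this

/-! ### The defining function `1 - |w₁|^(2/α) - |w₂|²` and the maps `varphiMap`, `phiMap` -/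

/-- The defining function of the Thullen domain. -/
noncomputable def defFun (α : ℝ) (w : ℂ × ℂ) : ℝ := 1 - ‖w.1‖ ^ (2 / α) - ‖w.2‖ ^ 2

theorem defFun_pos_iff {α : ℝ} (w : ℂ × ℂ) : 0 < defFun α w ↔ w ∈ thullenDomain α := by
  rw [defFun, thullenDomain, mem_ofPred_eq]
  constructor <;> intro h <;> linarith

/-- The Jacobian ratio of a Möbius involution. -/
noncomputable def moebiusJac (a x : ℂ) : ℝ := (1 - ‖a‖ ^ 2) / ‖1 - conj a * x‖ ^ 2

theorem moebiusJac_pos {a x : ℂ} (ha : ‖a‖ < 1) (hx : ‖x‖ < 1) : 0 < moebiusJac a x :=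
  div_pos (one_sub_sq_pos ha) (pow_pos (one_sub_conj_mul_norm_pos ha hx) 2)

theorem one_sub_norm_moebius_sq' {a x : ℂ} (ha : ‖a‖ < 1) (hx : ‖x‖ < 1) :
    1 - ‖moebius a x‖ ^ 2 = moebiusJac a x * (1 - ‖x‖ ^ 2) := by
  rw [one_sub_norm_moebius_sq ha hx, moebiusJac]; ring

/-- The squared dilation factor of `phiMap` on the second coordinate. -/
noncomputable def fibreScale (α : ℝ) (a x : ℂ) : ℝ :=
  (1 - ‖moebius a x‖ ^ (2 / α)) / (1 - ‖x‖ ^ (2 / α))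

theorem fibreScale_pos {α : ℝ} (hα : 0 < α) {a x : ℂ} (ha : ‖a‖ < 1) (hx : ‖x‖ < 1) :
    0 < fibreScale α a x :=
  div_pos (one_sub_rpow_pos hα (norm_moebius_lt_one ha hx)) (one_sub_rpow_pos hα hx)

/-- The factor by which `varphiMap` multiplies the first coordinate. -/
noncomputable def varphiFactor (α : ℝ) (b y : ℂ) : ℂ :=
  ((Real.sqrt (1 - ‖b‖ ^ 2) : ℂ) / (1 - conj b * y)) ^ (α : ℂ)

theorem norm_varphiFactor {α : ℝ} {b : ℂ} (hb : ‖b‖ < 1) (y : ℂ) :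
    ‖varphiFactor α b y‖ = moebiusJac b y ^ (α / 2) := by
  have h := (one_sub_sq_pos hb).le
  have h1 : moebiusJac b y = (√(1 - ‖b‖ ^ 2) / ‖1 - conj b * y‖) ^ 2 := by
    rw [moebiusJac, div_pow, Real.sq_sqrt h]
  rw [varphiFactor, Complex.norm_cpow_real, norm_div, Complex.norm_real,
    Real.norm_of_nonneg (Real.sqrt_nonneg _), h1, ← Real.rpow_natCast (_ / _),
    ← Real.rpow_mul (by positivity)]
  congr 1
  push_cast; ring

theorem varphiMap_eq (α : ℝ) (b : ℂ) (w : ℂ × ℂ) :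
    varphiMap α b w = (w.1 * varphiFactor α b w.2, moebius b w.2) := rfl

/-- The factor by which `phiMap` multiplies the second coordinate. -/
noncomputable def phiFactor (α : ℝ) (a x : ℂ) : ℂ :=
  ((Real.sqrt (1 - ‖a‖ ^ 2) : ℂ) / (1 - conj a * x)) *
    (Real.sqrt (((1 - ‖x‖ ^ 2) * (1 - ‖moebius a x‖ ^ (2 / α))) /
      ((1 - ‖x‖ ^ (2 / α)) * (1 - ‖moebius a x‖ ^ 2))) : ℂ)

theorem phiMap_eq (α : ℝ) (a : ℂ) (w : ℂ × ℂ) :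
    phiMap α a w = (moebius a w.1, w.2 * phiFactor α a w.1) := by
  rw [phiMap, phiFactor, mul_assoc]

theorem norm_phiFactor_sq {α : ℝ} (hα : 0 < α) {a x : ℂ} (ha : ‖a‖ < 1) (hx : ‖x‖ < 1) :
    ‖phiFactor α a x‖ ^ 2 = fibreScale α a x := by
  have h1 := one_sub_sq_pos ha
  have h2 := one_sub_sq_pos hx
  have h3 := one_sub_sq_pos (norm_moebius_lt_one ha hx)
  have h4 := one_sub_rpow_pos hα (norm_moebius_lt_one ha hx)
  have h5 := one_sub_rpow_pos hα hx
  have h6 := one_sub_conj_mul_norm_pos ha hx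
  rw [phiFactor, norm_mul, norm_div, Complex.norm_real, Complex.norm_real,
    Real.norm_of_nonneg (Real.sqrt_nonneg _), Real.norm_of_nonneg (Real.sqrt_nonneg _), mul_pow,
    div_pow, Real.sq_sqrt h1.le, Real.sq_sqrt (by positivity), fibreScale,
    one_sub_norm_moebius_sq' ha hx, moebiusJac]
  field_simp

theorem measurable_varphiFactor (α : ℝ) (b : ℂ) : Measurable (varphiFactor α b) := by
  unfold varphiFactor; fun_prop

theorem measurable_phiFactor (α : ℝ) (a : ℂ) : Measurable (phiFactor α a) := by
  have := measurable_moebius a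
  unfold phiFactor; fun_prop

theorem measurable_varphiMap (α : ℝ) (b : ℂ) : Measurable (varphiMap α b) := by
  have h1 := measurable_varphiFactor α b
  have h2 := measurable_moebius b
  simp_rw [funext (varphiMap_eq α b)]
  fun_prop

theorem measurable_phiMap (α : ℝ) (a : ℂ) : Measurable (phiMap α a) := by
  have h1 := measurable_phiFactor α a
  have h2 := measurable_moebius a
  simp_rw [funext (phiMap_eq α a)]
  fun_prop

theorem one_sub_norm_varphiMap_snd {α : ℝ} {b : ℂ} (hb : ‖b‖ < 1) {w : ℂ × ℂ} (hw : ‖w.2‖ < 1) :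
    1 - ‖(varphiMap α b w).2‖ ^ 2 = moebiusJac b w.2 * (1 - ‖w.2‖ ^ 2) :=
  one_sub_norm_moebius_sq' hb hw

/-- Under `varphiMap` the quantities |w₁|^(2/α) and 1 - |w₂|² are multiplied by the same factor, so
their difference is too. This gives invariance of the domain and the transformation of the Schur
test function. -/
theorem defFun_varphiMap {α : ℝ} (hα : 0 < α) {b : ℂ} (hb : ‖b‖ < 1) {w : ℂ × ℂ}
    (hw : ‖w.2‖ < 1) : defFun α (varphiMap α b w) = moebiusJac b w.2 * defFun α w := by
  have h := one_sub_norm_varphiMap_snd (α := α) hb hw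
  have h1 : ‖(varphiMap α b w).1‖ ^ (2 / α) = moebiusJac b w.2 * ‖w.1‖ ^ (2 / α) := by
    have h0 := (moebiusJac_pos hb hw).le
    rw [varphiMap_eq, norm_mul, norm_varphiFactor hb,
      Real.mul_rpow (norm_nonneg _) (Real.rpow_nonneg h0 _), ← Real.rpow_mul h0,
      show α / 2 * (2 / α) = 1 by field_simp, Real.rpow_one, mul_comm]
  rw [defFun, defFun, h1]
  linarith

/-- The square root correcting `phiMap` makes |w₂|² scale by the ratio of the values of 1 -
|·|^(2/α) at the new and the old first coordinate. -/
theorem defFun_phiMap {α : ℝ} (hα : 0 < α) {a : ℂ} (ha : ‖a‖ < 1) {w : ℂ × ℂ}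
    (hw : ‖w.1‖ < 1) : defFun α (phiMap α a w) = fibreScale α a w.1 * defFun α w := by
  have h := one_sub_rpow_pos hα hw
  rw [defFun, defFun, phiMap_eq, norm_mul, mul_pow, norm_phiFactor_sq hα ha hw, fibreScale]
  field_simp

theorem varphiMap_mem {α : ℝ} (hα : 0 < α) {b : ℂ} (hb : ‖b‖ < 1) {w : ℂ × ℂ}
    (hw : w ∈ thullenDomain α) : varphiMap α b w ∈ thullenDomain α := by
  have h := norm_snd_lt_one hα hw
  rw [← defFun_pos_iff] at *
  rw [defFun_varphiMap hα hb h]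
  exact mul_pos (moebiusJac_pos hb h) hw

theorem phiMap_mem {α : ℝ} (hα : 0 < α) {a : ℂ} (ha : ‖a‖ < 1) {w : ℂ × ℂ}
    (hw : w ∈ thullenDomain α) : phiMap α a w ∈ thullenDomain α := by
  have h := norm_fst_lt_one hα hw
  rw [← defFun_pos_iff] at *
  rw [defFun_phiMap hα ha h]
  exact mul_pos (fibreScale_pos hα ha h) hw

/-! ### Changes of variables -/

/-- After exchanging the coordinates this is a fibred map: the base contributes the square of
`moebiusJac` and the fibre dilation its power α. -/
theorem lintegral_varphiMap {α : ℝ} (hα : 0 < α) {b : ℂ} (hb : ‖b‖ < 1) {G : ℂ × ℂ → ℝ≥0∞}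
    (hG : Measurable G) :
    ∫⁻ w in thullenDomain α, G w =
      ∫⁻ w in thullenDomain α,
        ENNReal.ofReal (moebiusJac b w.2 ^ (α + 2)) * G (varphiMap α b w) := by
  set V := {p : ℂ × ℂ | ‖p.1‖ < 1 ∧ ‖p.2‖ < (1 - ‖p.1‖ ^ 2) ^ (α / 2)}
  have hV : Prod.swap ⁻¹' thullenDomain α = V := Set.ext fun p => mem_thullenDomain_iff_fst hα _
  have hVm : MeasurableSet V := by
    rw [← hV]; exact measurable_swap (measurableSet_thullenDomain hα)
  have hswap : ∀ F : ℂ × ℂ → ℝ≥0∞, ∫⁻ w in thullenDomain α, F w = ∫⁻ p in V, F p.swap := by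
    intro F
    have := (Measure.measurePreserving_swap (μ := (volume : Measure ℂ))
      (ν := (volume : Measure ℂ))).setLIntegral_comp_preimage_emb
      MeasurableEquiv.prodComm.measurableEmbedding F (thullenDomain α)
    rw [← hV]
    exact this.symm
  rw [hswap, hswap]
  refine (lintegral_fibred_moebius (T := fun x => (1 - ‖x‖ ^ 2) ^ (α / 2)) hVm
    (fun x hx => Real.rpow_pos_of_pos (one_sub_sq_pos hx) _) hb (measurable_varphiFactor α b)
    (fun x hx => ?_) (hG.comp measurable_swap)).trans ?_
  · rw [norm_varphiFactor hb, one_sub_norm_moebius_sq' hb hx,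
      Real.mul_rpow (moebiusJac_pos hb hx).le (one_sub_sq_pos hx).le]
  · refine setLIntegral_congr_fun hVm fun p hp => ?_
    simp only [varphiMap_eq, Prod.fst_swap, Prod.snd_swap, Prod.swap_prod_mk, Function.comp]
    congr 2
    have h0 := moebiusJac_pos hb hp.1
    rw [norm_varphiFactor hb, ← Real.rpow_natCast (moebiusJac b p.1 ^ (α / 2)),
      ← Real.rpow_mul h0.le, Real.rpow_add h0, mul_comm, Real.rpow_two]
    congr 2
    push_cast; ring

/-- Although `phiMap` need not be holomorphic, it is holomorphic on the base and multiplication by a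
constant on each fibre. The fibre Jacobian is `fibreScale`. -/
theorem lintegral_phiMap {α : ℝ} (hα : 0 < α) {a : ℂ} (ha : ‖a‖ < 1) {G : ℂ × ℂ → ℝ≥0∞}
    (hG : Measurable G) :
    ∫⁻ w in thullenDomain α, G w =
      ∫⁻ w in thullenDomain α,
        ENNReal.ofReal (moebiusJac a w.1 ^ 2 * fibreScale α a w.1) * G (phiMap α a w) := by
  have hm := measurableSet_thullenDomain hα
  rw [thullenDomain_eq_fibred hα] at hm ⊢
  refine (lintegral_fibred_moebius (T := fun x => √(1 - ‖x‖ ^ (2 / α))) hm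
    (fun x hx => Real.sqrt_pos.2 (one_sub_rpow_pos hα hx)) ha
    (measurable_phiFactor α a) (fun x hx => ?_) hG).trans ?_
  · rw [← Real.sqrt_sq (norm_nonneg (phiFactor α a x)), norm_phiFactor_sq hα ha hx,
      ← Real.sqrt_mul (fibreScale_pos hα ha hx).le, fibreScale,
      div_mul_cancel₀ _ (one_sub_rpow_pos hα hx).ne']
  · refine setLIntegral_congr_fun hm fun p hp => ?_
    simp only [phiMap_eq]
    rw [norm_phiFactor_sq hα ha hp.1, moebiusJac]

/-- The formula applied to the indicator of a null set shows that its preimage is null. This allows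
u, known only up to null sets, to be composed with the transport maps. -/
theorem quasiMeasurePreserving_of_lintegral {X : Type*} [MeasurableSpace X] {μ : Measure X}
    {F : X → X} (hF : Measurable F) {J : X → ℝ≥0∞} (hJm : Measurable J) (hJ : ∀ᵐ x ∂μ, J x ≠ 0)
    (h : ∀ G : X → ℝ≥0∞, Measurable G → ∫⁻ x, G x ∂μ = ∫⁻ x, J x * G (F x) ∂μ) :
    Measure.QuasiMeasurePreserving F μ μ := by
  refine ⟨hF, Measure.AbsolutelyContinuous.mk fun s hs h0 => ?_⟩
  rw [Measure.map_apply hF hs]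
  have h1 := h (s.indicator 1) (measurable_one.indicator hs)
  rw [lintegral_indicator_one hs, h0, eq_comm,
    lintegral_eq_zero_iff (f := fun x => J x * s.indicator 1 (F x))
      (hJm.mul ((measurable_one.indicator hs).comp hF))] at h1
  rw [← compl_compl (F ⁻¹' s), ← mem_ae_iff]
  filter_upwards [h1, hJ] with x hx hJx hxs
  rw [mem_preimage] at hxs
  simp [hxs, hJx] at hx

theorem quasiMeasurePreserving_varphiMap {α : ℝ} (hα : 0 < α) {b : ℂ} (hb : ‖b‖ < 1) :
    Measure.QuasiMeasurePreserving (varphiMap α b) (volume.restrict (thullenDomain α))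
      (volume.restrict (thullenDomain α)) := by
  refine quasiMeasurePreserving_of_lintegral (measurable_varphiMap α b)
    (J := fun w => ENNReal.ofReal (moebiusJac b w.2 ^ (α + 2))) ?_ ?_
    fun G hG => lintegral_varphiMap hα hb hG
  · unfold moebiusJac; fun_prop
  · filter_upwards [ae_restrict_mem (measurableSet_thullenDomain hα)] with w hw
    simpa using Real.rpow_pos_of_pos (moebiusJac_pos hb (norm_snd_lt_one hα hw)) _

theorem quasiMeasurePreserving_phiMap {α : ℝ} (hα : 0 < α) {a : ℂ} (ha : ‖a‖ < 1) :
    Measure.QuasiMeasurePreserving (phiMap α a) (volume.restrict (thullenDomain α))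
      (volume.restrict (thullenDomain α)) := by
  refine quasiMeasurePreserving_of_lintegral (measurable_phiMap α a)
    (J := fun w => ENNReal.ofReal (moebiusJac a w.1 ^ 2 * fibreScale α a w.1)) ?_ ?_
    fun G hG => lintegral_phiMap hα ha hG
  · have := measurable_moebius a
    unfold moebiusJac fibreScale; fun_prop
  · filter_upwards [ae_restrict_mem (measurableSet_thullenDomain hα)] with w hw
    have hw1 := norm_fst_lt_one hα hw
    simpa using mul_pos (pow_pos (moebiusJac_pos ha hw1) 2) (fibreScale_pos hα ha hw1)

end Thullen

namespace Thullen

/-! ### Comparison of `1 - |x|^(2/α)` with `1 - |x|²` -/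

/-- For β ≥ 1 use x^β ≤ x; for β ≤ 1 use Bernoulli's inequality for x = 1 + (x - 1). -/
theorem min_mul_one_sub_le {β x : ℝ} (hβ : 0 < β) (hx0 : 0 ≤ x) (hx1 : x ≤ 1) :
    min 1 β * (1 - x) ≤ 1 - x ^ β := by
  rcases le_total 1 β with h | h
  · rw [min_eq_left h]
    have := Real.rpow_le_rpow_of_exponent_ge' hx0 hx1 zero_le_one h
    rw [Real.rpow_one] at this
    linarith
  · rw [min_eq_right h]
    have := rpow_one_add_le_one_add_mul_self (s := x - 1) (by linarith) hβ.le h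
    rw [add_sub_cancel] at this
    linarith

theorem one_sub_rpow_le_max_mul {β x : ℝ} (hβ : 0 < β) (hx0 : 0 ≤ x) (hx1 : x ≤ 1) :
    1 - x ^ β ≤ max 1 β * (1 - x) := by
  rcases le_total 1 β with h | h
  · rw [max_eq_right h]
    have := one_add_mul_self_le_rpow_one_add (s := x - 1) (by linarith) h
    rw [add_sub_cancel] at this
    linarith
  · rw [max_eq_left h]
    have := Real.rpow_le_rpow_of_exponent_ge' hx0 hx1 hβ.le h
    rw [Real.rpow_one] at this
    linarith

theorem norm_rpow_two_div (α : ℝ) (x : ℂ) : ‖x‖ ^ (2 / α) = (‖x‖ ^ 2) ^ (1 / α) := by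
  rw [← Real.rpow_natCast, ← Real.rpow_mul (norm_nonneg _)]
  congr 1; push_cast; ring

theorem one_sub_rpow_le_mul {α : ℝ} (hα : 0 < α) {x : ℂ} (hx : ‖x‖ < 1) :
    1 - ‖x‖ ^ (2 / α) ≤ max 1 (1 / α) * (1 - ‖x‖ ^ 2) := by
  rw [norm_rpow_two_div]
  exact one_sub_rpow_le_max_mul (by positivity) (by positivity) (by linarith [one_sub_sq_pos hx])

theorem mul_le_one_sub_rpow {α : ℝ} (hα : 0 < α) {x : ℂ} (hx : ‖x‖ < 1) :
    min 1 (1 / α) * (1 - ‖x‖ ^ 2) ≤ 1 - ‖x‖ ^ (2 / α) := by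
  rw [norm_rpow_two_div]
  exact min_mul_one_sub_le (by positivity) (by positivity) (by linarith [one_sub_sq_pos hx])

/-- Numerator and denominator are comparable to the corresponding values of 1 - |·|², whose ratio is
exactly `moebiusJac`. An upper bound suffices, since it is applied to a power 1 - t > 0. -/
theorem fibreScale_le {α : ℝ} (hα : 0 < α) {a x : ℂ} (ha : ‖a‖ < 1) (hx : ‖x‖ < 1) :
    fibreScale α a x ≤ max 1 (1 / α) / min 1 (1 / α) * moebiusJac a x := by
  have hm : 0 < min 1 (1 / α) := by positivity
  have h1 := one_sub_rpow_le_mul hα (norm_moebius_lt_one ha hx)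
  have h2 := mul_le_one_sub_rpow hα hx
  have h3 := one_sub_rpow_pos hα hx
  have h4 := moebiusJac_pos ha hx
  rw [fibreScale, div_le_iff₀ h3]
  rw [one_sub_norm_moebius_sq' ha hx] at h1
  refine h1.trans ?_
  calc _ = max 1 (1 / α) / min 1 (1 / α) * moebiusJac a x * (min 1 (1 / α) * (1 - ‖x‖ ^ 2)) := by
        field_simp
    _ ≤ _ := by gcongr

/-! ### Integrals of singular kernels over the disc -/

/-- The squared modulus is (1 - s)² + 2s(1 - cos θ), and 1 - cos θ ≥ 2(θ/π)². The bound is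
independent of s, which decouples radius and angle in polar coordinates. -/
theorem abs_div_pi_le_norm {s θ : ℝ} (hs0 : 0 ≤ s) (hθ : |θ| ≤ Real.pi) :
    |θ| / Real.pi ≤ ‖1 - (s : ℂ) * (Real.cos θ + Real.sin θ * Complex.I)‖ := by
  refine abs_le_of_sq_le_sq' ?_ (norm_nonneg _) |>.2
  have h : ‖1 - (s : ℂ) * (Real.cos θ + Real.sin θ * Complex.I)‖ ^ 2
      = 1 - 2 * s * Real.cos θ + s ^ 2 := by
    rw [← Complex.normSq_eq_norm_sq, Complex.normSq_apply]
    simp [-Complex.ofReal_cos, -Complex.ofReal_sin]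
    nlinarith [Real.sin_sq_add_cos_sq θ]
  have hc := Real.cos_le_one_sub_mul_cos_sq hθ
  have hpi := Real.pi_pos
  set y := (|θ| / Real.pi) ^ 2 with hy
  have hy' : 2 / Real.pi ^ 2 * θ ^ 2 = 2 * y := by
    rw [hy, div_pow, sq_abs]; ring
  rw [hy'] at hc
  have hy0 : 0 ≤ y := by positivity
  have hy1 : y ≤ 1 := by
    have : |θ| / Real.pi ≤ 1 := (div_le_one hpi).2 hθ
    have h0 : 0 ≤ |θ| / Real.pi := by positivity
    rw [hy]; nlinarith
  rw [h]
  -- With y = (θ/π)², the quantity (1 - s)² + 4sy - y equals (1 - y)(1 - s)² + y(2s + s²).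
  nlinarith [mul_nonneg (sub_nonneg.2 hy1) (sq_nonneg (1 - s)), mul_nonneg hs0 (sub_nonneg.2 hc),
    mul_nonneg hy0 hs0, mul_nonneg hy0 (sq_nonneg s)]

theorem lintegral_rpow_neg_lt_top {η : ℝ} (hη : η < 1) (b : ℝ) :
    ∫⁻ x in Ioc 0 b, ENNReal.ofReal (x ^ (-η)) < ∞ := by
  rcases le_total b 0 with h | h
  · simp [Ioc_eq_empty_of_le h]
  have : IntervalIntegrable (fun x : ℝ => x ^ (-η)) volume 0 b :=
    intervalIntegral.intervalIntegrable_rpow' (by linarith)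
  rw [intervalIntegrable_iff_integrableOn_Ioc_of_le h] at this
  exact this.lintegral_lt_top

theorem lintegral_one_sub_rpow_neg_lt_top {η : ℝ} (hη : η < 1) :
    ∫⁻ x in Ioo 0 1, ENNReal.ofReal ((1 - x) ^ (-η)) < ∞ := by
  have : IntervalIntegrable (fun x : ℝ => x ^ (-η)) volume 0 1 :=
    intervalIntegral.intervalIntegrable_rpow' (by linarith)
  have h := (this.comp_sub_left 1).symm
  simp only [sub_zero, sub_self] at h
  rw [intervalIntegrable_iff_integrableOn_Ioc_of_le zero_le_one] at h
  exact (lintegral_mono_set Ioo_subset_Ioc_self).trans_lt h.lintegral_lt_top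

theorem lintegral_abs_rpow_neg_lt_top {η : ℝ} (hη : η < 1) :
    ∫⁻ θ in Ioo (-Real.pi) Real.pi, ENNReal.ofReal ((|θ| / Real.pi) ^ (-η)) < ∞ := by
  have hpi := Real.pi_pos
  have h1 : IntervalIntegrable (fun x : ℝ => (|x| / Real.pi) ^ (-η)) volume 0 Real.pi := by
    have : IntervalIntegrable (fun x : ℝ => x ^ (-η) / Real.pi ^ (-η)) volume 0 Real.pi :=
      (intervalIntegral.intervalIntegrable_rpow' (by linarith)).div_const _
    refine this.congr fun x hx => ?_
    rw [uIoc_of_le hpi.le] at hx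
    rw [abs_of_pos hx.1, Real.div_rpow hx.1.le hpi.le]
  have h2 : IntervalIntegrable (fun x : ℝ => (|x| / Real.pi) ^ (-η)) volume (-Real.pi) 0 := by
    have := (h1.comp_sub_left 0).symm
    simpa only [zero_sub, abs_neg, sub_zero] using this
  have h := h2.trans h1
  rw [intervalIntegrable_iff_integrableOn_Ioc_of_le (by linarith)] at h
  exact (lintegral_mono_set Ioo_subset_Ioc_self).trans_lt h.lintegral_lt_top

/-- Once the integrand is dominated by a radial times an angular function, Tonelli splits the
integral. The angle 0 is exempted because a negative real power takes the default value 0 there and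
would not dominate. -/
theorem lintegral_ball_polar (F : ℂ → ℝ≥0∞) (R : ℝ) (A B : ℝ → ℝ≥0∞) (hA : Measurable A)
    (hB : Measurable B)
    (h : ∀ r ∈ Ioo 0 R, ∀ θ ∈ Ioo (-Real.pi) Real.pi, θ ≠ 0 →
      ENNReal.ofReal r * F (r * (Real.cos θ + Real.sin θ * Complex.I)) ≤ A r * B θ) :
    ∫⁻ x in ball 0 R, F x ≤ (∫⁻ r in Ioo 0 R, A r) * ∫⁻ θ in Ioo (-Real.pi) Real.pi, B θ := by
  rw [← lintegral_indicator isOpen_ball.measurableSet, ← Complex.lintegral_comp_polarCoord_symm]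
  change ∫⁻ p in Ioi (0 : ℝ) ×ˢ Ioo (-Real.pi) Real.pi, _ ≤ _
  calc _ ≤ ∫⁻ p in Ioi (0 : ℝ) ×ˢ Ioo (-Real.pi) Real.pi, (Ioo 0 R).indicator A p.1 * B p.2 := by
        refine setLIntegral_mono_ae' (measurableSet_Ioi.prod measurableSet_Ioo) ?_
        have hne : ∀ᵐ θ : ℝ, θ ≠ 0 := Measure.ae_ne volume 0
        filter_upwards [Measure.quasiMeasurePreserving_snd.ae hne] with p hp0 hp
        have hn : ‖Complex.polarCoord.symm p‖ = p.1 := by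
          rw [Complex.norm_polarCoord_symm, abs_of_pos hp.1]
        by_cases hR : p.1 < R
        · rw [indicator_of_mem (mem_ball_zero_iff.2 (hn ▸ hR)), indicator_of_mem (show p.1 ∈ Ioo 0 R from ⟨hp.1, hR⟩),
            Complex.polarCoord_symm_apply, smul_eq_mul]
          exact h _ ⟨hp.1, hR⟩ _ hp.2 hp0
        · rw [indicator_of_notMem (by rwa [mem_ball_zero_iff, hn])]
          simp
    _ = (∫⁻ r in Ioi 0, (Ioo 0 R).indicator A r) * ∫⁻ θ in Ioo (-Real.pi) Real.pi, B θ := by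
        rw [Measure.volume_eq_prod, ← Measure.prod_restrict]
        exact lintegral_prod_mul (hA.indicator measurableSet_Ioo).aemeasurable hB.aemeasurable
    _ ≤ _ := by
        refine mul_le_mul_left ?_ _
        rw [← lintegral_indicator measurableSet_Ioo]
        exact setLIntegral_le_lintegral _ _

theorem lintegral_ball_norm_rpow_neg_lt_top {lam : ℝ} (h0 : lam < 2) (R : ℝ) :
    ∫⁻ x in ball (0 : ℂ) R, ENNReal.ofReal (‖x‖ ^ (-lam)) < ∞ := by
  refine (lintegral_ball_polar _ R (fun r => ENNReal.ofReal (r ^ (-(lam - 1)))) (fun _ => 1)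
    (by fun_prop) (by fun_prop) fun r hr θ hθ hθ0 => ?_).trans_lt ?_
  · have : ‖(r : ℂ) * (Real.cos θ + Real.sin θ * Complex.I)‖ = r := by
      have := Complex.norm_polarCoord_symm (r, θ)
      rw [Complex.polarCoord_symm_apply, abs_of_pos hr.1] at this
      exact this
    rw [this, mul_one, ← ENNReal.ofReal_mul hr.1.le]
    nth_rewrite 1 [← Real.rpow_one r]
    rw [← Real.rpow_add hr.1]
    apply le_of_eq; congr 2; ring
  · refine ENNReal.mul_lt_top ?_ (by simp)
    exact (lintegral_mono_set Ioo_subset_Ioc_self).trans_lt (lintegral_rpow_neg_lt_top (by linarith) R)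

theorem lintegral_rotate (u : Circle) (F : ℂ → ℝ≥0∞) (R : ℝ) :
    ∫⁻ x in ball 0 R, F x = ∫⁻ x in ball 0 R, F (x * u) := by
  have := lintegral_ball_mul (c := (u : ℂ)) (by simp) R F
  rw [Circle.norm_coe] at this
  simpa only [one_mul, one_pow, ENNReal.ofReal_one] using this

/-- The angular estimate for the Forelli–Rudin type kernel `|1 - bζ|^(-η)(1-|ζ|²)^(-η)`. -/
theorem exists_lintegral_kernel_le {η : ℝ} (h0 : 0 ≤ η) (h1 : η < 1) :
    ∃ C : ℝ≥0∞, C < ∞ ∧ ∀ b : ℂ, ‖b‖ ≤ 1 → ∫⁻ ζ in ball (0 : ℂ) 1,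
      ENNReal.ofReal (‖1 - b * ζ‖ ^ (-η) * (1 - ‖ζ‖ ^ 2) ^ (-η)) ≤ C := by
  refine ⟨(∫⁻ r in Ioo 0 1, ENNReal.ofReal ((1 - r) ^ (-η))) *
    ∫⁻ θ in Ioo (-Real.pi) Real.pi, ENNReal.ofReal ((|θ| / Real.pi) ^ (-η)),
    ENNReal.mul_lt_top (lintegral_one_sub_rpow_neg_lt_top h1) (lintegral_abs_rpow_neg_lt_top h1),
    fun b hb => ?_⟩
  -- Rotating ζ makes b real and nonnegative, so the angular lower bound applies with s = |b| r. The
  -- majorant then no longer depends on b.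
  obtain ⟨u, hu⟩ : ∃ u : Circle, b * u = ‖b‖ := by
    refine ⟨(Circle.exp b.arg)⁻¹, ?_⟩
    nth_rewrite 1 [← Complex.norm_mul_exp_arg_mul_I b]
    rw [Circle.coe_inv, Circle.coe_exp, mul_assoc, mul_inv_cancel₀ (Complex.exp_ne_zero _), mul_one]
  rw [lintegral_rotate u]
  refine lintegral_ball_polar _ 1 _ _ (by fun_prop) (by fun_prop) fun r hr θ hθ hθ0 => ?_
  have hn : ‖(r : ℂ) * (Real.cos θ + Real.sin θ * Complex.I)‖ = r := by
    have := Complex.norm_polarCoord_symm (r, θ)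
    rw [Complex.polarCoord_symm_apply, abs_of_pos hr.1] at this
    exact this
  have he : b * ((r : ℂ) * (Real.cos θ + Real.sin θ * Complex.I) * u)
      = ((‖b‖ * r : ℝ) : ℂ) * (Real.cos θ + Real.sin θ * Complex.I) := by
    push_cast; rw [← hu]; ring
  rw [norm_mul, hn, he, Circle.norm_coe, mul_one, ← ENNReal.ofReal_mul hr.1.le,
    ← ENNReal.ofReal_mul (Real.rpow_nonneg (by linarith [hr.2]) _)]
  refine ENNReal.ofReal_le_ofReal ?_
  have hr2 : 1 - r ≤ 1 - r ^ 2 := by nlinarith [hr.1, hr.2]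
  have h3 : (1 - r ^ 2) ^ (-η) ≤ (1 - r) ^ (-η) :=
    Real.rpow_le_rpow_of_nonpos (by linarith [hr.2]) hr2 (by linarith)
  have habs : |θ| ≤ Real.pi := abs_le.2 ⟨hθ.1.le, hθ.2.le⟩
  have h4 := Real.rpow_le_rpow_of_nonpos (z := -η) (by have := abs_pos.2 hθ0; positivity)
    (abs_div_pi_le_norm (s := ‖b‖ * r) (mul_nonneg (norm_nonneg _) hr.1.le) habs) (by linarith)
  calc _ ≤ 1 * ((|θ| / Real.pi) ^ (-η) * (1 - r) ^ (-η)) := by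
        have : 0 ≤ (1 - r ^ 2) ^ (-η) := Real.rpow_nonneg (by nlinarith [hr.1, hr.2]) _
        have := hr.2.le
        gcongr
    _ = _ := by ring

end Thullen

/-! ### The uniform L^q bound for the Schur weight -/

namespace Thullen

/-- Put X = 1 - σ²|ζ|². Then |1 - bζ| ≥ 1 - σ|ζ| ≥ X/2, so all but η of the c powers of |1 - bζ|⁻¹
can be traded for powers of X. There remains X^(d + η - c) ≤ X^(-γ) ≤ (1 - σ²)^(-γ), times the
kernel of `exists_lintegral_kernel_le`. -/
theorem exists_lintegral_fibre_le {η c d γ : ℝ} (h0 : 0 ≤ η) (h1 : η < 1) (hc : η ≤ c)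
    (hγ : 0 ≤ γ) (hE : c - η - d ≤ γ) :
    ∃ C : ℝ≥0∞, C < ∞ ∧ ∀ (b : ℂ) (σ : ℝ), σ < 1 → ‖b‖ ≤ σ →
      ∫⁻ ζ in ball (0 : ℂ) 1, ENNReal.ofReal
        (‖1 - b * ζ‖ ^ (-c) * (1 - σ ^ 2 * ‖ζ‖ ^ 2) ^ d * (1 - ‖ζ‖ ^ 2) ^ (-η)) ≤
        C * ENNReal.ofReal ((1 - σ ^ 2) ^ (-γ)) := by
  obtain ⟨C, hC, h⟩ := exists_lintegral_kernel_le h0 h1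
  refine ⟨C * ENNReal.ofReal (2 ^ (c - η)), ENNReal.mul_lt_top hC (by simp), fun b σ hσ hb => ?_⟩
  have hσ0 : 0 ≤ σ := (norm_nonneg b).trans hb
  have hσ2 : 0 < 1 - σ ^ 2 := by nlinarith
  rw [mul_assoc, ← ENNReal.ofReal_mul (by positivity), mul_comm]
  refine le_trans ?_ (mul_le_mul_right (h b (hb.trans hσ.le)) _)
  rw [← lintegral_const_mul' _ _ ENNReal.ofReal_ne_top]
  refine setLIntegral_mono' isOpen_ball.measurableSet fun ζ hζ => ?_
  rw [mem_ball_zero_iff] at hζ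
  rw [← ENNReal.ofReal_mul (by positivity)]
  refine ENNReal.ofReal_le_ofReal ?_
  have hz0 := norm_nonneg ζ
  have hz : 0 < 1 - ‖ζ‖ ^ 2 := one_sub_sq_pos hζ
  set X := 1 - σ ^ 2 * ‖ζ‖ ^ 2 with hX
  have hσX : 1 - σ ^ 2 ≤ X := by rw [hX]; nlinarith [sq_nonneg σ]
  have hX0 : 0 < X := hσ2.trans_le hσX
  have hX1 : X ≤ 1 := by rw [hX]; nlinarith [sq_nonneg σ, sq_nonneg ‖ζ‖, mul_nonneg (sq_nonneg σ) (sq_nonneg ‖ζ‖)]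
  set N := ‖1 - b * ζ‖ with hN
  have hσz : σ * ‖ζ‖ < 1 := by nlinarith
  have hNX : X / 2 ≤ N := by
    have h2 : 1 - ‖b‖ * ‖ζ‖ ≤ N := by simpa using norm_sub_norm_le (1 : ℂ) (b * ζ)
    have h3 : ‖b‖ * ‖ζ‖ ≤ σ * ‖ζ‖ := by gcongr
    have h4 : 0 ≤ σ * ‖ζ‖ := by positivity
    rw [hX]; nlinarith
  have hN0 : 0 < N := lt_of_lt_of_le (by positivity) hNX
  have e1 : N ^ (-c) ≤ N ^ (-η) * (2 ^ (c - η) * X ^ (-(c - η))) := by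
    rw [show -c = -η + -(c - η) by ring, Real.rpow_add hN0]
    gcongr
    refine (Real.rpow_le_rpow_of_nonpos (by positivity) hNX (by linarith)).trans (le_of_eq ?_)
    rw [Real.div_rpow hX0.le two_pos.le, Real.rpow_neg two_pos.le, div_inv_eq_mul, mul_comm]
  have e2 : X ^ (-(c - η)) * X ^ d ≤ (1 - σ ^ 2) ^ (-γ) := by
    rw [← Real.rpow_add hX0]
    exact (Real.rpow_le_rpow_of_exponent_ge hX0 hX1 (by linarith)).trans
      (Real.rpow_le_rpow_of_nonpos hσ2 hσX (by linarith))
  calc N ^ (-c) * X ^ d * (1 - ‖ζ‖ ^ 2) ^ (-η)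
      ≤ N ^ (-η) * (2 ^ (c - η) * X ^ (-(c - η))) * X ^ d * (1 - ‖ζ‖ ^ 2) ^ (-η) := by gcongr
    _ = 2 ^ (c - η) * (X ^ (-(c - η)) * X ^ d) * (N ^ (-η) * (1 - ‖ζ‖ ^ 2) ^ (-η)) := by ring
    _ ≤ _ := by gcongr

/-- The unit disc, translated by a, lies in the disc of radius 2, so the bound does not depend on a.
-/
theorem lintegral_norm_sub_rpow_neg_le {lam : ℝ} {a : ℂ} (ha : ‖a‖ < 1) :
    ∫⁻ x in ball (0 : ℂ) 1, ENNReal.ofReal (‖a - x‖ ^ (-lam)) ≤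
      ∫⁻ x in ball (0 : ℂ) 2, ENNReal.ofReal (‖x‖ ^ (-lam)) := by
  rw [← lintegral_indicator isOpen_ball.measurableSet, ← lintegral_indicator isOpen_ball.measurableSet]
  refine le_trans ?_ (lintegral_sub_left_eq_self
    ((ball (0 : ℂ) 2).indicator fun x => ENNReal.ofReal (‖x‖ ^ (-lam))) a).le
  refine lintegral_mono fun x => ?_
  by_cases hx : x ∈ ball (0 : ℂ) 1
  · rw [indicator_of_mem hx, indicator_of_mem]
    rw [mem_ball_zero_iff] at *
    exact (norm_sub_le _ _).trans_lt (by linarith)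
  · rw [indicator_of_notMem hx]; exact bot_le

/-- The integrability exponent at which the weight integral stays bounded. -/
theorem exists_exponents {α q : ℝ} (hα : 0 < α) (hq1 : 1 ≤ q) (hq : q < 4 / 3) :
    ∃ ε lam : ℝ, 0 < ε ∧ ε < 1 ∧ lam < 2 ∧ 0 ≤ lam ∧ 3 * q - 2 + ε ≤ lam ∧
      3 / 4 * (α + 2) * q - 2 + 2 * ε ≤ lam * α / 2 := by
  -- At ε = 0 the two lower bounds on λ are below 2 by 4 - 3q and by (2/α)(α + 2)(1 - 3q/4). Both
  -- gaps are positive because q < 4/3, and ε is chosen small enough to fit inside them.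
  have h3 : 0 < (α + 2) * (1 - 3 * q / 4) := mul_pos (by linarith) (by linarith)
  obtain ⟨ε, h0, h⟩ := exists_between
    (show (0 : ℝ) < min 1 (min (4 - 3 * q) ((α + 2) * (1 - 3 * q / 4) / 2)) by
      refine lt_min one_pos (lt_min (by linarith) (by linarith)))
  rw [lt_min_iff, lt_min_iff] at h
  refine ⟨ε, max (3 * q - 2 + ε) ((3 / 4 * (α + 2) * q - 2 + 2 * ε) * 2 / α), h0, h.1,
    max_lt (by linarith [h.2.1]) ?_, le_max_of_le_left (by linarith), le_max_left _ _, ?_⟩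
  · rw [div_lt_iff₀ hα]
    nlinarith [h.2.2]
  · have := le_max_right (3 * q - 2 + ε) ((3 / 4 * (α + 2) * q - 2 + 2 * ε) * 2 / α)
    rw [div_le_iff₀ hα] at this
    linarith

theorem norm_one_sub_conj_mul_le_two {a x : ℂ} (ha : ‖a‖ < 1) (hx : ‖x‖ < 1) :
    ‖1 - conj a * x‖ ≤ 2 := by
  refine (norm_sub_le _ _).trans ?_
  rw [norm_one, norm_mul, RCLike.norm_conj]
  nlinarith [norm_nonneg a, norm_nonneg x]

theorem one_sub_sq_le_two_mul {a x : ℂ} (ha : ‖a‖ < 1) (hx : ‖x‖ < 1) :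
    1 - ‖x‖ ^ 2 ≤ 2 * ‖1 - conj a * x‖ := by
  have := one_sub_norm_le a x
  nlinarith [norm_nonneg a, norm_nonneg x]

/-- Let N = |1 - conj a x|. The factor 1 - |x|^(2/α) survives to the power ε and is at most a
constant times N; |m|^(-λ), for m the Möbius image of x, contributes |a - x|^(-λ) N^λ. The total
exponent of N is λ - (3q - 2 + ε) ≥ 0, and N ≤ 2. -/
theorem base_bound {α η q ε lam : ℝ} (hα : 0 < α) (hε : 0 < ε) (hη : η = 1 - ε)
    (hlam : 3 * q - 2 + ε ≤ lam) {a x : ℂ} (ha : ‖a‖ < 1) (hx : ‖x‖ < 1) (hax : x ≠ a) :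
    (1 - ‖x‖ ^ (2 / α)) * ((1 - ‖x‖ ^ (2 / α)) ^ (-η) * ‖1 - conj a * x‖ ^ (2 * η - 3 * q)) *
        ‖moebius a x‖ ^ (-lam) ≤
      (max 1 (1 / α) * 2) ^ ε * 2 ^ (lam - (3 * q - 2 + ε)) * ‖a - x‖ ^ (-lam) := by
  have hP := one_sub_rpow_pos hα hx
  have hN := one_sub_conj_mul_norm_pos ha hx
  have hN2 := norm_one_sub_conj_mul_le_two ha hx
  have hd : 0 < ‖a - x‖ := norm_pos_iff.2 (sub_ne_zero.2 hax.symm)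
  have h1 := (one_sub_rpow_le_mul hα hx).trans
    (mul_le_mul_of_nonneg_left (one_sub_sq_le_two_mul ha hx) (show 0 ≤ max 1 (1 / α) by positivity))
  set P := 1 - ‖x‖ ^ (2 / α)
  set N := ‖1 - conj a * x‖ with hNdef
  set M := max 1 (1 / α)
  have hM : 0 ≤ M := by positivity
  have hmb : ‖moebius a x‖ ^ (-lam) = ‖a - x‖ ^ (-lam) * N ^ lam := by
    rw [moebius, norm_div, Real.div_rpow (norm_nonneg _) (norm_nonneg _), ← hNdef,
      Real.rpow_neg hN.le, div_inv_eq_mul]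
  have hPe : P * P ^ (-η) ≤ (M * 2) ^ ε * N ^ ε := by
    rw [← Real.mul_rpow (by positivity) hN.le]
    nth_rewrite 1 [← Real.rpow_one P]
    rw [← Real.rpow_add hP, hη, show 1 + -(1 - ε) = ε by ring]
    exact Real.rpow_le_rpow hP.le (by linarith) hε.le
  have hNN : N ^ ε * N ^ (2 * η - 3 * q) * N ^ lam ≤ 2 ^ (lam - (3 * q - 2 + ε)) := by
    rw [← Real.rpow_add hN, ← Real.rpow_add hN,
      show ε + (2 * η - 3 * q) + lam = lam - (3 * q - 2 + ε) by rw [hη]; ring]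
    exact Real.rpow_le_rpow hN.le hN2 (by linarith)
  rw [hmb]
  calc _ = (P * P ^ (-η)) * (N ^ (2 * η - 3 * q) * N ^ lam) * ‖a - x‖ ^ (-lam) := by ring
    _ ≤ ((M * 2) ^ ε * N ^ ε) * (N ^ (2 * η - 3 * q) * N ^ lam) * ‖a - x‖ ^ (-lam) := by gcongr
    _ = (M * 2) ^ ε * (N ^ ε * N ^ (2 * η - 3 * q) * N ^ lam) * ‖a - x‖ ^ (-lam) := by ring
    _ ≤ _ := by gcongr

/-- The weight whose `L^q` norm controls the Schur integral. -/
noncomputable def schurWeight (α t : ℝ) (a b : ℂ) (w : ℂ × ℂ) : ℝ :=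
  ‖1 - conj b * (phiMap α a w).2‖ ^ (-((α + 2) / 2)) *
    (1 - ‖(phiMap α a w).2‖ ^ 2) ^ (t - (α + 2) / 4) * defFun α w ^ (-t) *
    ‖1 - conj a * w.1‖ ^ (2 * t - 3)

theorem measurable_defFun (α : ℝ) : Measurable (defFun α) := by unfold defFun; fun_prop

theorem measurable_schurWeight (α t : ℝ) (a b : ℂ) : Measurable (schurWeight α t a b) := by
  have h1 := measurable_phiMap α a
  have h2 := measurable_defFun α
  have h3 := measurable_moebius a
  unfold schurWeight
  fun_prop

/-- On the fibre over x, with w₂ = ζ √(1 - |x|^(2/α)), the q-th power of the weight is a base factor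
times the integrand of `exists_lintegral_fibre_le`, where σ² = 1 - |m|^(2/α) and m is the Möbius
image of x. The fibre integral costs a power of 1 - σ² = |m|^(2/α), and `base_bound` turns the
result into a multiple of |a - x|^(-λ). -/
theorem exists_lintegral_schurWeight_le {α q : ℝ} (hα : 0 < α) (hq1 : 1 ≤ q) (hq : q < 4 / 3) :
    ∃ t : ℝ, 0 < t ∧ t < 1 ∧ ∃ C : ℝ≥0∞, C < ∞ ∧ ∀ a b : ℂ, ‖a‖ < 1 → ‖b‖ < 1 →
      ∫⁻ w in thullenDomain α, ENNReal.ofReal (schurWeight α t a b w ^ q) ≤ C := by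
  obtain ⟨ε, lam, hε0, hε1, hlam2, hlam0, hk, hE⟩ := exists_exponents hα hq1 hq
  have hq0 : 0 < q := by linarith
  obtain ⟨η, hη⟩ : ∃ η, η = 1 - ε := ⟨_, rfl⟩
  -- The exponents c and d are those of `schurWeight` times q, with tq = η, hence t = η/q. The
  -- choice γ = λα/2 makes (|m|^(2/α))^(-γ) equal to |m|^(-λ).
  obtain ⟨C₁, hC₁, hfib⟩ := exists_lintegral_fibre_le (η := η) (c := (α + 2) / 2 * q)
    (d := η - (α + 2) / 4 * q) (γ := lam * α / 2) (by linarith) (by linarith)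
    (by nlinarith) (by positivity) (by rw [hη]; linarith)
  set K := (max 1 (1 / α) * 2) ^ ε * 2 ^ (lam - (3 * q - 2 + ε)) with hK
  have hK0 : 0 ≤ K := by positivity
  refine ⟨η / q, by rw [hη]; exact div_pos (by linarith) hq0, by
    rw [div_lt_one hq0]; linarith, C₁ * (ENNReal.ofReal K *
      ∫⁻ x in ball (0 : ℂ) 2, ENNReal.ofReal (‖x‖ ^ (-lam))),
    ENNReal.mul_lt_top hC₁ (ENNReal.mul_lt_top (by simp)
      (lintegral_ball_norm_rpow_neg_lt_top hlam2 2)), fun a b ha hb => ?_⟩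
  have hmeas := measurable_schurWeight α (η / q) a b
  rw [lintegral_thullenDomain hα (by fun_prop)]
  refine le_trans ?_ (mul_le_mul_right
    (mul_le_mul_right (lintegral_norm_sub_rpow_neg_le ha) _) _)
  rw [← lintegral_const_mul' _ _ ENNReal.ofReal_ne_top, ← lintegral_const_mul' _ _ hC₁.ne]
  refine setLIntegral_mono_ae' isOpen_ball.measurableSet ?_
  -- At x = a the Möbius image is 0 and σ = 1, so the fibre estimate is unavailable; this is a null
  -- set.
  filter_upwards [Measure.ae_ne volume a] with x hxa hx
  rw [mem_ball_zero_iff] at hx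
  have hP := one_sub_rpow_pos hα hx
  have hm1 := norm_moebius_lt_one ha hx
  have hPm := one_sub_rpow_pos hα hm1
  have hmpos : 0 < ‖moebius a x‖ := by
    rw [norm_pos_iff, moebius]
    exact div_ne_zero (sub_ne_zero.2 hxa.symm) (one_sub_conj_mul_ne_zero ha hx)
  have hN := one_sub_conj_mul_norm_pos ha hx
  set B := conj b * ((√(1 - ‖x‖ ^ (2 / α)) : ℂ) * phiFactor α a x) with hB
  set σ := √(1 - ‖moebius a x‖ ^ (2 / α)) with hσ
  have hσ2 : σ ^ 2 = 1 - ‖moebius a x‖ ^ (2 / α) := Real.sq_sqrt hPm.le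
  have hσ1 : σ < 1 := by
    have : 0 < ‖moebius a x‖ ^ (2 / α) := Real.rpow_pos_of_pos hmpos _
    nlinarith [Real.sqrt_nonneg (1 - ‖moebius a x‖ ^ (2 / α))]
  have hfac : ‖(√(1 - ‖x‖ ^ (2 / α)) : ℂ) * phiFactor α a x‖ = σ := by
    rw [hσ, eq_comm, Real.sqrt_eq_iff_mul_self_eq hPm.le (norm_nonneg _), ← sq, norm_mul, mul_pow,
      norm_phiFactor_sq hα ha hx, Complex.norm_real, Real.norm_of_nonneg (Real.sqrt_nonneg _),
      Real.sq_sqrt hP.le, fibreScale, mul_div_cancel₀ _ hP.ne']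
  have hBσ : ‖B‖ ≤ σ := by
    rw [hB, norm_mul, hfac, RCLike.norm_conj]
    nlinarith [Real.sqrt_nonneg (1 - ‖moebius a x‖ ^ (2 / α))]
  have hint : ∀ ζ ∈ ball (0 : ℂ) 1,
      ENNReal.ofReal (schurWeight α (η / q) a b (x, ζ * (√(1 - ‖x‖ ^ (2 / α)) : ℂ)) ^ q) =
      ENNReal.ofReal ((1 - ‖x‖ ^ (2 / α)) ^ (-η) * ‖1 - conj a * x‖ ^ (2 * η - 3 * q)) *
        ENNReal.ofReal (‖1 - B * ζ‖ ^ (-((α + 2) / 2 * q)) *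
          (1 - σ ^ 2 * ‖ζ‖ ^ 2) ^ (η - (α + 2) / 4 * q) * (1 - ‖ζ‖ ^ 2) ^ (-η)) := by
    intro ζ hζ
    rw [mem_ball_zero_iff] at hζ
    have hz := one_sub_sq_pos hζ
    have hX : 0 < 1 - σ ^ 2 * ‖ζ‖ ^ 2 := by
      have := Real.sqrt_nonneg (1 - ‖moebius a x‖ ^ (2 / α))
      nlinarith [sq_nonneg σ]
    rw [← ENNReal.ofReal_mul (by positivity)]
    congr 1
    have hdef : defFun α (x, ζ * (√(1 - ‖x‖ ^ (2 / α)) : ℂ)) =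
        (1 - ‖x‖ ^ (2 / α)) * (1 - ‖ζ‖ ^ 2) := by
      rw [defFun, norm_mul, mul_pow, Complex.norm_real, Real.norm_of_nonneg (Real.sqrt_nonneg _),
        Real.sq_sqrt hP.le]
      ring
    have hsnd : ‖ζ * (√(1 - ‖x‖ ^ (2 / α)) : ℂ) * phiFactor α a x‖ ^ 2 = σ ^ 2 * ‖ζ‖ ^ 2 := by
      rw [mul_assoc, norm_mul, hfac]; ring
    have hBz : 1 - conj b * (ζ * (√(1 - ‖x‖ ^ (2 / α)) : ℂ) * phiFactor α a x) = 1 - B * ζ := by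
      rw [hB]; ring
    have hqt : η / q * q = η := div_mul_cancel₀ _ hq0.ne'
    rw [schurWeight, phiMap_eq, hdef]
    simp only
    rw [hsnd, hBz, Real.mul_rpow (by positivity) (by positivity),
      Real.mul_rpow (by positivity) (by positivity), Real.mul_rpow (by positivity) (by positivity),
      ← Real.rpow_mul (by positivity), ← Real.rpow_mul hX.le, ← Real.rpow_mul (by positivity),
      ← Real.rpow_mul hN.le, Real.mul_rpow hP.le hz.le,
      show (2 * (η / q) - 3) * q = 2 * η - 3 * q by rw [sub_mul, mul_assoc, hqt],
      show (η / q - (α + 2) / 4) * q = η - (α + 2) / 4 * q by rw [sub_mul, hqt],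
      neg_mul, neg_mul, hqt]
    ring
  rw [setLIntegral_congr_fun isOpen_ball.measurableSet hint,
    lintegral_const_mul' _ _ ENNReal.ofReal_ne_top]
  have hQ : 0 ≤ (1 - ‖x‖ ^ (2 / α)) ^ (-η) * ‖1 - conj a * x‖ ^ (2 * η - 3 * q) := by positivity
  calc _ ≤ ENNReal.ofReal (1 - ‖x‖ ^ (2 / α)) * (ENNReal.ofReal ((1 - ‖x‖ ^ (2 / α)) ^ (-η) *
        ‖1 - conj a * x‖ ^ (2 * η - 3 * q)) *
        (C₁ * ENNReal.ofReal ((1 - σ ^ 2) ^ (-(lam * α / 2))))) := by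
        gcongr
        exact hfib B σ hσ1 hBσ
    _ = C₁ * ENNReal.ofReal ((1 - ‖x‖ ^ (2 / α)) * ((1 - ‖x‖ ^ (2 / α)) ^ (-η) *
        ‖1 - conj a * x‖ ^ (2 * η - 3 * q)) * ‖moebius a x‖ ^ (-lam)) := by
        rw [hσ2, sub_sub_cancel, ← Real.rpow_mul hmpos.le,
          show 2 / α * -(lam * α / 2) = -lam by field_simp,
          ENNReal.ofReal_mul (mul_nonneg hP.le hQ), ENNReal.ofReal_mul hP.le]
        ring
    _ ≤ _ := by
        rw [← ENNReal.ofReal_mul hK0]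
        refine mul_le_mul_right (ENNReal.ofReal_le_ofReal ?_) _
        exact base_bound hα hε0 hη hk ha hx hxa

end Thullen

namespace Thullen

/-! ### Averaging over circle actions -/

/-- The skew product (θ, x) ↦ (θ, ρ_θ x) preserves the product measure, so Fubini shows that
averaging over θ does not change the integral. -/
theorem integral_circle_average {X : Type*} [MeasurableSpace X] {μ : Measure X} [SFinite μ]
    {ρ : ℝ → X → X} (hρm : Measurable (Function.uncurry ρ))
    (hρ : ∀ θ, MeasurePreserving (ρ θ) μ μ) {G : X → ℂ} (hG : Integrable G μ) :
    Integrable (fun v => (2 * Real.pi)⁻¹ • ∫ θ in (0)..(2 * Real.pi), G (ρ θ v)) μ ∧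
      ∫ v, ((2 * Real.pi)⁻¹ • ∫ θ in (0)..(2 * Real.pi), G (ρ θ v)) ∂μ = ∫ v, G v ∂μ := by
  have hpi : (0 : ℝ) ≤ 2 * Real.pi := by positivity
  set ν : Measure ℝ := volume.restrict (Ioc 0 (2 * Real.pi)) with hν
  have hskew : MeasurePreserving (fun p : ℝ × X => (p.1, ρ p.1 p.2)) (ν.prod μ) (ν.prod μ) :=
    (MeasurePreserving.id ν).skew_product hρm (Eventually.of_forall fun θ => (hρ θ).map_eq)
  have hint : Integrable (fun p : ℝ × X => G (ρ p.1 p.2)) (ν.prod μ) :=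
    hskew.integrable_comp_of_integrable (hG.comp_snd ν)
  have h1 : ∫ p, G (ρ p.1 p.2) ∂(ν.prod μ) = (2 * Real.pi) • ∫ v, G v ∂μ := by
    have e1 : ∫ p, G (ρ p.1 p.2) ∂(ν.prod μ) = ∫ p : ℝ × X, G p.2 ∂(ν.prod μ) := by
      have hm : AEStronglyMeasurable (fun p : ℝ × X => G p.2)
          (Measure.map (fun p : ℝ × X => (p.1, ρ p.1 p.2)) (ν.prod μ)) := by
        rw [hskew.map_eq]; exact (hG.comp_snd ν).1
      have := integral_map hskew.measurable.aemeasurable hm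
      rw [hskew.map_eq] at this
      exact this.symm
    rw [e1, integral_prod _ (hG.comp_snd ν)]
    simp only
    rw [integral_const, hν, Measure.real, Measure.restrict_apply_univ, Real.volume_Ioc, sub_zero,
      ENNReal.toReal_ofReal hpi]
  simp_rw [intervalIntegral.integral_of_le hpi]
  refine ⟨hint.swap.integral_prod_left.smul (2 * Real.pi)⁻¹, ?_⟩
  rw [integral_smul, integral_integral_swap (f := fun v θ => G (ρ θ v)) hint.swap,
    ← integral_prod _ hint, h1, smul_smul, inv_mul_cancel₀ (by positivity), one_smul]

theorem measurePreserving_circleMap_mul (θ : ℝ) :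
    MeasurePreserving fun w : ℂ => circleMap 0 1 θ * w := by
  convert (rotation (Circle.exp θ)).measurePreserving using 2
  simp [circleMap]

theorem mem_thullenDomain_iff_of_norm_eq {α : ℝ} {z w : ℂ × ℂ} (h1 : ‖z.1‖ = ‖w.1‖)
    (h2 : ‖z.2‖ = ‖w.2‖) : z ∈ thullenDomain α ↔ w ∈ thullenDomain α := by
  rw [thullenDomain, mem_ofPred_eq, mem_ofPred_eq, h1, h2]

theorem measurePreserving_rot_fst {α : ℝ} (hα : 0 < α) (θ : ℝ) :
    MeasurePreserving (fun w : ℂ × ℂ => (circleMap 0 1 θ * w.1, w.2))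
      (volume.restrict (thullenDomain α)) (volume.restrict (thullenDomain α)) := by
  have h : MeasurePreserving (fun w : ℂ × ℂ => (circleMap 0 1 θ * w.1, w.2)) :=
    (measurePreserving_circleMap_mul θ).prod (MeasurePreserving.id _)
  have := h.restrict_preimage (measurableSet_thullenDomain hα)
  rwa [show (fun w : ℂ × ℂ => (circleMap 0 1 θ * w.1, w.2)) ⁻¹' thullenDomain α = thullenDomain α from
    Set.ext fun w => mem_thullenDomain_iff_of_norm_eq (by simp) rfl] at this

theorem measurePreserving_rot_snd {α : ℝ} (hα : 0 < α) (θ : ℝ) :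
    MeasurePreserving (fun w : ℂ × ℂ => (w.1, circleMap 0 1 θ * w.2))
      (volume.restrict (thullenDomain α)) (volume.restrict (thullenDomain α)) := by
  have h : MeasurePreserving (fun w : ℂ × ℂ => (w.1, circleMap 0 1 θ * w.2)) :=
    (MeasurePreserving.id _).prod (measurePreserving_circleMap_mul θ)
  have := h.restrict_preimage (measurableSet_thullenDomain hα)
  rwa [show (fun w : ℂ × ℂ => (w.1, circleMap 0 1 θ * w.2)) ⁻¹' thullenDomain α = thullenDomain α from
    Set.ext fun w => mem_thullenDomain_iff_of_norm_eq rfl (by simp)] at this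

theorem mk_zero_mem_thullenDomain {α : ℝ} (hα : 0 < α) {x : ℂ} (hx : ‖x‖ < 1) :
    (x, (0 : ℂ)) ∈ thullenDomain α := by
  rw [← defFun_pos_iff, defFun]
  simpa using one_sub_rpow_pos hα hx

/-- Averaging over rotations in the second coordinate restricts to the first axis. -/
theorem integral_conj_pow_mul_eq {α : ℝ} (hα : 0 < α) {g : ℂ × ℂ → ℂ}
    (hg : DifferentiableOn ℂ g (thullenDomain α))
    (hi : IntegrableOn g (thullenDomain α)) (n : ℕ) :
    IntegrableOn (fun v : ℂ × ℂ => conj v.1 ^ n * g (v.1, 0)) (thullenDomain α) ∧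
    ∫ v in thullenDomain α, conj v.1 ^ n * g (v.1, 0) =
      ∫ v in thullenDomain α, conj v.1 ^ n * g v := by
  have hU := measurableSet_thullenDomain hα
  have hint : Integrable (fun v : ℂ × ℂ => conj v.1 ^ n * g v)
      (volume.restrict (thullenDomain α)) := by
    refine Integrable.bdd_mul (c := 1) hi (by fun_prop) ?_
    filter_upwards [ae_restrict_mem hU] with v hv
    rw [norm_pow, RCLike.norm_conj]
    exact pow_le_one₀ (norm_nonneg _) (norm_fst_lt_one hα hv).le
  obtain ⟨h1, h2⟩ := integral_circle_average
    (ρ := fun θ w => (w.1, circleMap 0 1 θ * w.2)) (by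
      have := continuous_circleMap 0 1
      exact Continuous.measurable (by fun_prop)) (measurePreserving_rot_snd hα) hint
  have heq : (fun v : ℂ × ℂ => (2 * Real.pi)⁻¹ • ∫ θ in (0)..(2 * Real.pi),
      conj v.1 ^ n * g (v.1, circleMap 0 1 θ * v.2)) =ᵐ[volume.restrict (thullenDomain α)]
      fun v => conj v.1 ^ n * g (v.1, 0) := by
    filter_upwards [ae_restrict_mem hU] with v hv
    have hd : DiffContOnCl ℂ (fun l : ℂ => conj v.1 ^ n * g (v.1, l * v.2)) (ball 0 |1|) := by
      refine DifferentiableOn.diffContOnCl ?_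
      rw [abs_one, closure_ball _ one_ne_zero]
      refine (hg.comp (by fun_prop) fun l hl => ?_).const_mul _
      rw [mem_closedBall_zero_iff] at hl
      have hv' := (mem_thullenDomain_iff_snd hα v).1 hv
      rw [mem_thullenDomain_iff_snd hα]
      refine ⟨hv'.1, lt_of_le_of_lt ?_ hv'.2⟩
      rw [norm_mul]
      exact mul_le_of_le_one_left (norm_nonneg _) hl
    have hav := hd.circleAverage
    rw [Real.circleAverage_def] at hav
    simpa using hav
  exact ⟨h1.congr heq, (integral_congr_ae heq).symm.trans h2⟩

/-- On the unit circle conj l = l⁻¹, so the average is Cauchy's integral for the n-th Taylor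
coefficient of l ↦ f(lx), times conj(x)ⁿ. -/
theorem circleAverage_conj_pow_mul {f : ℂ → ℂ} (hf : DifferentiableOn ℂ f (ball 0 1)) {x : ℂ}
    (hx : ‖x‖ < 1) (n : ℕ) :
    Real.circleAverage (fun l => conj (l * x) ^ n * f (l * x)) 0 1 =
      ((‖x‖ ^ 2) ^ n : ℝ) * ((n.factorial : ℂ)⁻¹ * iteratedDeriv n f 0) := by
  have hmaps : ∀ l ∈ closedBall (0 : ℂ) 1, l * x ∈ ball (0 : ℂ) 1 := by
    intro l hl
    rw [mem_closedBall_zero_iff] at hl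
    rw [mem_ball_zero_iff, norm_mul]
    nlinarith [norm_nonneg x, norm_nonneg l]
  have hd : DiffContOnCl ℂ (fun l => f (l * x)) (ball 0 1) := by
    refine DifferentiableOn.diffContOnCl ?_
    rw [closure_ball _ one_ne_zero]
    exact hf.comp (by fun_prop) hmaps
  have hC := hd.circleIntegral_one_div_sub_center_pow_smul one_pos n
  have hit : iteratedDeriv n (fun l => f (l * x)) 0 = x ^ n * iteratedDeriv n f 0 := by
    have h0 : (0 : ℂ) ∈ ball (0 : ℂ) 1 := mem_ball_self one_pos
    have := iteratedDerivWithin_comp_const_smul (n := n) h0 isOpen_ball.uniqueDiffOn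
      (hf.contDiffOn isOpen_ball) x fun l hl => by
        change x * l ∈ _
        rw [mul_comm]; exact hmaps l (ball_subset_closedBall hl)
    rw [mul_zero, iteratedDerivWithin_of_isOpen isOpen_ball h0,
      iteratedDerivWithin_of_isOpen isOpen_ball h0] at this
    simpa [mul_comm] using this
  rw [Real.circleAverage_eq_circleIntegral one_ne_zero]
  have hcongr : ∮ l in C(0, 1), (l - 0)⁻¹ • (conj (l * x) ^ n * f (l * x)) =
      conj x ^ n • ∮ l in C(0, 1), (1 / (l - 0) ^ (n + 1)) • f (l * x) := by
    rw [← circleIntegral.integral_smul]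
    refine circleIntegral.integral_congr zero_le_one fun l hl => ?_
    rw [mem_sphere_zero_iff_norm] at hl
    have hl0 : l ≠ 0 := by rintro rfl; simp at hl
    have hlc : conj l = l⁻¹ := by
      rw [Complex.inv_def, Complex.normSq_eq_norm_sq, hl]; simp
    simp only [sub_zero, smul_eq_mul, map_mul, hlc, mul_pow]
    rw [one_div, pow_succ, mul_inv, inv_pow]
    ring
  rw [hcongr, hC, hit]
  have h2 : conj x ^ n * x ^ n = (((‖x‖ ^ 2) ^ n : ℝ) : ℂ) := by
    rw [← mul_pow, conj_mul_self_eq]; push_cast; rfl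
  rw [← h2]
  simp only [smul_eq_mul]
  have : (Real.pi : ℂ) ≠ 0 := by exact_mod_cast Real.pi_ne_zero
  field_simp

theorem integral_conj_pow_mul_axis {α : ℝ} (hα : 0 < α) {f : ℂ → ℂ}
    (hf : DifferentiableOn ℂ f (ball 0 1)) (n : ℕ)
    (hi : IntegrableOn (fun v : ℂ × ℂ => conj v.1 ^ n * f v.1) (thullenDomain α)) :
    ∫ v in thullenDomain α, conj v.1 ^ n * f v.1 =
      ((∫ v in thullenDomain α, (‖v.1‖ ^ 2) ^ n : ℝ) : ℂ) *
        ((n.factorial : ℂ)⁻¹ * iteratedDeriv n f 0) := by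
  obtain ⟨-, h2⟩ := integral_circle_average
    (ρ := fun θ w => (circleMap 0 1 θ * w.1, w.2)) (by
      have := continuous_circleMap 0 1
      exact Continuous.measurable (by fun_prop)) (measurePreserving_rot_fst hα) hi
  rw [← h2, ← integral_complex_ofReal, ← integral_mul_const (L := ℂ)]
  refine setIntegral_congr_fun (measurableSet_thullenDomain hα) fun v hv => ?_
  have := circleAverage_conj_pow_mul hf (norm_fst_lt_one hα hv) n
  rw [Real.circleAverage_def] at this
  exact_mod_cast this

/-- The squared norm of the monomial `z₁ ^ n`. -/
theorem integral_norm_sq_pow {α : ℝ} (hα : 0 < α) (n : ℕ) :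
    ∫ v in thullenDomain α, (‖v.1‖ ^ 2) ^ n =
      Real.pi ^ 2 / ((n + 1) * (α * (n + 1) + 1)) := by
  -- The fibre over x has area π(1 - |x|^(2/α)). That π supplies one factor of π², and polar
  -- coordinates in x supply the other.
  have hrad : ∫ x in ball (0 : ℂ) 1, (1 - ‖x‖ ^ (2 / α)) * (‖x‖ ^ 2) ^ n =
      Real.pi / ((n + 1) * (α * (n + 1) + 1)) := by
    have h := integral_fun_norm_addHaar (volume : Measure ℂ)
      ((Iio (1 : ℝ)).indicator fun r => (1 - r ^ (2 / α)) * (r ^ 2) ^ n)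
    rw [← integral_indicator isOpen_ball.measurableSet]
    have e1 : ∀ x : ℂ, (ball (0 : ℂ) 1).indicator
        (fun x => (1 - ‖x‖ ^ (2 / α)) * (‖x‖ ^ 2) ^ n) x =
        (Iio (1 : ℝ)).indicator (fun r => (1 - r ^ (2 / α)) * (r ^ 2) ^ n) ‖x‖ := by
      intro x
      by_cases hx : ‖x‖ < 1
      · rw [indicator_of_mem (mem_ball_zero_iff.2 hx), indicator_of_mem (show ‖x‖ ∈ Iio 1 from hx)]
      · rw [indicator_of_notMem (by rwa [mem_ball_zero_iff]), indicator_of_notMem (s := Iio 1) hx]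
    rw [integral_congr_ae (Eventually.of_forall e1), h]
    have hvol : (volume : Measure ℂ).real (ball 0 1) = Real.pi := by
      rw [Measure.real, Complex.volume_ball]
      simp
    rw [Complex.finrank_real_complex, hvol]
    have e2 : ∫ y in Ioi (0 : ℝ), y ^ (2 - 1) •
        (Iio (1 : ℝ)).indicator (fun r => (1 - r ^ (2 / α)) * (r ^ 2) ^ n) y =
        ∫ y in (0 : ℝ)..1, (y ^ ((2 * n + 1 : ℕ) : ℝ) - y ^ ((2 * n + 1 : ℕ) + 2 / α : ℝ)) := by
      rw [intervalIntegral.integral_of_le zero_le_one, integral_Ioc_eq_integral_Ioo,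
        ← integral_indicator measurableSet_Ioi, ← integral_indicator measurableSet_Ioo]
      refine integral_congr_ae (Eventually.of_forall fun y => ?_)
      by_cases h0 : 0 < y
      · by_cases h1 : y < 1
        · rw [indicator_of_mem (show y ∈ Ioi 0 from h0), indicator_of_mem (show y ∈ Iio 1 from h1),
            indicator_of_mem (show y ∈ Ioo 0 1 from ⟨h0, h1⟩), Real.rpow_add h0, Real.rpow_natCast,
            smul_eq_mul]
          ring
        · rw [indicator_of_mem (show y ∈ Ioi 0 from h0), indicator_of_notMem (s := Iio 1) h1,
            indicator_of_notMem (s := Ioo 0 1) fun h => h1 h.2, smul_zero]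
      · rw [indicator_of_notMem (s := Ioi 0) h0, indicator_of_notMem (s := Ioo 0 1) fun h => h0 h.1]
    have hexp : (-1 : ℝ) < (2 * n + 1 : ℕ) + 2 / α := by
      have : 0 < 2 / α := by positivity
      have h3 : (0 : ℝ) ≤ (2 * n + 1 : ℕ) := by positivity
      linarith
    rw [e2, intervalIntegral.integral_sub
      (intervalIntegral.intervalIntegrable_rpow' (by
        have h3 : (0 : ℝ) ≤ (2 * n + 1 : ℕ) := by positivity
        linarith)) (intervalIntegral.intervalIntegrable_rpow' hexp), integral_rpow (Or.inl (by
        have h3 : (0 : ℝ) ≤ (2 * n + 1 : ℕ) := by positivity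
        linarith)), integral_rpow (Or.inl hexp)]
    rw [Real.one_rpow, Real.one_rpow, Real.zero_rpow (by positivity), Real.zero_rpow (by positivity)]
    simp only [nsmul_eq_mul, smul_eq_mul]
    push_cast
    field_simp
    ring
  have hbase : ∀ x ∈ ball (0 : ℂ) 1, 0 ≤ (1 - ‖x‖ ^ (2 / α)) * (‖x‖ ^ 2) ^ n := fun x hx =>
    mul_nonneg (one_sub_rpow_pos hα (mem_ball_zero_iff.1 hx)).le (by positivity)
  rw [integral_eq_lintegral_of_nonneg_ae (Eventually.of_forall fun v => by positivity)
    (by fun_prop), lintegral_thullenDomain hα (by fun_prop)]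
  simp only
  have e3 : ∫⁻ x in ball (0 : ℂ) 1, ENNReal.ofReal (1 - ‖x‖ ^ (2 / α)) *
      ∫⁻ _ in ball (0 : ℂ) 1, ENNReal.ofReal ((‖x‖ ^ 2) ^ n) =
      (∫⁻ x in ball (0 : ℂ) 1, ENNReal.ofReal ((1 - ‖x‖ ^ (2 / α)) * (‖x‖ ^ 2) ^ n)) *
        volume (ball (0 : ℂ) 1) := by
    rw [← lintegral_mul_const' _ _ measure_ball_lt_top.ne]
    refine setLIntegral_congr_fun isOpen_ball.measurableSet fun x hx => ?_
    rw [setLIntegral_const, ENNReal.ofReal_mul (one_sub_rpow_pos hα (mem_ball_zero_iff.1 hx)).le,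
      mul_assoc]
  rw [e3, ENNReal.toReal_mul, ← integral_eq_lintegral_of_nonneg_ae
    ((ae_restrict_iff' isOpen_ball.measurableSet).2 (Eventually.of_forall hbase))
    (by fun_prop), hrad, Complex.volume_ball]
  simp
  ring

/-- Weighted Taylor coefficients as pairings with monomials. -/
theorem integral_conj_pow_mul {α : ℝ} (hα : 0 < α) {g : ℂ × ℂ → ℂ}
    (hg : DifferentiableOn ℂ g (thullenDomain α))
    (hi : IntegrableOn g (thullenDomain α)) (n : ℕ) :
    ∫ v in thullenDomain α, conj v.1 ^ n * g v =
      ((Real.pi ^ 2 / ((n + 1) * (α * (n + 1) + 1)) : ℝ) : ℂ) *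
        ((n.factorial : ℂ)⁻¹ * iteratedDeriv n (fun x => g (x, 0)) 0) := by
  obtain ⟨h1, h2⟩ := integral_conj_pow_mul_eq hα hg hi n
  rw [← h2, ← integral_norm_sq_pow hα]
  refine integral_conj_pow_mul_axis hα (f := fun x => g (x, 0)) (hg.comp (by fun_prop) ?_) n h1
  exact fun x hx => mk_zero_mem_thullenDomain hα (mem_ball_zero_iff.1 hx)

end Thullen

namespace Thullen

/-! ### The Bergman kernel -/

/-- The one-variable profile `π⁻² ∑ (n+1)(α(n+1)+1) νⁿ` of the Bergman kernel. -/
noncomputable def kernelProfile (α : ℝ) (ν : ℂ) : ℂ :=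
  (α * (1 + ν) / (1 - ν) ^ 3 + 1 / (1 - ν) ^ 2) / (Real.pi : ℂ) ^ 2

theorem one_sub_ne_zero_of_norm_lt {ν : ℂ} (hν : ‖ν‖ < 1) : 1 - ν ≠ 0 := by
  intro h
  rw [← sub_eq_zero.1 h] at hν
  simp at hν

/-- The coefficients are the reciprocal squared norms of z₁ⁿ. They split as 2α·C(n+2, 2) + (1 - α)(n
+ 1), up to π², so the sum combines (1 - ν)⁻³ and (1 - ν)⁻². -/
theorem hasSum_kernelProfile (α : ℝ) {ν : ℂ} (hν : ‖ν‖ < 1) :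
    HasSum (fun n : ℕ => (((n + 1) * (α * (n + 1) + 1) / Real.pi ^ 2 : ℝ) : ℂ) * ν ^ n)
      (kernelProfile α ν) := by
  have h := one_sub_ne_zero_of_norm_lt hν
  have h1 := hasSum_choose_mul_geometric_of_norm_lt_one 1 hν
  have h2 := hasSum_choose_mul_geometric_of_norm_lt_one 2 hν
  have h3 := ((h2.mul_left (2 * α : ℂ)).add (h1.mul_left (1 - α : ℂ))).div_const ((Real.pi : ℂ) ^ 2)
  have hval : kernelProfile α ν = (2 * α * (1 / (1 - ν) ^ (2 + 1)) +
      (1 - α) * (1 / (1 - ν) ^ (1 + 1))) / (Real.pi : ℂ) ^ 2 := by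
    unfold kernelProfile
    congr 1
    field_simp
    ring
  rw [hval]
  refine Eq.subst (motive := fun F => HasSum F _) (funext fun n => ?_) h3
  have e : (((n + 2).choose 2 : ℕ) : ℂ) = (n + 2) * (n + 1) / 2 := by
    rw [Nat.cast_choose_two]
    push_cast; ring
  rw [e, Nat.choose_one_right]
  push_cast
  ring

theorem norm_kernelProfile_le {α : ℝ} (hα : 0 < α) {ν : ℂ} (hν : ‖ν‖ < 1) :
    ‖kernelProfile α ν‖ ≤ (2 * α + 2) * ‖1 - ν‖ ^ (-3 : ℝ) := by
  have h := one_sub_ne_zero_of_norm_lt hν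
  have hpos : 0 < ‖1 - ν‖ := norm_pos_iff.2 h
  have e : kernelProfile α ν = (α * (1 + ν) + (1 - ν)) / (1 - ν) ^ 3 / (Real.pi : ℂ) ^ 2 := by
    rw [kernelProfile]; congr 1; field_simp
  have hnum : ‖α * (1 + ν) + (1 - ν)‖ ≤ 2 * α + 2 := by
    have h1 : ‖1 + ν‖ ≤ 2 := (norm_add_le _ _).trans (by rw [norm_one]; linarith)
    have h2 : ‖1 - ν‖ ≤ 2 := (norm_sub_le _ _).trans (by rw [norm_one]; linarith)
    refine (norm_add_le _ _).trans ?_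
    rw [norm_mul, Complex.norm_real, Real.norm_of_nonneg hα.le]
    nlinarith
  have hpi : 1 ≤ Real.pi ^ 2 := by nlinarith [Real.pi_gt_three]
  rw [e, norm_div, norm_div, norm_pow, norm_pow, Complex.norm_real,
    Real.norm_of_nonneg Real.pi_pos.le, show (-3 : ℝ) = ((-3 : ℤ) : ℝ) by norm_num,
    Real.rpow_intCast, zpow_neg, ← div_eq_mul_inv]
  refine (div_le_self (by positivity) hpi).trans ?_
  exact div_le_div_of_nonneg_right hnum (by positivity)

theorem conj_kernelProfile (α : ℝ) (ν : ℂ) :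
    conj (kernelProfile α ν) = kernelProfile α (conj ν) := by
  simp [kernelProfile]

theorem differentiableAt_kernelProfile (α : ℝ) {ν : ℂ} (hν : ‖ν‖ < 1) :
    DifferentiableAt ℂ (kernelProfile α) ν := by
  have h := one_sub_ne_zero_of_norm_lt hν
  unfold kernelProfile
  refine DifferentiableAt.div_const ?_ _
  refine DifferentiableAt.add ?_ ?_
  · exact DifferentiableAt.div (by fun_prop) (by fun_prop) (pow_ne_zero _ h)
  · exact DifferentiableAt.div (by fun_prop) (by fun_prop) (pow_ne_zero _ h)

theorem measurable_kernelProfile (α : ℝ) : Measurable (kernelProfile α) := by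
  unfold kernelProfile; fun_prop

/-- The reproducing property at points of the first axis. -/
theorem integral_kernelProfile_mul {α : ℝ} (hα : 0 < α) {g : ℂ × ℂ → ℂ}
    (hg : DifferentiableOn ℂ g (thullenDomain α)) (hi : IntegrableOn g (thullenDomain α))
    {a : ℂ} (ha : ‖a‖ < 1) :
    ∫ v in thullenDomain α, kernelProfile α (a * conj v.1) * g v = g (a, 0) := by
  have hU := measurableSet_thullenDomain hα
  set κ : ℕ → ℝ := fun n => (n + 1) * (α * (n + 1) + 1) / Real.pi ^ 2 with hκ
  have hκ0 : ∀ n, 0 < κ n := fun n => by have := Real.pi_pos; positivity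
  set F : ℕ → ℂ × ℂ → ℂ := fun n v => ((κ n : ℝ) : ℂ) * (a * conj v.1) ^ n * g v with hF
  have hbd : ∀ n, ∀ v ∈ thullenDomain α, ‖((κ n : ℝ) : ℂ) * (a * conj v.1) ^ n‖ ≤ κ n * ‖a‖ ^ n := by
    intro n v hv
    rw [norm_mul, Complex.norm_real, Real.norm_of_nonneg (hκ0 n).le, norm_pow, norm_mul,
      RCLike.norm_conj]
    have := hκ0 n
    gcongr
    exact mul_le_of_le_one_right (norm_nonneg _) (norm_fst_lt_one hα hv).le
  have hFi : ∀ n, Integrable (F n) (volume.restrict (thullenDomain α)) := fun n =>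
    Integrable.bdd_mul (c := κ n * ‖a‖ ^ n) hi (by fun_prop)
      ((ae_restrict_iff' hU).2 (Eventually.of_forall (hbd n)))
  have hsum : Summable fun n => ∫ v in thullenDomain α, ‖F n v‖ := by
    have hs : Summable fun n => κ n * ‖a‖ ^ n := by
      have := (hasSum_kernelProfile α ha).summable.norm
      refine this.congr fun n => ?_
      rw [norm_mul, norm_pow, Complex.norm_real, Real.norm_of_nonneg (hκ0 n).le]
    refine Summable.of_nonneg_of_le (fun n => integral_nonneg fun v => norm_nonneg _) (fun n => ?_)
      (hs.mul_right (∫ v in thullenDomain α, ‖g v‖))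
    rw [← integral_const_mul]
    refine setIntegral_mono_on (hFi n).norm (hi.norm.const_mul _) hU fun v hv => ?_
    rw [hF]
    simp only
    rw [norm_mul]
    gcongr
    exact hbd n v hv
  have h1 := hasSum_integral_of_summable_integral_norm hFi hsum
  have h2 : ∫ v in thullenDomain α, ∑' n, F n v =
      ∫ v in thullenDomain α, kernelProfile α (a * conj v.1) * g v := by
    refine setIntegral_congr_fun hU fun v hv => ?_
    have hν : ‖a * conj v.1‖ < 1 := by
      rw [norm_mul, RCLike.norm_conj]
      have := norm_fst_lt_one hα hv
      nlinarith [norm_nonneg a, norm_nonneg v.1]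
    exact ((hasSum_kernelProfile α hν).mul_right (g v)).tsum_eq
  -- The coefficient κ n cancels the squared norm of the monomial, leaving the n-th Taylor term of x
  -- ↦ g(x, 0) at a.
  have h3 : ∀ n, ∫ v in thullenDomain α, F n v =
      (n.factorial : ℂ)⁻¹ • (a - 0) ^ n • iteratedDeriv n (fun x => g (x, 0)) 0 := by
    intro n
    have e : ∀ v, F n v = (((κ n : ℝ) : ℂ) * a ^ n) * (conj v.1 ^ n * g v) := fun v => by
      rw [hF]; ring
    simp_rw [e]
    rw [integral_const_mul, integral_conj_pow_mul hα hg hi n, sub_zero]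
    have hk : ((κ n : ℝ) : ℂ) * ((Real.pi ^ 2 / ((n + 1) * (α * (n + 1) + 1)) : ℝ) : ℂ) = 1 := by
      rw [← Complex.ofReal_mul, hκ]
      have : Real.pi ^ 2 ≠ 0 := by have := Real.pi_pos; positivity
      have h5 : ((n : ℝ) + 1) * (α * (n + 1) + 1) ≠ 0 := by positivity
      norm_cast
      field_simp
    simp only [smul_eq_mul]
    linear_combination (a ^ n * ((n.factorial : ℂ)⁻¹ * iteratedDeriv n (fun x => g (x, 0)) 0)) * hk
  rw [h2] at h1
  simp_rw [h3] at h1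
  refine h1.unique (Complex.hasSum_taylorSeries_on_ball (f := fun x => g (x, 0)) (r := 1)
    (hg.comp (by fun_prop) fun x hx => ?_) (mem_ball_zero_iff.2 ha))
  exact mk_zero_mem_thullenDomain hα (mem_ball_zero_iff.1 hx)

/-- The Bergman kernel of the Thullen domain, holomorphic in the second argument. -/
noncomputable def kernel (α : ℝ) (z w : ℂ × ℂ) : ℂ :=
  (1 - conj z.2 * w.2) ^ (((-(α + 2) : ℝ)) : ℂ) *
    kernelProfile α (conj z.1 * w.1 * (1 - conj z.2 * w.2) ^ ((-α : ℝ) : ℂ))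

theorem norm_fAlpha {α : ℝ} (z : ℂ × ℂ) (hz : ‖z.2‖ < 1) :
    ‖fAlpha α z‖ = ‖z.1‖ / (1 - ‖z.2‖ ^ 2) ^ (α / 2) := by
  rw [fAlpha, norm_div, Complex.norm_real,
    Real.norm_of_nonneg (Real.rpow_nonneg (one_sub_sq_pos hz).le _)]

theorem norm_fAlpha_lt_one {α : ℝ} (hα : 0 < α) {z : ℂ × ℂ} (hz : z ∈ thullenDomain α) :
    ‖fAlpha α z‖ < 1 := by
  have h := (mem_thullenDomain_iff_fst hα z).1 hz
  rw [norm_fAlpha z h.1, div_lt_one (Real.rpow_pos_of_pos (one_sub_sq_pos h.1) _)]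
  exact h.2

/-- Combine (1 - |z₂|²)(1 - |w₂|²) ≤ |1 - conj z₂ w₂|² with |w₁| < (1 - |w₂|²)^(α/2). The bound is
less than 1 and independent of w, so `kernelProfile` is evaluated away from its pole and the kernel
is bounded in w. -/
theorem norm_kernel_arg_le {α : ℝ} (hα : 0 < α) {z w : ℂ × ℂ} (hz : z ∈ thullenDomain α)
    (hw : w ∈ thullenDomain α) :
    ‖conj z.1 * w.1 * (1 - conj z.2 * w.2) ^ ((-α : ℝ) : ℂ)‖ ≤ ‖fAlpha α z‖ := by
  have hz' := (mem_thullenDomain_iff_fst hα z).1 hz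
  have hw' := (mem_thullenDomain_iff_fst hα w).1 hw
  have hD := one_sub_conj_mul_norm_pos hz'.1 hw'.1
  have h1 := one_sub_sq_pos hz'.1
  have h2 := one_sub_sq_pos hw'.1
  have h3 : (1 - ‖z.2‖ ^ 2) * (1 - ‖w.2‖ ^ 2) ≤ ‖1 - conj z.2 * w.2‖ ^ 2 := by
    rw [← norm_sq_one_sub_sub]
    linarith [sq_nonneg ‖z.2 - w.2‖]
  have h4 : (1 - ‖z.2‖ ^ 2) ^ (α / 2) * (1 - ‖w.2‖ ^ 2) ^ (α / 2) ≤ ‖1 - conj z.2 * w.2‖ ^ α := by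
    rw [← Real.mul_rpow h1.le h2.le]
    refine (Real.rpow_le_rpow (by positivity) h3 (by positivity)).trans (le_of_eq ?_)
    rw [← Real.rpow_natCast, ← Real.rpow_mul hD.le]
    congr 1; push_cast; ring
  rw [norm_mul, norm_mul, RCLike.norm_conj, Complex.norm_cpow_real, Real.rpow_neg hD.le,
    norm_fAlpha z hz'.1, ← div_eq_mul_inv, div_le_div_iff₀ (Real.rpow_pos_of_pos hD _)
    (Real.rpow_pos_of_pos h1 _)]
  calc _ ≤ ‖z.1‖ * (1 - ‖w.2‖ ^ 2) ^ (α / 2) * (1 - ‖z.2‖ ^ 2) ^ (α / 2) := by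
        gcongr; exact hw'.2.le
    _ = ‖z.1‖ * ((1 - ‖z.2‖ ^ 2) ^ (α / 2) * (1 - ‖w.2‖ ^ 2) ^ (α / 2)) := by ring
    _ ≤ _ := by gcongr

theorem one_sub_conj_mul_mem_slitPlane {b y : ℂ} (hb : ‖b‖ < 1) (hy : ‖y‖ < 1) :
    1 - conj b * y ∈ Complex.slitPlane := by
  left
  have h := (Complex.abs_re_le_norm (conj b * y)).trans (by rw [norm_mul, RCLike.norm_conj])
  have := (abs_le.1 h).2
  rw [Complex.sub_re, Complex.one_re]
  nlinarith [norm_nonneg b, norm_nonneg y]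

theorem differentiableOn_kernel {α : ℝ} (hα : 0 < α) {z : ℂ × ℂ} (hz : z ∈ thullenDomain α) :
    DifferentiableOn ℂ (kernel α z) (thullenDomain α) := by
  intro w hw
  have hs := one_sub_conj_mul_mem_slitPlane (norm_snd_lt_one hα hz) (norm_snd_lt_one hα hw)
  refine DifferentiableAt.differentiableWithinAt ?_
  have hd : ∀ r : ℂ, DifferentiableAt ℂ (fun w : ℂ × ℂ => (1 - conj z.2 * w.2) ^ r) w := fun r =>
    DifferentiableAt.cpow (by fun_prop) (by fun_prop) hs
  unfold kernel
  refine (hd _).mul ?_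
  refine DifferentiableAt.comp w (differentiableAt_kernelProfile α
    ((norm_kernel_arg_le hα hz hw).trans_lt (norm_fAlpha_lt_one hα hz))) ?_
  exact DifferentiableAt.mul (by fun_prop) (hd _)

theorem measurable_kernel (α : ℝ) : Measurable fun p : (ℂ × ℂ) × (ℂ × ℂ) => kernel α p.1 p.2 := by
  have := measurable_kernelProfile α
  unfold kernel
  fun_prop

theorem exists_norm_kernel_le {α : ℝ} (hα : 0 < α) {z : ℂ × ℂ} (hz : z ∈ thullenDomain α) :
    ∃ C : ℝ, ∀ w ∈ thullenDomain α, ‖kernel α z w‖ ≤ C := by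
  have hz2 := norm_snd_lt_one hα hz
  have ha := norm_fAlpha_lt_one hα hz
  refine ⟨(1 - ‖z.2‖) ^ (-(α + 2)) * ((2 * α + 2) * (1 - ‖fAlpha α z‖) ^ (-3 : ℝ)), fun w hw => ?_⟩
  have hw2 := norm_snd_lt_one hα hw
  have hν := norm_kernel_arg_le hα hz hw
  rw [kernel, norm_mul, Complex.norm_cpow_real]
  have h1 : 1 - ‖z.2‖ ≤ ‖1 - conj z.2 * w.2‖ := by
    have := one_sub_norm_le z.2 w.2
    nlinarith [norm_nonneg z.2]
  set ν := conj z.1 * w.1 * (1 - conj z.2 * w.2) ^ ((-α : ℝ) : ℂ)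
  have h2 : 1 - ‖fAlpha α z‖ ≤ ‖1 - ν‖ := by
    have := norm_sub_norm_le 1 ν
    rw [norm_one] at this
    linarith
  refine mul_le_mul (Real.rpow_le_rpow_of_nonpos (z := -(α + 2)) (by linarith) h1 (by linarith)) ?_
    (norm_nonneg _) (Real.rpow_nonneg (by linarith) _)
  refine (norm_kernelProfile_le hα (hν.trans_lt ha)).trans ?_
  exact mul_le_mul_of_nonneg_left
    (Real.rpow_le_rpow_of_nonpos (by linarith) h2 (by norm_num)) (by linarith)

theorem conj_cpow_real {x : ℂ} (hx : x ∈ Complex.slitPlane) (r : ℝ) :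
    conj (x ^ (r : ℂ)) = conj x ^ (r : ℂ) := by
  rw [Complex.conj_cpow _ _ (Complex.mem_slitPlane_iff_arg.1 hx).1, Complex.conj_ofReal]

theorem conj_kernel {α : ℝ} (hα : 0 < α) {z w : ℂ × ℂ} (hz : z ∈ thullenDomain α)
    (hw : w ∈ thullenDomain α) : conj (kernel α z w) = kernel α w z := by
  have hs := one_sub_conj_mul_mem_slitPlane (norm_snd_lt_one hα hz) (norm_snd_lt_one hα hw)
  rw [kernel, kernel, map_mul, conj_cpow_real hs, conj_kernelProfile, map_mul, conj_cpow_real hs]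
  simp only [map_sub, map_one, map_mul, Complex.conj_conj]
  rw [mul_comm z.2, mul_comm z.1]

theorem ofReal_mul_cpow {s : ℝ} (hs : 0 < s) {x : ℂ} (hx : x ≠ 0) (r : ℝ) :
    ((s : ℂ) * x) ^ (r : ℂ) = ((s ^ r : ℝ) : ℂ) * x ^ (r : ℂ) := by
  have hs' : (s : ℂ) ≠ 0 := by exact_mod_cast hs.ne'
  rw [Complex.cpow_def_of_ne_zero (mul_ne_zero hs' hx), Complex.log_ofReal_mul hs hx, add_mul,
    Complex.exp_add, ← Complex.cpow_def_of_ne_zero hx, Complex.ofReal_cpow hs.le,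
    Complex.cpow_def_of_ne_zero hs', Complex.ofReal_log hs.le]

theorem fAlpha_eq {α : ℝ} {z : ℂ × ℂ} (hz : ‖z.2‖ < 1) :
    fAlpha α z = z.1 / ((√(1 - ‖z.2‖ ^ 2) ^ α : ℝ) : ℂ) := by
  rw [fAlpha, Real.sqrt_eq_rpow, ← Real.rpow_mul (one_sub_sq_pos hz).le,
    show 1 / 2 * α = α / 2 by ring]

/-- The kernel pulled back by the automorphism `varphiMap`. -/
theorem kernel_varphiMap {α : ℝ} {z v : ℂ × ℂ} (hz : ‖z.2‖ < 1) (hv : ‖v.2‖ < 1) :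
    kernel α z (varphiMap α z.2 v) =
      ((√(1 - ‖z.2‖ ^ 2) ^ (-(α + 2)) : ℝ) : ℂ) *
        ((√(1 - ‖z.2‖ ^ 2) : ℂ) / (1 - conj z.2 * v.2)) ^ ((-(α + 2) : ℝ) : ℂ) *
        kernelProfile α (conj (fAlpha α z) * v.1) := by
  have hpos := one_sub_sq_pos hz
  have hs : 0 < √(1 - ‖z.2‖ ^ 2) := Real.sqrt_pos.2 hpos
  have hD := one_sub_conj_mul_ne_zero hz hv
  set s := √(1 - ‖z.2‖ ^ 2) with hsdef
  have hs' : (s : ℂ) ≠ 0 := by exact_mod_cast hs.ne'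
  have hx : (s : ℂ) / (1 - conj z.2 * v.2) ≠ 0 := div_ne_zero hs' hD
  have h1 : 1 - conj z.2 * moebius z.2 v.2 = (s : ℂ) * ((s : ℂ) / (1 - conj z.2 * v.2)) := by
    rw [one_sub_conj_mul_moebius hz hv, ← mul_div_assoc, ← Complex.ofReal_mul,
      Real.mul_self_sqrt hpos.le]
  rw [kernel, varphiMap_eq]
  simp only
  rw [h1, ofReal_mul_cpow hs hx, ofReal_mul_cpow hs hx, varphiFactor, ← hsdef, fAlpha_eq hz, ← hsdef]
  congr 2
  rw [map_div₀, Complex.conj_ofReal, Complex.ofReal_neg, Complex.cpow_neg, Real.rpow_neg hs.le,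
    Complex.ofReal_inv]
  have hxα : ((s : ℂ) / (1 - conj z.2 * v.2)) ^ (α : ℂ) ≠ 0 := by
    rw [Complex.cpow_ne_zero_iff]; exact Or.inl hx
  field_simp

end Thullen

/-! ### The reproducing property at arbitrary points -/

namespace Thullen

/-- Reading the formula as an identity of measures extends it from nonnegative to complex
integrands. -/
theorem map_withDensity_of_lintegral {X : Type*} [MeasurableSpace X] {μ : Measure X}
    {F : X → X} (hF : Measurable F) {J : X → ℝ≥0∞}
    (h : ∀ G : X → ℝ≥0∞, Measurable G → ∫⁻ x, G x ∂μ = ∫⁻ x, J x * G (F x) ∂μ) :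
    (μ.withDensity J).map F = μ := by
  ext s hs
  have h1 := h (s.indicator 1) (measurable_one.indicator hs)
  rw [lintegral_indicator_one hs] at h1
  rw [h1, Measure.map_apply hF hs, withDensity_apply _ (hF hs), ← lintegral_indicator (hF hs)]
  refine lintegral_congr fun x => ?_
  by_cases hx : F x ∈ s
  · rw [indicator_of_mem (show x ∈ F ⁻¹' s from hx), indicator_of_mem hx, Pi.one_apply, mul_one]
  · rw [indicator_of_notMem (show x ∉ F ⁻¹' s from hx), indicator_of_notMem hx, mul_zero]

theorem integral_of_lintegral {X : Type*} [MeasurableSpace X] {μ : Measure X}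
    {F : X → X} (hF : Measurable F) {J : X → ℝ} (hJm : Measurable J) (hJ : ∀ x, 0 ≤ J x)
    (h : ∀ G : X → ℝ≥0∞, Measurable G → ∫⁻ x, G x ∂μ = ∫⁻ x, ENNReal.ofReal (J x) * G (F x) ∂μ)
    {f : X → ℂ} (hf : Integrable f μ) :
    Integrable (fun x => J x • f (F x)) μ ∧ ∫ x, f x ∂μ = ∫ x, J x • f (F x) ∂μ := by
  have hmap := map_withDensity_of_lintegral hF h
  have hJm' : Measurable fun x => ENNReal.ofReal (J x) := by fun_prop
  have hfin : ∀ᵐ x ∂μ, ENNReal.ofReal (J x) < ∞ := Eventually.of_forall fun x => by simp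
  have hto : ∀ x, (ENNReal.ofReal (J x)).toReal = J x := fun x => ENNReal.toReal_ofReal (hJ x)
  have hfs : AEStronglyMeasurable f ((μ.withDensity fun x => ENNReal.ofReal (J x)).map F) := by
    rw [hmap]; exact hf.1
  constructor
  · have h1 := (integrable_map_measure hfs hF.aemeasurable).1 (by rwa [hmap])
    rw [integrable_withDensity_iff_integrable_smul' hJm' hfin] at h1
    simpa only [hto, Function.comp] using h1
  · have h1 := integral_map hF.aemeasurable hfs
    rw [hmap, integral_withDensity_eq_integral_toReal_smul hJm' hfin] at h1
    simpa only [hto] using h1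

theorem moebiusJac_nonneg {a : ℂ} (ha : ‖a‖ < 1) (x : ℂ) : 0 ≤ moebiusJac a x :=
  div_nonneg (one_sub_sq_pos ha).le (by positivity)

/-- The base of the power in `varphiMap`. -/
noncomputable def powerBase (b y : ℂ) : ℂ := (Real.sqrt (1 - ‖b‖ ^ 2) : ℂ) / (1 - conj b * y)

theorem norm_powerBase_sq {b : ℂ} (hb : ‖b‖ < 1) (y : ℂ) : ‖powerBase b y‖ ^ 2 = moebiusJac b y := by
  rw [powerBase, norm_div, Complex.norm_real, Real.norm_of_nonneg (Real.sqrt_nonneg _), div_pow,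
    Real.sq_sqrt (one_sub_sq_pos hb).le, moebiusJac]

theorem powerBase_mem_slitPlane {b y : ℂ} (hb : ‖b‖ < 1) (hy : ‖y‖ < 1) :
    powerBase b y ∈ Complex.slitPlane := by
  have hs : 0 < √(1 - ‖b‖ ^ 2) := Real.sqrt_pos.2 (one_sub_sq_pos hb)
  have hre : 0 < (1 - conj b * y).re := by
    have h := (Complex.abs_re_le_norm (conj b * y)).trans (by rw [norm_mul, RCLike.norm_conj])
    have := (abs_le.1 h).2
    rw [Complex.sub_re, Complex.one_re]
    nlinarith [norm_nonneg b, norm_nonneg y]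
  left
  have hD := one_sub_conj_mul_ne_zero hb hy
  rw [powerBase, Complex.div_re, Complex.ofReal_re, Complex.ofReal_im, zero_mul, zero_div, add_zero]
  exact div_pos (mul_pos hs hre) (Complex.normSq_pos.2 hD)

theorem differentiableOn_powerBase_cpow {α : ℝ} (hα : 0 < α) {b : ℂ} (hb : ‖b‖ < 1) (r : ℂ) :
    DifferentiableOn ℂ (fun w : ℂ × ℂ => powerBase b w.2 ^ r) (thullenDomain α) := by
  intro w hw
  have hw2 := norm_snd_lt_one hα hw
  have h2 : DifferentiableAt ℂ (fun w : ℂ × ℂ => 1 - conj b * w.2) w := by fun_prop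
  have h3 : DifferentiableAt ℂ (fun w : ℂ × ℂ => powerBase b w.2) w := by
    unfold powerBase
    simp_rw [div_eq_mul_inv]
    exact (h2.fun_inv (one_sub_conj_mul_ne_zero hb hw2)).const_mul _
  exact (h3.cpow_const (powerBase_mem_slitPlane hb hw2)).differentiableWithinAt

theorem differentiableOn_varphiMap {α : ℝ} (hα : 0 < α) {b : ℂ} (hb : ‖b‖ < 1) :
    DifferentiableOn ℂ (varphiMap α b) (thullenDomain α) := by
  have h1 : DifferentiableOn ℂ (fun w : ℂ × ℂ => w.1 * powerBase b w.2 ^ (α : ℂ))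
    (thullenDomain α) := DifferentiableOn.mul (by fun_prop) (differentiableOn_powerBase_cpow hα hb _)
  refine h1.prodMk fun w hw => ?_
  refine DifferentiableAt.differentiableWithinAt ?_
  exact DifferentiableAt.comp (f := fun w : ℂ × ℂ => w.2) w
    (hasDerivAt_moebius hb (norm_snd_lt_one hα hw)).differentiableAt (by fun_prop)

/-- The reproducing property of the Bergman kernel. -/
theorem integral_conj_kernel_mul {α : ℝ} (hα : 0 < α) {f : ℂ × ℂ → ℂ}
    (hf : DifferentiableOn ℂ f (thullenDomain α)) (hi : IntegrableOn f (thullenDomain α))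
    {z : ℂ × ℂ} (hz : z ∈ thullenDomain α) :
    ∫ w in thullenDomain α, conj (kernel α z w) * f w = f z := by
  have hU := measurableSet_thullenDomain hα
  have hb := norm_snd_lt_one hα hz
  have ha := norm_fAlpha_lt_one hα hz
  have hs : 0 < √(1 - ‖z.2‖ ^ 2) := Real.sqrt_pos.2 (one_sub_sq_pos hb)
  have hJ0 : ∀ w : ℂ × ℂ, 0 ≤ moebiusJac z.2 w.2 ^ (α + 2) := fun w =>
    Real.rpow_nonneg (moebiusJac_nonneg hb _) _
  have hJm : Measurable fun w : ℂ × ℂ => moebiusJac z.2 w.2 ^ (α + 2) := by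
    unfold moebiusJac; fun_prop
  have hker : Measurable (kernel α z) := (measurable_kernel α).of_uncurry_left
  obtain ⟨C, hC⟩ := exists_norm_kernel_le hα hz
  have hi' : Integrable (fun w => conj (kernel α z w) * f w) (volume.restrict (thullenDomain α)) := by
    refine Integrable.bdd_mul (c := C) hi (by
      exact (Complex.continuous_conj.measurable.comp hker).aestronglyMeasurable) ?_
    filter_upwards [ae_restrict_mem hU] with w hw
    rw [RCLike.norm_conj]
    exact hC w hw
  have hcov := fun {F : ℂ × ℂ → ℂ} (hF : Integrable F (volume.restrict (thullenDomain α))) =>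
    integral_of_lintegral (measurable_varphiMap α z.2) hJm hJ0
      (fun G hG => lintegral_varphiMap hα hb hG) hF
  -- The power of `powerBase` is, up to sign, the complex Jacobian of `varphiMap`, and its squared
  -- modulus is the real Jacobian. Thus g is the weighted pullback of f, again holomorphic.
  set g : ℂ × ℂ → ℂ := fun v => powerBase z.2 v.2 ^ ((α + 2 : ℝ) : ℂ) * f (varphiMap α z.2 v) with hg
  have hgd : DifferentiableOn ℂ g (thullenDomain α) :=
    (differentiableOn_powerBase_cpow hα hb _).mul (hf.comp (differentiableOn_varphiMap hα hb)
      fun w hw => varphiMap_mem hα hb hw)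
  have hne : ∀ v ∈ thullenDomain α, powerBase z.2 v.2 ≠ 0 := fun v hv =>
    Complex.slitPlane_ne_zero (powerBase_mem_slitPlane hb (norm_snd_lt_one hα hv))
  have hsq : ∀ v, ‖powerBase z.2 v‖ ^ 2 = moebiusJac z.2 v := norm_powerBase_sq hb
  have hJy : ∀ v ∈ thullenDomain α, ((moebiusJac z.2 v.2 ^ (α + 2) : ℝ) : ℂ) =
      powerBase z.2 v.2 ^ ((α + 2 : ℝ) : ℂ) * conj (powerBase z.2 v.2 ^ ((α + 2 : ℝ) : ℂ)) := by
    intro v hv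
    rw [Complex.mul_conj, Complex.normSq_eq_norm_sq, Complex.norm_cpow_real, ← hsq,
      ← Real.rpow_natCast, ← Real.rpow_natCast, ← Real.rpow_mul (norm_nonneg _),
      ← Real.rpow_mul (norm_nonneg _), mul_comm]
  have hgi : IntegrableOn g (thullenDomain α) := by
    have h1 := (hcov hi).1
    -- Integrability is known for the pullback multiplied by the full real Jacobian. The conjugate
    -- half can be divided out because `powerBase` is bounded below.
    have hlow : ∀ v ∈ thullenDomain α, √(1 - ‖z.2‖ ^ 2) / 2 ≤ ‖powerBase z.2 v.2‖ := by
      intro v hv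
      have hv2 := norm_snd_lt_one hα hv
      rw [powerBase, norm_div, Complex.norm_real, Real.norm_of_nonneg hs.le]
      have := one_sub_conj_mul_norm_pos hb hv2
      have := norm_one_sub_conj_mul_le_two hb hv2
      gcongr
    have h2 : Integrable (fun v => (conj (powerBase z.2 v.2 ^ ((α + 2 : ℝ) : ℂ)))⁻¹ *
        (moebiusJac z.2 v.2 ^ (α + 2) • f (varphiMap α z.2 v)))
        (volume.restrict (thullenDomain α)) := by
      refine Integrable.bdd_mul (c := (√(1 - ‖z.2‖ ^ 2) / 2) ^ (-(α + 2))) h1 ?_ ?_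
      · refine Measurable.aestronglyMeasurable ?_
        unfold powerBase
        exact (Complex.continuous_conj.measurable.comp (by fun_prop)).inv
      · filter_upwards [ae_restrict_mem hU] with v hv
        rw [norm_inv, RCLike.norm_conj, Complex.norm_cpow_real, ← Real.rpow_neg (norm_nonneg _)]
        exact Real.rpow_le_rpow_of_nonpos (by positivity) (hlow v hv) (by linarith)
    refine h2.congr ?_
    filter_upwards [ae_restrict_mem hU] with v hv
    have h0 : conj (powerBase z.2 v.2 ^ ((α + 2 : ℝ) : ℂ)) ≠ 0 := by
      rw [map_ne_zero, Complex.cpow_ne_zero_iff]; exact Or.inl (hne v hv)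
    rw [Complex.real_smul, hJy v hv, hg]
    field_simp
  have hrep := integral_kernelProfile_mul hα hgd hgi ha
  rw [(hcov hi').2]
  -- The conjugate of the pulled-back kernel cancels the conjugate half of the Jacobian, reducing
  -- the claim to the point (f_α(z), 0) of the first axis.
  have hcongr : ∀ v ∈ thullenDomain α, moebiusJac z.2 v.2 ^ (α + 2) •
      (conj (kernel α z (varphiMap α z.2 v)) * f (varphiMap α z.2 v)) =
      ((√(1 - ‖z.2‖ ^ 2) ^ (-(α + 2)) : ℝ) : ℂ) *
        (kernelProfile α (fAlpha α z * conj v.1) * g v) := by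
    intro v hv
    have h0 : conj (powerBase z.2 v.2 ^ ((α + 2 : ℝ) : ℂ)) ≠ 0 := by
      rw [map_ne_zero, Complex.cpow_ne_zero_iff]; exact Or.inl (hne v hv)
    rw [kernel_varphiMap hb (norm_snd_lt_one hα hv), ← powerBase, map_mul, map_mul,
      Complex.conj_ofReal, conj_kernelProfile, map_mul, Complex.conj_conj, Complex.real_smul,
      hJy v hv, Complex.ofReal_neg (α + 2), Complex.cpow_neg, map_inv₀, hg]
    field_simp
  rw [setIntegral_congr_fun hU hcongr, integral_const_mul, hrep, hg]
  have hpt : varphiMap α z.2 (fAlpha α z, 0) = z := by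
    have hsa : ((√(1 - ‖z.2‖ ^ 2) ^ α : ℝ) : ℂ) ≠ 0 := by
      exact_mod_cast (Real.rpow_pos_of_pos hs _).ne'
    rw [varphiMap_eq, varphiFactor, moebius, fAlpha_eq hb]
    simp only [mul_zero, sub_zero, div_one]
    rw [← Complex.ofReal_cpow hs.le, div_mul_cancel₀ _ hsa]
  simp only
  rw [hpt, powerBase, mul_zero, sub_zero, div_one, ← Complex.ofReal_cpow hs.le, ← mul_assoc,
    ← Complex.ofReal_mul, ← Real.rpow_add hs, neg_add_cancel, Real.rpow_zero, Complex.ofReal_one,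
    one_mul]

/-! ### The pointwise estimate behind the Schur test -/

/-- Put E = 1 - |a|² and N = |1 - conj a x|. Then `moebiusJac` is E/N², `fibreScale` is at most a
multiple of it, and the profile is at most a multiple of (E/N)⁻³. The exponents add up to -t for E
and 2t - 3 for N, and 1 - |a|^(2/α) is at most a multiple of E. -/
theorem profile_bound {α t : ℝ} (hα : 0 < α) (ht0 : 0 < t) (ht1 : t < 1) :
    ∃ C : ℝ, 0 ≤ C ∧ ∀ a x : ℂ, ‖a‖ < 1 → ‖x‖ < 1 →
      moebiusJac a x ^ 2 * fibreScale α a x ^ (1 - t) * ‖kernelProfile α (conj a * moebius a x)‖ ≤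
        C * ((1 - ‖a‖ ^ (2 / α)) ^ (-t) * ‖1 - conj a * x‖ ^ (2 * t - 3)) := by
  set M := max 1 (1 / α) with hM
  have hM0 : 0 < M := by positivity
  set c := M / min 1 (1 / α) with hc
  have hc0 : 0 < c := by positivity
  refine ⟨(2 * α + 2) * c ^ (1 - t) * M ^ t, by positivity, fun a x ha hx => ?_⟩
  have hE := one_sub_sq_pos ha
  have hN := one_sub_conj_mul_norm_pos ha hx
  have hA := one_sub_rpow_pos hα ha
  have hm := norm_moebius_lt_one ha hx
  have hS := fibreScale_le hα ha hx
  have hS0 := fibreScale_pos hα ha hx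
  have hAE : 1 - ‖a‖ ^ (2 / α) ≤ M * (1 - ‖a‖ ^ 2) := one_sub_rpow_le_mul hα ha
  have hk : ‖kernelProfile α (conj a * moebius a x)‖ ≤
      (2 * α + 2) * ((1 - ‖a‖ ^ 2) / ‖1 - conj a * x‖) ^ (-3 : ℝ) := by
    have h1 : ‖conj a * moebius a x‖ < 1 := by
      rw [norm_mul, RCLike.norm_conj]
      nlinarith [norm_nonneg a, norm_nonneg (moebius a x)]
    have := norm_kernelProfile_le hα h1
    rwa [one_sub_conj_mul_moebius ha hx, norm_div, Complex.norm_real,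
      Real.norm_of_nonneg hE.le] at this
  set E := 1 - ‖a‖ ^ 2
  set N := ‖1 - conj a * x‖ with hNd
  set A := 1 - ‖a‖ ^ (2 / α)
  have hB : moebiusJac a x = E * N ^ (-2 : ℝ) := by
    rw [moebiusJac, ← hNd, Real.rpow_neg hN.le, Real.rpow_two]; rfl
  have h1 : fibreScale α a x ^ (1 - t) ≤ (c * (E * N ^ (-2 : ℝ))) ^ (1 - t) := by
    rw [← hB]
    exact Real.rpow_le_rpow hS0.le hS (by linarith)
  have h2 : (M * E) ^ (-t) ≤ A ^ (-t) := Real.rpow_le_rpow_of_nonpos hA hAE (by linarith)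
  have hN2 : 0 < N ^ (-2 : ℝ) := Real.rpow_pos_of_pos hN _
  rw [hB]
  calc _ ≤ (E * N ^ (-2 : ℝ)) ^ 2 * (c * (E * N ^ (-2 : ℝ))) ^ (1 - t) *
        ((2 * α + 2) * (E / N) ^ (-3 : ℝ)) := by gcongr
    _ = (2 * α + 2) * c ^ (1 - t) * M ^ t * ((M * E) ^ (-t) * N ^ (2 * t - 3)) := by
        rw [← Real.rpow_two, Real.mul_rpow hE.le hN2.le, Real.mul_rpow hc0.le (by positivity),
          Real.mul_rpow hE.le hN2.le, Real.div_rpow hE.le hN.le, Real.mul_rpow hM0.le hE.le,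
          ← Real.rpow_mul hN.le, ← Real.rpow_mul hN.le]
        have e1 : M ^ t * M ^ (-t) = 1 := by rw [← Real.rpow_add hM0]; simp
        have e2 : E ^ (2 : ℝ) * E ^ (1 - t) * E ^ (-3 : ℝ) = E ^ (-t) := by
          rw [← Real.rpow_add hE, ← Real.rpow_add hE]; congr 1; ring
        have e3 : N ^ (-2 * 2 : ℝ) * N ^ (-2 * (1 - t)) / N ^ (-3 : ℝ) = N ^ (2 * t - 3) := by
          rw [← Real.rpow_add hN, ← Real.rpow_sub hN]; congr 1; ring
        rw [← e2, ← e3]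
        linear_combination (-(2 * α + 2) * c ^ (1 - t) * (E ^ (2 : ℝ) * E ^ (1 - t) * E ^ (-3 : ℝ)) *
          (N ^ (-2 * 2 : ℝ) * N ^ (-2 * (1 - t)) / N ^ (-3 : ℝ))) * e1
    _ ≤ _ := by gcongr

/-- The test function for the Schur test. -/
noncomputable def schurFun (α t : ℝ) (w : ℂ × ℂ) : ℝ :=
  (1 - ‖w.2‖ ^ 2) ^ (t - (α + 2) / 4) * defFun α w ^ (-t)

theorem schurFun_pos {α t : ℝ} (hα : 0 < α) {w : ℂ × ℂ} (hw : w ∈ thullenDomain α) :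
    0 < schurFun α t w :=
  mul_pos (Real.rpow_pos_of_pos (one_sub_sq_pos (norm_snd_lt_one hα hw)) _)
    (Real.rpow_pos_of_pos ((defFun_pos_iff w).2 hw) _)

theorem measurable_schurFun (α t : ℝ) : Measurable (schurFun α t) := by
  have := measurable_defFun α
  unfold schurFun; fun_prop

/-- The defining function at z is (1 - |z₂|²)(1 - |f_α(z)|^(2/α)), so the exponents ±t of the first
factor cancel. In this form the test function is recognised after transport. -/
theorem schurFun_eq {α : ℝ} (t : ℝ) (hα : 0 < α) {z : ℂ × ℂ} (hz : z ∈ thullenDomain α) :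
    schurFun α t z = (1 - ‖z.2‖ ^ 2) ^ (-((α + 2) / 4)) * (1 - ‖fAlpha α z‖ ^ (2 / α)) ^ (-t) := by
  have hb := norm_snd_lt_one hα hz
  have hs := one_sub_sq_pos hb
  have hA := one_sub_rpow_pos hα (norm_fAlpha_lt_one hα hz)
  have hd : defFun α z = (1 - ‖z.2‖ ^ 2) * (1 - ‖fAlpha α z‖ ^ (2 / α)) := by
    rw [norm_fAlpha z hb, Real.div_rpow (norm_nonneg _) (Real.rpow_nonneg hs.le _),
      ← Real.rpow_mul hs.le, show α / 2 * (2 / α) = 1 by field_simp, Real.rpow_one, defFun]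
    field_simp
    ring
  rw [schurFun, hd, Real.mul_rpow hs.le hA.le, ← mul_assoc, ← Real.rpow_add hs]
  congr 2; ring

/-- Let v be the image of w under ϕ. The Jacobian of φ times the pulled-back kernel is |1 - conj z₂
v₂|^(-(α+2)) times the profile, all powers of 1 - |z₂|² cancelling. In the pulled-back test function
they survive as (1 - |z₂|²)^(-(α+2)/4), the same factor as in `schurFun_eq`. The remaining
`fibreScale` factors have exponent 1 - t, as `profile_bound` requires. -/
theorem kernel_weight_bound {α t : ℝ} (hα : 0 < α) (ht0 : 0 < t) (ht1 : t < 1) :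
    ∃ C : ℝ, 0 ≤ C ∧ ∀ z ∈ thullenDomain α, ∀ w ∈ thullenDomain α,
      moebiusJac (fAlpha α z) w.1 ^ 2 * fibreScale α (fAlpha α z) w.1 *
        (moebiusJac z.2 (phiMap α (fAlpha α z) w).2 ^ (α + 2) *
          (‖kernel α z (varphiMap α z.2 (phiMap α (fAlpha α z) w))‖ *
            schurFun α t (varphiMap α z.2 (phiMap α (fAlpha α z) w)))) ≤
      C * schurFun α t z * schurWeight α t (fAlpha α z) z.2 w := by
  obtain ⟨C, hC, h⟩ := profile_bound hα ht0 ht1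
  refine ⟨C, hC, fun z hz w hw => ?_⟩
  have hb := norm_snd_lt_one hα hz
  have ha := norm_fAlpha_lt_one hα hz
  have hx := norm_fst_lt_one hα hw
  have hv := phiMap_mem hα ha hw
  have hv2 := norm_snd_lt_one hα hv
  have hprof := h (fAlpha α z) w.1 ha hx
  have hS := fibreScale_pos hα ha hx
  have hδ := (defFun_pos_iff w).2 hw
  have hδv := defFun_phiMap hα ha hx
  have hfst : (phiMap α (fAlpha α z) w).1 = moebius (fAlpha α z) w.1 := rfl
  set a := fAlpha α z with had
  set v := phiMap α a w with hvd
  have hr := one_sub_sq_pos hv2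
  have hs2 := one_sub_sq_pos hb
  have hs : 0 < √(1 - ‖z.2‖ ^ 2) := Real.sqrt_pos.2 hs2
  have hD := one_sub_conj_mul_norm_pos hb hv2
  have hj := moebiusJac_pos hb hv2
  have hA := one_sub_rpow_pos hα ha
  have hker : moebiusJac z.2 v.2 ^ (α + 2) * ‖kernel α z (varphiMap α z.2 v)‖ =
      ‖1 - conj z.2 * v.2‖ ^ (-(α + 2)) * ‖kernelProfile α (conj a * moebius a w.1)‖ := by
    rw [kernel_varphiMap hb hv2, norm_mul, norm_mul, Complex.norm_cpow_real, Complex.norm_real,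
      Real.norm_of_nonneg (Real.rpow_nonneg hs.le _), norm_div, Complex.norm_real,
      Real.norm_of_nonneg hs.le, ← had, hfst, ← mul_assoc]
    congr 1
    have hj2 : moebiusJac z.2 v.2 = √(1 - ‖z.2‖ ^ 2) ^ (2 : ℝ) * ‖1 - conj z.2 * v.2‖ ^ (-2 : ℝ) := by
      rw [Real.rpow_two, Real.sq_sqrt hs2.le, Real.rpow_neg hD.le, Real.rpow_two, moebiusJac]; rfl
    rw [hj2, Real.mul_rpow (by positivity) (by positivity), Real.div_rpow hs.le hD.le,
      ← Real.rpow_mul hs.le, ← Real.rpow_mul hD.le]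
    have e1 : √(1 - ‖z.2‖ ^ 2) ^ (2 * (α + 2)) * √(1 - ‖z.2‖ ^ 2) ^ (-(α + 2)) *
        √(1 - ‖z.2‖ ^ 2) ^ (-(α + 2)) = 1 := by
      rw [← Real.rpow_add hs, ← Real.rpow_add hs]
      rw [show 2 * (α + 2) + -(α + 2) + -(α + 2) = 0 by ring, Real.rpow_zero]
    have e2 : ‖1 - conj z.2 * v.2‖ ^ (-2 * (α + 2)) / ‖1 - conj z.2 * v.2‖ ^ (-(α + 2)) =
        ‖1 - conj z.2 * v.2‖ ^ (-(α + 2)) := by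
      rw [← Real.rpow_sub hD]; congr 1; ring
    refine Eq.trans ?_ e2
    linear_combination (‖1 - conj z.2 * v.2‖ ^ (-2 * (α + 2)) /
      ‖1 - conj z.2 * v.2‖ ^ (-(α + 2))) * e1
  have hh : schurFun α t (varphiMap α z.2 v) =
      (1 - ‖z.2‖ ^ 2) ^ (-((α + 2) / 4)) * ‖1 - conj z.2 * v.2‖ ^ ((α + 2) / 2) *
        (1 - ‖v.2‖ ^ 2) ^ (t - (α + 2) / 4) * (fibreScale α a w.1 ^ (-t) * defFun α w ^ (-t)) := by
    rw [schurFun, one_sub_norm_varphiMap_snd hb hv2, defFun_varphiMap hα hb hv2, hδv,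
      Real.mul_rpow hj.le hr.le, Real.mul_rpow hj.le (by positivity), Real.mul_rpow hS.le hδ.le]
    have e1 : moebiusJac z.2 v.2 ^ (t - (α + 2) / 4) * moebiusJac z.2 v.2 ^ (-t) =
        (1 - ‖z.2‖ ^ 2) ^ (-((α + 2) / 4)) * ‖1 - conj z.2 * v.2‖ ^ ((α + 2) / 2) := by
      rw [← Real.rpow_add hj, show t - (α + 2) / 4 + -t = -((α + 2) / 4) by ring, moebiusJac,
        Real.div_rpow hs2.le (by positivity), ← Real.rpow_natCast ‖1 - conj z.2 * v.2‖,
        ← Real.rpow_mul hD.le, div_eq_mul_inv, ← Real.rpow_neg hD.le]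
      congr 2; push_cast; ring
    rw [← e1]; ring
  have hSS : fibreScale α a w.1 * fibreScale α a w.1 ^ (-t) = fibreScale α a w.1 ^ (1 - t) := by
    nth_rewrite 1 [← Real.rpow_one (fibreScale α a w.1)]
    rw [← Real.rpow_add hS]; congr 1
  have hDD : ‖1 - conj z.2 * v.2‖ ^ (-(α + 2)) * ‖1 - conj z.2 * v.2‖ ^ ((α + 2) / 2) =
      ‖1 - conj z.2 * v.2‖ ^ (-((α + 2) / 2)) := by
    rw [← Real.rpow_add hD]; congr 1; ring
  rw [schurFun_eq t hα hz, schurWeight, ← hvd, ← had]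
  set K := ‖kernelProfile α (conj a * moebius a w.1)‖
  calc _ = moebiusJac a w.1 ^ 2 * fibreScale α a w.1 * ((moebiusJac z.2 v.2 ^ (α + 2) *
          ‖kernel α z (varphiMap α z.2 v)‖) * schurFun α t (varphiMap α z.2 v)) := by ring
    _ = (moebiusJac a w.1 ^ 2 * (fibreScale α a w.1 * fibreScale α a w.1 ^ (-t)) * K) *
        ((1 - ‖z.2‖ ^ 2) ^ (-((α + 2) / 4)) * (‖1 - conj z.2 * v.2‖ ^ (-(α + 2)) *
          ‖1 - conj z.2 * v.2‖ ^ ((α + 2) / 2)) * (1 - ‖v.2‖ ^ 2) ^ (t - (α + 2) / 4) *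
          defFun α w ^ (-t)) := by rw [hker, hh]; ring
    _ ≤ (C * ((1 - ‖a‖ ^ (2 / α)) ^ (-t) * ‖1 - conj a * w.1‖ ^ (2 * t - 3))) *
        ((1 - ‖z.2‖ ^ 2) ^ (-((α + 2) / 4)) * (‖1 - conj z.2 * v.2‖ ^ (-(α + 2)) *
          ‖1 - conj z.2 * v.2‖ ^ ((α + 2) / 2)) * (1 - ‖v.2‖ ^ 2) ^ (t - (α + 2) / 4) *
          defFun α w ^ (-t)) := by
        rw [hSS]
        exact mul_le_mul_of_nonneg_right hprof (by positivity)
    _ = _ := by rw [hDD]; ring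

end Thullen

namespace Thullen

/-! ### The Schur test -/

/-- Cauchy–Schwarz for the factorisation M f = (M h)^(1/2) · (M f²/h)^(1/2). -/
theorem lintegral_mul_sq_le {X : Type*} [MeasurableSpace X] {μ : Measure X} {M h f : X → ℝ≥0∞}
    (hM : Measurable M) (hh : Measurable h) (hf : Measurable f) (h0 : ∀ᵐ x ∂μ, h x ≠ 0)
    (ht : ∀ᵐ x ∂μ, h x ≠ ∞) :
    (∫⁻ x, M x * f x ∂μ) ^ 2 ≤ (∫⁻ x, M x * h x ∂μ) * ∫⁻ x, M x * (f x ^ 2 * (h x)⁻¹) ∂μ := by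
  have hpq : (2 : ℝ).HolderConjugate 2 := Real.HolderConjugate.two_two
  have key := ENNReal.lintegral_mul_le_Lp_mul_Lq μ hpq
    (f := fun x => (M x * h x) ^ (1 / 2 : ℝ)) (g := fun x => (M x * (f x ^ 2 * (h x)⁻¹)) ^ (1 / 2 : ℝ))
    (by fun_prop) (by fun_prop)
  have e1 : ∀ y : ℝ≥0∞, (y ^ (1 / 2 : ℝ)) ^ (2 : ℝ) = y := fun y => by
    rw [← ENNReal.rpow_mul]; norm_num
  have e2 : ∀ᵐ x ∂μ, ((fun x => (M x * h x) ^ (1 / 2 : ℝ)) *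
      fun x => (M x * (f x ^ 2 * (h x)⁻¹)) ^ (1 / 2 : ℝ)) x = M x * f x := by
    filter_upwards [h0, ht] with x hx0 hxt
    rw [Pi.mul_apply, ← ENNReal.mul_rpow_of_nonneg _ _ (by norm_num),
      show M x * h x * (M x * (f x ^ 2 * (h x)⁻¹)) = (M x * f x) ^ 2 * (h x * (h x)⁻¹) by ring,
      ENNReal.mul_inv_cancel hx0 hxt, mul_one, ← ENNReal.rpow_natCast, ← ENNReal.rpow_mul]
    norm_num
  rw [lintegral_congr_ae e2] at key
  simp_rw [e1] at key
  refine (pow_le_pow_left' key 2).trans (le_of_eq ?_)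
  rw [mul_pow, ← ENNReal.rpow_natCast, ← ENNReal.rpow_natCast, ← ENNReal.rpow_mul,
    ← ENNReal.rpow_mul]
  norm_num

/-- Schur's test for a nonnegative kernel. -/
theorem schur_test {X : Type*} [MeasurableSpace X] {μ : Measure X} [SFinite μ]
    {M : X → X → ℝ≥0∞} (hM : Measurable (Function.uncurry M)) {h : X → ℝ≥0∞} (hh : Measurable h)
    (h0 : ∀ᵐ x ∂μ, h x ≠ 0) (ht : ∀ᵐ x ∂μ, h x ≠ ∞) {A : ℝ≥0∞}
    (h1 : ∀ᵐ x ∂μ, ∫⁻ y, M x y * h y ∂μ ≤ A * h x)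
    (h2 : ∀ᵐ y ∂μ, ∫⁻ x, M x y * h x ∂μ ≤ A * h y) {f : X → ℝ≥0∞} (hf : Measurable f) :
    ∫⁻ x, (∫⁻ y, M x y * f y ∂μ) ^ 2 ∂μ ≤ A ^ 2 * ∫⁻ y, f y ^ 2 ∂μ := by
  have hM' : Measurable fun p : X × X => M p.1 p.2 := hM
  have hMx : ∀ x, Measurable (M x) := fun x => hM.of_uncurry_left
  calc ∫⁻ x, (∫⁻ y, M x y * f y ∂μ) ^ 2 ∂μ
      ≤ ∫⁻ x, A * ∫⁻ y, M x y * h x * (f y ^ 2 * (h y)⁻¹) ∂μ ∂μ := by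
        refine lintegral_mono_ae ?_
        filter_upwards [h1] with x hx
        refine (lintegral_mul_sq_le (hMx x) hh hf h0 ht).trans ((mul_le_mul_left hx _).trans ?_)
        rw [mul_assoc, ← lintegral_const_mul _ (by have := hMx x; fun_prop)]
        exact mul_le_mul_right (le_of_eq (lintegral_congr fun y => by ring)) _
    _ = A * ∫⁻ y, ∫⁻ x, M x y * h x * (f y ^ 2 * (h y)⁻¹) ∂μ ∂μ := by
        rw [lintegral_const_mul]
        · congr 1
          exact lintegral_lintegral_swap (Measurable.aemeasurable (by fun_prop))
        · exact Measurable.lintegral_prod_right' (f := fun p : X × X =>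
            M p.1 p.2 * h p.1 * (f p.2 ^ 2 * (h p.2)⁻¹)) (by fun_prop)
    _ ≤ A * ∫⁻ y, A * f y ^ 2 ∂μ := by
        gcongr A * ?_
        refine lintegral_mono_ae ?_
        filter_upwards [h2, h0, ht] with y hy hy0 hyt
        have hMy : Measurable fun x => M x y := hM.of_uncurry_right
        rw [lintegral_mul_const _ (by fun_prop)]
        refine (mul_le_mul_left hy _).trans (le_of_eq ?_)
        rw [show A * h y * (f y ^ 2 * (h y)⁻¹) = A * f y ^ 2 * (h y * (h y)⁻¹) by ring,
          ENNReal.mul_inv_cancel hy0 hyt, mul_one]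
    _ = A ^ 2 * ∫⁻ y, f y ^ 2 ∂μ := by
        rw [lintegral_const_mul _ (by fun_prop), ← mul_assoc, sq]

/-- The weighted integral condition of the Schur test for the kernel `(u(z)-u(w)) K(z,w)`. -/
theorem exists_lintegral_schur_le {α : ℝ} (hα : 0 < α) {p q : ℝ} (hpq : p.HolderConjugate q)
    (hq : q < 4 / 3) :
    ∃ t : ℝ, ∃ C : ℝ≥0∞, C < ∞ ∧ ∀ u : ℂ × ℂ → ℂ, Measurable u → ∀ z ∈ thullenDomain α,
      ∫⁻ w in thullenDomain α, ‖u z - u w‖ₑ * ‖kernel α z w‖ₑ * ENNReal.ofReal (schurFun α t w) ≤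
        C * eLpNorm (fun w => u z - u (varphiMap α z.2 (phiMap α (fAlpha α z) w)))
          (ENNReal.ofReal p) (volume.restrict (thullenDomain α)) *
          ENNReal.ofReal (schurFun α t z) := by
  obtain ⟨t, ht0, ht1, C₁, hC₁, hW⟩ := exists_lintegral_schurWeight_le hα hpq.symm.lt.le hq
  obtain ⟨C₂, hC₂, hK⟩ := kernel_weight_bound hα ht0 ht1
  have hp0 : 0 < p := hpq.pos
  have hq0 : 0 < q := hpq.symm.pos
  refine ⟨t, ENNReal.ofReal C₂ * C₁ ^ (1 / q), ENNReal.mul_lt_top (by simp)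
    (ENNReal.rpow_lt_top_of_nonneg (by positivity) hC₁.ne), fun u hu z hz => ?_⟩
  have hb := norm_snd_lt_one hα hz
  have ha := norm_fAlpha_lt_one hα hz
  have hU := measurableSet_thullenDomain hα
  have hm1 := measurable_varphiMap α z.2
  have hm2 := measurable_phiMap α (fAlpha α z)
  have hm3 : Measurable (kernel α z) := (measurable_kernel α).of_uncurry_left
  have hm4 := measurable_schurFun α t
  have hm5 := measurable_schurWeight α t (fAlpha α z) z.2
  have hG : Measurable fun w => ‖u z - u w‖ₑ * ‖kernel α z w‖ₑ * ENNReal.ofReal (schurFun α t w) := by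
    fun_prop
  have hJm : Measurable fun w : ℂ × ℂ => moebiusJac z.2 w.2 ^ (α + 2) := by
    unfold moebiusJac; fun_prop
  refine (lintegral_varphiMap hα hb hG).le.trans ((lintegral_phiMap hα ha
    (hJm.ennreal_ofReal.mul (hG.comp hm1))).le.trans ?_)
  set D : ℂ × ℂ → ℂ := fun w => u z - u (varphiMap α z.2 (phiMap α (fAlpha α z) w)) with hD
  have hDm : Measurable D := measurable_const.sub (hu.comp (hm1.comp hm2))
  set S := ENNReal.ofReal (schurFun α t z)
  calc _ ≤ ∫⁻ w in thullenDomain α, ENNReal.ofReal C₂ * S *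
        (‖D w‖ₑ * ENNReal.ofReal (schurWeight α t (fAlpha α z) z.2 w)) := by
        refine setLIntegral_mono' hU fun w hw => ?_
        have hw1 := norm_fst_lt_one hα hw
        have hv := norm_snd_lt_one hα (phiMap_mem hα ha hw)
        have hj := moebiusJac_pos ha hw1
        have hS := fibreScale_pos hα ha hw1
        have hj2 := moebiusJac_pos hb hv
        have hsf := schurFun_pos (t := t) hα hz
        simp only [Pi.mul_apply, Function.comp]
        rw [← ofReal_norm (kernel _ _ _)]
        set v := phiMap α (fAlpha α z) w
        calc ENNReal.ofReal (moebiusJac (fAlpha α z) w.1 ^ 2 * fibreScale α (fAlpha α z) w.1) *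
              (ENNReal.ofReal (moebiusJac z.2 v.2 ^ (α + 2)) *
                (‖D w‖ₑ * ENNReal.ofReal ‖kernel α z (varphiMap α z.2 v)‖ *
                  ENNReal.ofReal (schurFun α t (varphiMap α z.2 v))))
            = ‖D w‖ₑ * ENNReal.ofReal (moebiusJac (fAlpha α z) w.1 ^ 2 *
              fibreScale α (fAlpha α z) w.1 * (moebiusJac z.2 v.2 ^ (α + 2) *
              (‖kernel α z (varphiMap α z.2 v)‖ * schurFun α t (varphiMap α z.2 v)))) := by
              rw [ENNReal.ofReal_mul (p := moebiusJac (fAlpha α z) w.1 ^ 2 *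
                fibreScale α (fAlpha α z) w.1) (by positivity),
                ENNReal.ofReal_mul (p := moebiusJac z.2 v.2 ^ (α + 2)) (by positivity),
                ENNReal.ofReal_mul (norm_nonneg _)]
              ring
          _ ≤ ‖D w‖ₑ * ENNReal.ofReal (C₂ * schurFun α t z *
              schurWeight α t (fAlpha α z) z.2 w) :=
              mul_le_mul_right (ENNReal.ofReal_le_ofReal (hK z hz w hw)) _
          _ = _ := by
              rw [ENNReal.ofReal_mul (by positivity), ENNReal.ofReal_mul hC₂]
              ring
    _ = ENNReal.ofReal C₂ * S *
        ∫⁻ w in thullenDomain α, ‖D w‖ₑ * ENNReal.ofReal (schurWeight α t (fAlpha α z) z.2 w) :=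
        lintegral_const_mul _ (by fun_prop)
    -- Hölder: the hypothesis on u controls D in L^p, and the weight is bounded in L^q independently
    -- of z.
    _ ≤ ENNReal.ofReal C₂ * S * (eLpNorm D (ENNReal.ofReal p)
        (volume.restrict (thullenDomain α)) * C₁ ^ (1 / q)) := by
        gcongr ENNReal.ofReal C₂ * S * ?_
        refine (ENNReal.lintegral_mul_le_Lp_mul_Lq _ hpq (f := fun w => ‖D w‖ₑ)
          (g := fun w => ENNReal.ofReal (schurWeight α t (fAlpha α z) z.2 w))
          (by fun_prop) (by fun_prop)).trans ?_
        rw [eLpNorm_eq_lintegral_rpow_enorm_toReal (by simpa using hp0) (by simp),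
          ENNReal.toReal_ofReal hp0.le]
        gcongr
        refine le_trans (le_of_eq ?_) (hW (fAlpha α z) z.2 ha hb)
        refine setLIntegral_congr_fun hU fun w hw => ?_
        refine ENNReal.ofReal_rpow_of_nonneg ?_ hq0.le
        have hv := one_sub_sq_pos (norm_snd_lt_one hα (phiMap_mem hα ha hw))
        have hd := (defFun_pos_iff w).2 hw
        unfold schurWeight
        positivity
    _ = _ := by ring

/-! ### The Bergman space and its reproducing kernel -/

theorem isFiniteMeasure_thullenDomain {α : ℝ} (hα : 0 < α) :
    IsFiniteMeasure (volume.restrict (thullenDomain α)) :=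
  isFiniteMeasure_restrict.2 (volume_thullenDomain_lt_top hα).ne

theorem memLp_kernel {α : ℝ} (hα : 0 < α) {z : ℂ × ℂ} (hz : z ∈ thullenDomain α) (p : ℝ≥0∞) :
    MemLp (kernel α z) p (volume.restrict (thullenDomain α)) := by
  have := isFiniteMeasure_thullenDomain hα
  obtain ⟨C, hC⟩ := exists_norm_kernel_le hα hz
  have hm3 : Measurable (kernel α z) := (measurable_kernel α).of_uncurry_left
  exact MemLp.of_bound hm3.aestronglyMeasurable C
    ((ae_restrict_iff' (measurableSet_thullenDomain hα)).2 (Eventually.of_forall hC))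

/-- The kernel function at `z` as an element of the Bergman space. -/
noncomputable def kernelVec {α : ℝ} (hα : 0 < α) {z : ℂ × ℂ} (hz : z ∈ thullenDomain α) :
    bergmanSpace (thullenDomain α) :=
  ⟨(memLp_kernel hα hz 2).toLp _, kernel α z, differentiableOn_kernel hα hz, MemLp.coeFn_toLp _⟩

theorem inner_kernelVec {α : ℝ} (hα : 0 < α) {z : ℂ × ℂ} (hz : z ∈ thullenDomain α)
    (f : Lp ℂ 2 (volume.restrict (thullenDomain α))) :
    inner ℂ (kernelVec hα hz : Lp ℂ 2 (volume.restrict (thullenDomain α))) f =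
      ∫ w in thullenDomain α, conj (kernel α z w) * f w := by
  rw [L2.inner_def]
  refine integral_congr_ae ?_
  filter_upwards [(memLp_kernel hα hz 2).coeFn_toLp] with w hw
  rw [RCLike.inner_apply, kernelVec, hw, mul_comm]

theorem integral_conj_kernel_mul_eq {α : ℝ} (hα : 0 < α) {z : ℂ × ℂ} (hz : z ∈ thullenDomain α)
    (f : Lp ℂ 2 (volume.restrict (thullenDomain α))) {g : ℂ × ℂ → ℂ}
    (hg : DifferentiableOn ℂ g (thullenDomain α)) (hfg : f =ᵐ[volume.restrict (thullenDomain α)] g) :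
    ∫ w in thullenDomain α, conj (kernel α z w) * f w = g z := by
  have := isFiniteMeasure_thullenDomain hα
  have hgi : IntegrableOn g (thullenDomain α) :=
    (((Lp.memLp f).mono_exponent one_le_two).integrable le_rfl).congr hfg
  rw [← integral_conj_kernel_mul hα hg hgi hz]
  refine integral_congr_ae ?_
  filter_upwards [hfg] with w hw
  rw [hw]

/-- The Bergman projection is integration against the Bergman kernel. -/
theorem bergmanProjection_ae_eq {α : ℝ} (hα : 0 < α)
    (f : Lp ℂ 2 (volume.restrict (thullenDomain α))) :
    ∀ᵐ z ∂(volume.restrict (thullenDomain α)),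
      bergmanProjection (isOpen_thullenDomain hα) f z =
        ∫ w in thullenDomain α, conj (kernel α z w) * f w := by
  have hproj := hasOrthogonalProjection_bergmanSpace (isOpen_thullenDomain hα)
  have hdef : bergmanProjection (isOpen_thullenDomain hα) f =
    (bergmanSpace (thullenDomain α)).starProjection f := rfl
  obtain ⟨g, hg, hfg⟩ := Submodule.starProjection_apply_mem (bergmanSpace (thullenDomain α)) f
  rw [hdef]
  filter_upwards [hfg, ae_restrict_mem (measurableSet_thullenDomain hα)] with z hz hzU
  -- With k the kernel vector at z: Pf(z) = ⟨k, Pf⟩ = ⟨Pk, f⟩ = ⟨k, f⟩, since P is self-adjoint and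
  -- fixes k.
  rw [hz, ← integral_conj_kernel_mul_eq hα hzU _ hg hfg, ← inner_kernelVec hα hzU,
    ← inner_kernelVec hα hzU, ← Submodule.inner_starProjection_left_eq_right,
    Submodule.starProjection_eq_self_iff.2 (kernelVec hα hzU).2]

end Thullen

namespace Thullen

/-! ### Boundedness and density -/

theorem quasiMeasurePreserving_transport {α : ℝ} (hα : 0 < α) {z : ℂ × ℂ}
    (hz : z ∈ thullenDomain α) :
    Measure.QuasiMeasurePreserving
      (fun w => varphiMap α z.2 (phiMap α (fAlpha α z) w))
      (volume.restrict (thullenDomain α)) (volume.restrict (thullenDomain α)) :=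
  (quasiMeasurePreserving_varphiMap hα (norm_snd_lt_one hα hz)).comp
    (quasiMeasurePreserving_phiMap hα (norm_fAlpha_lt_one hα hz))

/-- Pointwise formula for the Hankel operator. -/
theorem hankel_ae_eq {α : ℝ} (hα : 0 < α) (u : ℂ × ℂ → ℂ)
    (f : (hankel (isOpen_thullenDomain hα) u).domain) :
    ∀ᵐ z ∂(volume.restrict (thullenDomain α)),
      hankel (isOpen_thullenDomain hα) u f z =
        ∫ w in thullenDomain α, (u z - u w) * conj (kernel α z w) *
          (f.1.1 : Lp ℂ 2 (volume.restrict (thullenDomain α))) w := by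
  have := isFiniteMeasure_thullenDomain hα
  have huf : MemLp (fun w => u w * (f.1.1 : Lp ℂ 2 (volume.restrict (thullenDomain α))) w) 2
    (volume.restrict (thullenDomain α)) := f.2
  have hH : hankel (isOpen_thullenDomain hα) u f =
    huf.toLp _ - bergmanProjection (isOpen_thullenDomain hα) (huf.toLp _) := rfl
  obtain ⟨g, hg, hfg⟩ := f.1.2
  rw [hH]
  filter_upwards [Lp.coeFn_sub (huf.toLp _) (bergmanProjection (isOpen_thullenDomain hα)
    (huf.toLp _)), bergmanProjection_ae_eq hα (huf.toLp _), huf.coeFn_toLp, hfg,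
    ae_restrict_mem (measurableSet_thullenDomain hα)] with z h1 h2 h3 h4 hz
  obtain ⟨C, hC⟩ := exists_norm_kernel_le hα hz
  have hm : AEStronglyMeasurable (fun w => conj (kernel α z w))
      (volume.restrict (thullenDomain α)) :=
    (Complex.continuous_conj.measurable.comp
      (measurable_kernel α).of_uncurry_left).aestronglyMeasurable
  have hb : ∀ᵐ w ∂(volume.restrict (thullenDomain α)), ‖conj (kernel α z w)‖ ≤ C := by
    filter_upwards [ae_restrict_mem (measurableSet_thullenDomain hα)] with w hw
    rw [RCLike.norm_conj]
    exact hC w hw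
  have hi1 := Integrable.bdd_mul (((Lp.memLp f.1.1).mono_exponent one_le_two).integrable le_rfl) hm hb
  have hi2 := Integrable.bdd_mul ((huf.mono_exponent one_le_two).integrable le_rfl) hm hb
  have e1 : ∫ w in thullenDomain α, conj (kernel α z w) * (huf.toLp _) w =
      ∫ w in thullenDomain α, conj (kernel α z w) *
        (u w * (f.1.1 : Lp ℂ 2 (volume.restrict (thullenDomain α))) w) := by
    refine integral_congr_ae ?_
    filter_upwards [huf.coeFn_toLp] with w hw
    rw [hw]
  -- Since f is holomorphic, f(z) is itself the kernel integral of f; this brings u(z) f(z) under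
  -- the same integral as P(uf)(z).
  rw [h1, Pi.sub_apply, h2, h3, h4, e1, ← integral_conj_kernel_mul_eq hα hz _ hg hfg,
    ← integral_const_mul, ← integral_sub (hi1.const_mul _) hi2]
  refine integral_congr_ae (Eventually.of_forall fun w => ?_)
  simp only
  ring

theorem exists_norm_hankel_le {α : ℝ} (hα : 0 < α) {p : ℝ} (hp : 4 < p) {u : ℂ × ℂ → ℂ}
    (hu : AEStronglyMeasurable u (volume.restrict (thullenDomain α))) {K : ℝ≥0∞} (hK : K < ∞)
    (h : ∀ z ∈ thullenDomain α,
      eLpNorm (fun w => u z - u (varphiMap α z.2 (phiMap α (fAlpha α z) w)))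
        (ENNReal.ofReal p) (volume.restrict (thullenDomain α)) ≤ K) :
    ∃ C : ℝ, ∀ f : (hankel (isOpen_thullenDomain hα) u).domain,
      ‖hankel (isOpen_thullenDomain hα) u f‖ ≤ C * ‖(f : bergmanSpace (thullenDomain α))‖ := by
  have hU := measurableSet_thullenDomain hα
  have hpq : p.HolderConjugate p.conjExponent := Real.HolderConjugate.conjExponent (by linarith)
  obtain ⟨t, C, hC, hS⟩ := exists_lintegral_schur_le hα hpq (by
    -- The conjugate exponent p/(p - 1) is below 4/3 exactly because p > 4.
    rw [Real.conjExponent, div_lt_div_iff₀ (by linarith) (by norm_num)]; linarith)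
  set μ := volume.restrict (thullenDomain α) with hμ
  -- The Schur estimate needs a measurable symbol. The representative v satisfies the same bound for
  -- almost every z, because the transport pulls null sets back to null sets.
  obtain ⟨v, hvs, huv⟩ := hu
  have hv := hvs.measurable
  have hmk := measurable_kernel α
  have hmh := measurable_schurFun α t
  have hsymm : ∀ z ∈ thullenDomain α, ∀ w ∈ thullenDomain α,
      ‖kernel α z w‖ₑ = ‖kernel α w z‖ₑ := fun z hz w hw => by
    rw [← conj_kernel hα hz hw, RCLike.enorm_conj]
  have h1 : ∀ᵐ z ∂μ, ∫⁻ w, ‖v z - v w‖ₑ * ‖kernel α z w‖ₑ * ENNReal.ofReal (schurFun α t w) ∂μ ≤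
      C * K * ENNReal.ofReal (schurFun α t z) := by
    filter_upwards [huv, ae_restrict_mem hU] with z hz hzU
    refine (hS v hv z hzU).trans ?_
    gcongr
    refine le_trans (le_of_eq ?_) (h z hzU)
    refine eLpNorm_congr_ae ?_
    filter_upwards [(quasiMeasurePreserving_transport hα hzU).ae huv] with w hw
    rw [hz, hw]
  -- The kernel is Hermitian, so the integrand is symmetric and the second Schur condition is the
  -- first with the variables exchanged.
  have h2 : ∀ᵐ w ∂μ, ∫⁻ z, ‖v z - v w‖ₑ * ‖kernel α z w‖ₑ * ENNReal.ofReal (schurFun α t z) ∂μ ≤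
      C * K * ENNReal.ofReal (schurFun α t w) := by
    filter_upwards [h1, ae_restrict_mem hU] with w hw hwU
    refine le_trans (le_of_eq ?_) hw
    refine setLIntegral_congr_fun hU fun z hz => ?_
    rw [hsymm z hz w hwU, ← neg_sub (v w), enorm_neg]
  have hpos : ∀ᵐ w ∂μ, ENNReal.ofReal (schurFun α t w) ≠ 0 := by
    filter_upwards [ae_restrict_mem hU] with w hw
    simpa using schurFun_pos hα hw
  refine ⟨(C * K).toReal, fun f => ?_⟩
  set F : Lp ℂ 2 μ := f.1.1 with hF
  have hFm : Measurable (F : ℂ × ℂ → ℂ) := (Lp.stronglyMeasurable F).measurable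
  have htest := schur_test (μ := μ) (M := fun z w => ‖v z - v w‖ₑ * ‖kernel α z w‖ₑ)
    (by simp only [Function.uncurry_def]; fun_prop) (h := fun w => ENNReal.ofReal (schurFun α t w)) (by fun_prop) hpos
    (Eventually.of_forall fun _ => ENNReal.ofReal_ne_top) h1 h2 (f := fun w => ‖F w‖ₑ) (by fun_prop)
  have hnorm : ∀ G : Lp ℂ 2 μ, ‖G‖ₑ ^ 2 = ∫⁻ w, ‖G w‖ₑ ^ 2 ∂μ := fun G => by
    rw [Lp.enorm_def]
    simpa using eLpNorm_nnreal_pow_eq_lintegral (f := G) (μ := μ) (p := 2) (by norm_num)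
  have hle : ‖hankel (isOpen_thullenDomain hα) u f‖ₑ ^ 2 ≤ (C * K * ‖F‖ₑ) ^ 2 := by
    rw [mul_pow, hnorm, hnorm]
    refine le_trans (lintegral_mono_ae ?_) htest
    filter_upwards [hankel_ae_eq hα u f, huv] with z hz hzv
    rw [hz]
    gcongr
    refine (enorm_integral_le_lintegral_enorm _).trans (le_of_eq (lintegral_congr_ae ?_))
    filter_upwards [huv] with w hw
    rw [enorm_mul, enorm_mul, RCLike.enorm_conj, hzv, hw]
  have hle2 : ‖hankel (isOpen_thullenDomain hα) u f‖ₑ ≤ C * K * ‖F‖ₑ :=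
    (ENNReal.pow_le_pow_left_iff two_ne_zero).1 hle
  have hfin : C * K * ‖F‖ₑ ≠ ∞ :=
    ENNReal.mul_ne_top (ENNReal.mul_ne_top hC.ne hK.ne) enorm_ne_top
  have := ENNReal.toReal_mono hfin hle2
  rwa [ENNReal.toReal_mul, toReal_enorm, toReal_enorm] at this

theorem neg_mem_thullenDomain_iff {α : ℝ} (w : ℂ × ℂ) :
    -w ∈ thullenDomain α ↔ w ∈ thullenDomain α :=
  mem_thullenDomain_iff_of_norm_eq (by simp) (by simp)

theorem measurePreserving_neg_thullenDomain {α : ℝ} (hα : 0 < α) :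
    MeasurePreserving (fun w : ℂ × ℂ => -w) (volume.restrict (thullenDomain α))
      (volume.restrict (thullenDomain α)) := by
  have h0 : (fun w : ℂ × ℂ => circleMap 0 1 Real.pi • w) = fun w => -w := by
    ext w <;> simp [circleMap]
  have h := (rot_mp Real.pi).restrict_preimage (measurableSet_thullenDomain hα)
  rw [h0] at h
  rwa [show (fun w : ℂ × ℂ => -w) ⁻¹' thullenDomain α = thullenDomain α from
    Set.ext neg_mem_thullenDomain_iff] at h

/-- At parameter 0 each of the two maps merely changes the sign of one coordinate. Hence the
hypothesis at z = 0 speaks of u itself, up to a reflection. -/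
theorem transport_zero {α : ℝ} (hα : 0 < α) {w : ℂ × ℂ} (hw : w ∈ thullenDomain α) :
    varphiMap α (0 : ℂ × ℂ).2 (phiMap α (fAlpha α 0) w) = -w := by
  have hx := norm_fst_lt_one hα hw
  have h1 := one_sub_rpow_pos hα hx
  have h2 := one_sub_sq_pos hx
  have hf : fAlpha α 0 = 0 := by simp [fAlpha]
  have hfac : phiFactor α 0 w.1 = 1 := by
    have : (1 - ‖w.1‖ ^ 2) * (1 - ‖w.1‖ ^ (2 / α)) / ((1 - ‖w.1‖ ^ (2 / α)) * (1 - ‖w.1‖ ^ 2)) = 1 := by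
      rw [mul_comm]; exact div_self (by positivity)
    simp [phiFactor, moebius, this]
  rw [hf, phiMap_eq, hfac, varphiMap_eq]
  ext <;> simp [moebius, varphiFactor]

/-- The reflection preserves the measure, and on a finite measure space constants lie in L^p and L^p
lies in L² for p ≥ 2. -/
theorem memLp_two_of_bound {α : ℝ} (hα : 0 < α) {p : ℝ≥0∞} (hp : 2 ≤ p) {u : ℂ × ℂ → ℂ}
    (hu : AEStronglyMeasurable u (volume.restrict (thullenDomain α)))
    (h : eLpNorm (fun w => u 0 - u (varphiMap α (0 : ℂ × ℂ).2 (phiMap α (fAlpha α 0) w)))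
        p (volume.restrict (thullenDomain α)) < ∞) :
    MemLp u 2 (volume.restrict (thullenDomain α)) := by
  have := isFiniteMeasure_thullenDomain hα
  have hneg := measurePreserving_neg_thullenDomain hα
  have hun : AEStronglyMeasurable (fun w => u (-w)) (volume.restrict (thullenDomain α)) :=
    hu.comp_quasiMeasurePreserving hneg.quasiMeasurePreserving
  have h1 : MemLp (fun w => u 0 - u (-w)) p (volume.restrict (thullenDomain α)) := by
    refine ⟨aestronglyMeasurable_const.sub hun, ?_⟩
    rw [eLpNorm_congr_ae (g := fun w =>
      u 0 - u (varphiMap α (0 : ℂ × ℂ).2 (phiMap α (fAlpha α 0) w)))]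
    · exact h
    · filter_upwards [ae_restrict_mem (measurableSet_thullenDomain hα)] with w hw
      rw [transport_zero hα hw]
  have h2 : MemLp (fun w => u (-w)) p (volume.restrict (thullenDomain α)) := by
    have := (memLp_const (u 0)).sub h1
    refine this.ae_eq (Eventually.of_forall fun w => ?_)
    simp
  have h3 := (h2.comp_measurePreserving hneg).mono_exponent hp
  refine h3.ae_eq (Eventually.of_forall fun w => ?_)
  simp

theorem kernelVec_mem_mulDomain {α : ℝ} (hα : 0 < α) {u : ℂ × ℂ → ℂ}
    (hu : MemLp u 2 (volume.restrict (thullenDomain α))) {z : ℂ × ℂ} (hz : z ∈ thullenDomain α) :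
    kernelVec hα hz ∈ mulDomain (thullenDomain α) u := by
  have h1 : MemLp (fun w => u w * kernel α z w) 2 (volume.restrict (thullenDomain α)) := by
    have := MemLp.mul (p := 2) (q := ∞) (r := 2) (memLp_kernel hα hz ∞) hu
    exact this
  refine (memLp_congr_ae ?_).2 h1
  filter_upwards [(memLp_kernel hα hz 2).coeFn_toLp] with w hw
  rw [kernelVec, hw]

/-- The kernel vectors already lie in the domain, and orthogonality to the one at z forces the
holomorphic representative to vanish at z. -/
theorem dense_mulDomain {α : ℝ} (hα : 0 < α) {u : ℂ × ℂ → ℂ}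
    (hu : MemLp u 2 (volume.restrict (thullenDomain α))) :
    Dense (mulDomain (thullenDomain α) u : Set (bergmanSpace (thullenDomain α))) := by
  have : CompleteSpace (bergmanSpace (thullenDomain α)) :=
    (isClosed_bergmanSpace (isOpen_thullenDomain hα)).completeSpace_coe
  rw [Submodule.dense_iff_topologicalClosure_eq_top, Submodule.topologicalClosure_eq_top_iff,
    Submodule.eq_bot_iff]
  intro f hf
  rw [Submodule.mem_orthogonal] at hf
  obtain ⟨g, hg, hfg⟩ := f.2
  refine Subtype.ext (Lp.ext ?_)
  refine hfg.trans (EventuallyEq.trans ?_ (Lp.coeFn_zero ℂ 2 _).symm)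
  filter_upwards [ae_restrict_mem (measurableSet_thullenDomain hα)] with z hz
  have h1 := hf _ (kernelVec_mem_mulDomain hα hu hz)
  rw [Submodule.coe_inner, inner_kernelVec, integral_conj_kernel_mul_eq hα hz _ hg hfg] at h1
  exact h1

end Thullen

/-! ### The theorem: dense domain and bounded extension -/

theorem corollary3p3 (α : ℝ) (hα : 0 < α) (hα1 : α ≠ 1) (p : ℝ≥0∞) (hp : 4 < p)
    (u : ℂ × ℂ → ℂ)
    (hu : AEStronglyMeasurable u (volume.restrict (Thullen.thullenDomain α)))
    (h : ⨆ z ∈ Thullen.thullenDomain α,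
      eLpNorm (fun w => u z - u (Thullen.varphiMap α z.2 (Thullen.phiMap α (Thullen.fAlpha α z) w)))
        p (volume.restrict (Thullen.thullenDomain α)) < ∞) :
    Dense ((Thullen.hankel (Thullen.isOpen_thullenDomain hα) u).domain :
        Set (Thullen.bergmanSpace (Thullen.thullenDomain α))) ∧
      ∃ H : Thullen.bergmanSpace (Thullen.thullenDomain α) →L[ℂ]
          Lp ℂ 2 (volume.restrict (Thullen.thullenDomain α)),
        ∀ f : (Thullen.hankel (Thullen.isOpen_thullenDomain hα) u).domain,
          H f = Thullen.hankel (Thullen.isOpen_thullenDomain hα) u f := by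
  have hpos : (0 : ℝ≥0∞) < 4 := by norm_num
  have := Thullen.isFiniteMeasure_thullenDomain hα
  have hz0 : (0 : ℂ × ℂ) ∈ Thullen.thullenDomain α :=
    Thullen.mk_zero_mem_thullenDomain hα (by simp)
  have hle : ∀ z ∈ Thullen.thullenDomain α, eLpNorm (fun w =>
      u z - u (Thullen.varphiMap α z.2 (Thullen.phiMap α (Thullen.fAlpha α z) w)))
        p (volume.restrict (Thullen.thullenDomain α)) ≤ _ := fun z hz =>
    le_iSup₂ (f := fun z (_ : z ∈ Thullen.thullenDomain α) => eLpNorm (fun w =>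
      u z - u (Thullen.varphiMap α z.2 (Thullen.phiMap α (Thullen.fAlpha α z) w)))
        p (volume.restrict (Thullen.thullenDomain α))) z hz
  have hu2 := Thullen.memLp_two_of_bound hα
    ((show (2 : ℝ≥0∞) ≤ 4 by norm_num).trans hp.le) hu ((hle 0 hz0).trans_lt h)
  have hdense := Thullen.dense_mulDomain hα hu2
  refine ⟨hdense, ?_⟩
  -- The Hölder argument needs a finite exponent. Some r with 4 < r < p serves for p = ∞ as well,
  -- and passing from L^p to L^r costs only a power of the finite volume.
  obtain ⟨r, hr1, hr2⟩ := exists_between hp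
  have hrt : r ≠ ∞ := (hr2.trans_le le_top).ne
  have hr4 : 4 < r.toReal := by
    have := (ENNReal.toReal_lt_toReal (by norm_num) hrt).2 hr1
    simpa using this
  obtain ⟨C, hC⟩ := Thullen.exists_norm_hankel_le hα hr4 hu (K := (⨆ z ∈ Thullen.thullenDomain α,
      eLpNorm (fun w => u z - u (Thullen.varphiMap α z.2 (Thullen.phiMap α (Thullen.fAlpha α z) w)))
        p (volume.restrict (Thullen.thullenDomain α))) *
      (volume.restrict (Thullen.thullenDomain α)) univ ^ (1 / r.toReal - 1 / p.toReal))
    (by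
      refine ENNReal.mul_lt_top h (ENNReal.rpow_lt_top_of_nonneg ?_ (measure_ne_top _ _))
      rcases eq_or_ne p ∞ with rfl | hpt
      · simp
      · rw [sub_nonneg]
        exact one_div_le_one_div_of_le (by linarith)
          ((ENNReal.toReal_le_toReal hrt hpt).2 hr2.le))
    (fun z hz => by
      rw [ENNReal.ofReal_toReal hrt]
      refine (eLpNorm_le_eLpNorm_mul_rpow_measure_univ hr2.le
        (aestronglyMeasurable_const.sub (hu.comp_quasiMeasurePreserving
          (Thullen.quasiMeasurePreserving_transport hα hz)))).trans ?_
      gcongr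
      exact hle z hz)
  -- The norm bound on a dense domain gives the bounded extension, L² being complete.
  refine ⟨(Thullen.hankel (Thullen.isOpen_thullenDomain hα) u).toFun.extendOfNorm
    (Thullen.hankel (Thullen.isOpen_thullenDomain hα) u).domain.subtype, fun f => ?_⟩
  exact LinearMap.extendOfNorm_eq (f := (Thullen.hankel (Thullen.isOpen_thullenDomain hα) u).toFun)
    (e := (Thullen.hankel (Thullen.isOpen_thullenDomain hα) u).domain.subtype)
    (by
      rw [DenseRange, Submodule.coe_subtype, Subtype.range_coe]
      exact hdense) ⟨C, hC⟩ f
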